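/- Let $n\ge 0$ be an integer, $\mathbf n=\{1,\dots,n\}$, and let $\Bbbk$ be a field. **Monoids.** Let $P_n$ be the partition monoid: its elements are the set partitions of $\mathbf n\sqcup\mathbf n'$, with the usual composition of partitions, $\rho\pi$ meaning "first $\pi$, then $\rho$". The symmetric group $S_n$ embeds in $P_n$ by sending $\sigma$ to the partition with parts $\{x,\sigma(x)'\}$. The dual symmetric inverse monoid $I_n^*\subseteq P_n$ consists of the partitions each of whose parts meets both $\mathbf n$ and $\mathbf n'$. Its maximal factorizable submonoid is $F_n^*=\{\sigma e:\sigma\in S_n,\ e\in I_n^*,\ e^2=e\}$. Its natural partial order is: $s\le t$ iff $s=et$ for some idempotent $e$, equivalently iff every part of $t$ is contained in a part of $s$. **2-categories.** The 2-category $\mathcal B_n$ has one object and the elements of $S_n$ as 1-morphisms, composed as in $S_n$; the 2-morphisms $\pi\Rightarrow\sigma$ are the $\alpha\in I_n^*$ such that all parts of $\pi$ and of $\sigma$ are contained in parts of $\alpha$; vertical composition is the join of partitions (the finest common coarsening), and horizontal composition is multiplication in $I_n^*$. The 2-category $\mathcal S_{F_n^*}$ has one object and the elements of $F_n^*$ as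 1-morphisms, composed as in $F_n^*$; there is exactly one 2-morphism $s\Rightarrow t$ if $s\le t$, and none otherwise. For a 2-category $\mathcal C$ with finitely many 2-morphisms, $\Bbbk\mathcal C$ is the bicategory with the same objects in which $\Bbbk\mathcal C(i,j)$ is the idempotent completion of the additive closure of the $\Bbbk$-linearization of $\mathcal C(i,j)$ (1-morphisms: finite direct sums of 1-morphisms of $\mathcal C$, and their formal direct summands; 2-morphisms: matrices of $\Bbbk$-linear combinations of 2-morphisms of $\mathcal C$), with the induced compositions. The bicategory $\overline{\Bbbk\mathcal B_n}$ has as objects the pairs $(i,\varepsilon)$, where $i$ is an object of $\Bbbk\mathcal B_n$ and $\varepsilon$ is a primitive idempotent of the commutative algebra $\mathrm{End}(\mathbb 1_i)$. Its 1-morphisms $(i,\varepsilon)\to(j,\delta)$ are the 1-morphisms $i\to j$ of $\Bbbk\mathcal B_n$, and $\mathrm{Hom}_{\overline{\Bbbk\mathcal B_n}}(F,G)=\delta\circ_0\mathrm{Hom}_{\Bbbk\mathcal B_n}(F,G)\circ_0\varepsilon$. The identity 1-morphism of $(i,\varepsilon)$ is $\mathbb 1_i$. The composite of $F:(i,\varepsilon)\to(j,\delta)$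 and $G:(j,\delta)\to(k,\varepsilon')$ is the 1-morphism $G'\circ F'$, where $F'$ and $G'$ are the direct summands of $F$ and $G$ cut out by the idempotents $\delta\circ_0\mathrm{id}_F\circ_0\varepsilon$ and $\varepsilon'\circ_0\mathrm{id}_G\circ_0\delta$; horizontal composition of 2-morphisms is induced from $\Bbbk\mathcal B_n$. **Decategorification.** For a bicategory $\mathcal C$ with additive morphism categories and biadditive composition, let $[\mathcal C(i,j)]_\oplus$ be the split Grothendieck group of $\mathcal C(i,j)$. The decategorification of $\mathcal C$ is $A_{\mathcal C}=\bigoplus_{i,j}[\mathcal C(i,j)]_\oplus$, the sum being over all pairs of objects, with the multiplication $[G][F]=[G\circ F]$ if $F$ and $G$ are composable and $[G][F]=0$ otherwise. **Möbius basis.** For $s\in F_n^*$ let $\ker s$ be the partition of $\mathbf n$ induced by $s$, let $\mu$ be the Möbius function of the lattice of partitions of $\mathbf n$ ordered by refinement (finer partitions being smaller), and put $$\underline s=\sum_{t\le s}\mu(\ker s,\ker t)\,t\in\mathbb Z[F_n^*].$$ **Theorem.** The elements $\underline s$, $s\in F_n^*$, form a $\mathbb Z$-basis of the semigroup algebra $\mathbb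 Z[F_n^*]$, and there are ring isomorphisms $$A_{\overline{\Bbbk\mathcal B_n}}\ \cong\ \mathbb Z[F_n^*]\ \cong\ A_{\Bbbk\mathcal S_{F_n^*}}.$$ The first can be chosen so that the set of classes of indecomposable 1-morphisms of $\overline{\Bbbk\mathcal B_n}$ corresponds to the basis $\{\underline s: s\in F_n^*\}$. The second can be chosen so that the class of the 1-morphism $s$ corresponds to $s$, for every $s\in F_n^*$, and so that the set of classes of indecomposable 1-morphisms of $\Bbbk\mathcal S_{F_n^*}$ corresponds to the basis $F_n^*$. -/

import Mathlib

/-! ### The partition monoid and its submonoids `I*_n` and `F*_n` -/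

namespace FiatCat

open CategoryTheory

theorem setoid_map_le_iff {α β : Type*} (f : α → β) (r : Setoid α) (s : Setoid β) :
    r.map f ≤ s ↔ r ≤ s.comap f := by
  constructor
  · intro h a b hab
    exact h (Relation.EqvGen.rel _ _ ⟨a, b, hab, rfl, rfl⟩)
  · intro h x y hxy
    induction hxy with
    | rel x y h' => obtain ⟨a, b, hab, rfl, rfl⟩ := h'; exact h hab
    | refl x => exact s.refl' x
    | symm x y _ ih => exact s.symm' ih
    | trans x y z _ _ ih1 ih2 => exact s.trans' ih1 ih2

theorem setoid_map_mk {α β : Type*} (f : α → β) (r : Setoid α) {a b : α} (h : r a b) :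
    r.map f (f a) (f b) :=
  (setoid_map_le_iff f r _).1 le_rfl h

theorem setoid_map_mono {α β : Type*} (f : α → β) {r s : Setoid α} (h : r ≤ s) :
    r.map f ≤ s.map f :=
  (setoid_map_le_iff f r _).2 fun _ _ hab => setoid_map_mk f s (h hab)

theorem setoid_map_map {α β γ : Type*} (f : α → β) (g : β → γ) (r : Setoid α) :
    (r.map f).map g = r.map (g ∘ f) := by
  apply le_antisymm
  · rw [setoid_map_le_iff, setoid_map_le_iff]
    intro a b h
    exact setoid_map_mk (g ∘ f) r h
  · rw [setoid_map_le_iff]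
    intro a b h
    exact setoid_map_mk g _ (setoid_map_mk f r h)

theorem setoid_map_sup {α β : Type*} (f : α → β) (r s : Setoid α) :
    (r ⊔ s).map f = r.map f ⊔ s.map f := by
  apply le_antisymm
  · rw [setoid_map_le_iff]
    refine sup_le ?_ ?_
    · rw [← setoid_map_le_iff]; exact le_sup_left
    · rw [← setoid_map_le_iff]; exact le_sup_right
  · exact sup_le (setoid_map_mono f le_sup_left) (setoid_map_mono f le_sup_right)

theorem setoid_map_inj {α β : Type*} (f : α → β) (hf : Function.Injective f) (r : Setoid α)
    {x y : β} (h : r.map f x y) : x = y ∨ ∃ a b, r a b ∧ f a = x ∧ f b = y := by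
  induction h with
  | rel x y h' => exact Or.inr h'
  | refl x => exact Or.inl rfl
  | symm x y _ ih =>
    rcases ih with rfl | ⟨a, b, hab, rfl, rfl⟩
    · exact Or.inl rfl
    · exact Or.inr ⟨b, a, r.symm' hab, rfl, rfl⟩
  | trans x y z _ _ ih1 ih2 =>
    rcases ih1 with rfl | ⟨a, b, hab, rfl, rfl⟩
    · exact ih2
    · rcases ih2 with rfl | ⟨a', b', hab', h1, rfl⟩
      · exact Or.inr ⟨a, b, hab, rfl, rfl⟩
      · obtain rfl := hf h1
        exact Or.inr ⟨a, b', r.trans' hab hab', rfl, rfl⟩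

theorem setoid_comap_sup_map {V W : Type*} (f : W → V) (r : Setoid V) (s : Setoid W) :
    (r ⊔ s.map f).comap f = r.comap f ⊔ s := by
  apply le_antisymm
  · let t : Setoid W := r.comap f ⊔ s
    let E : Setoid V :=
      { r := fun x y => r x y ∨ ∃ w w', r x (f w) ∧ t w w' ∧ r (f w') y
        iseqv :=
          { refl := fun x => Or.inl (r.refl' x)
            symm := by
              rintro x y (h | ⟨w, w', h1, h2, h3⟩)
              · exact Or.inl (r.symm' h)
              · exact Or.inr ⟨w', w, r.symm' h3, t.symm' h2, r.symm' h1⟩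
            trans := by
              rintro x y z (h | ⟨w, w', h1, h2, h3⟩) (k | ⟨v, v', k1, k2, k3⟩)
              · exact Or.inl (r.trans' h k)
              · exact Or.inr ⟨v, v', r.trans' h k1, k2, k3⟩
              · exact Or.inr ⟨w, w', h1, h2, r.trans' h3 k⟩
              · refine Or.inr ⟨w, v', h1, t.trans' h2 (t.trans' ?_ k2), k3⟩
                exact (le_sup_left : r.comap f ≤ t) (r.trans' h3 k1) } }
    have hE : r ⊔ s.map f ≤ E := by
      refine sup_le (fun x y h => Or.inl h) ?_
      rw [setoid_map_le_iff]
      intro a b h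
      exact Or.inr ⟨a, b, r.refl' _, (le_sup_right : s ≤ t) h, r.refl' _⟩
    intro a b h
    rcases hE h with h | ⟨w, w', h1, h2, h3⟩
    · exact (le_sup_left : r.comap f ≤ t) h
    · exact t.trans' ((le_sup_left : r.comap f ≤ t) h1)
        (t.trans' h2 ((le_sup_left : r.comap f ≤ t) h3))
  · refine sup_le (fun a b h => (le_sup_left : r ≤ r ⊔ s.map f) h) ?_
    rw [← setoid_map_le_iff]
    exact le_sup_right

theorem setoid_comap_map {P A B V : Type*} (f : A → V) (g : B → V) (p : P → A) (q : P → B)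
    (hf : Function.Injective f) (hg : Function.Injective g) (hpq : ∀ x, f (p x) = g (q x))
    (h : ∀ a b, f a = g b → ∃ x, p x = a ∧ q x = b) (S : Setoid A) :
    (S.map f).comap g = (S.comap p).map q := by
  apply le_antisymm
  · intro b b' hb
    rcases setoid_map_inj f hf S hb with hb | ⟨a, a', haa, h1, h2⟩
    · rw [hg hb]
    · obtain ⟨x, rfl, rfl⟩ := h _ _ h1
      obtain ⟨y, rfl, rfl⟩ := h _ _ h2
      exact setoid_map_mk q (S.comap p) haa
  · rw [setoid_map_le_iff]
    intro x y hxy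
    change (S.map f) (g (q x)) (g (q y))
    rw [← hpq, ← hpq]
    exact setoid_map_mk f S hxy

/-- Elements of the partition monoid `P_n`: set partitions, encoded as equivalence relations, of
`{1, …, n} ⊔ {1', …, n'}`.  Here `Sum.inl x` stands for `x` and `Sum.inr x` for `x'`.  The order is
refinement: `ρ ≤ τ` means that every part of `ρ` is contained in a part of `τ`. -/
abbrev PartitionMonoid (n : ℕ) : Type := Setoid (Fin n ⊕ Fin n)

namespace PartitionMonoid

variable {n : ℕ}

/-- `{1, …, n} ⊔ {1', …, n'} ⊔ {1'', …, n''}`. -/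
abbrev Three (n : ℕ) : Type := Fin n ⊕ Fin n ⊕ Fin n

/-- `x ↦ x`, `x' ↦ x'`. -/
def lower : Fin n ⊕ Fin n → Three n := Sum.elim Sum.inl (Sum.inr ∘ Sum.inl)
/-- `x ↦ x'`, `x' ↦ x''`. -/
def upper : Fin n ⊕ Fin n → Three n := Sum.elim (Sum.inr ∘ Sum.inl) (Sum.inr ∘ Sum.inr)
/-- `x ↦ x`, `x' ↦ x''`. -/
def outer : Fin n ⊕ Fin n → Three n := Sum.elim Sum.inl (Sum.inr ∘ Sum.inr)

/-- The finest partition of the three-level set such that all parts of `π` (on the levels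
`x, x'`) and all parts of `ρ` (on the levels `x', x''`) are contained in its parts. -/
def stack (ρ π : PartitionMonoid n) : Setoid (Three n) :=
  Setoid.map (r := π) lower ⊔ Setoid.map (r := ρ) upper

/-- Composition of partitions: restrict `stack ρ π` to the levels `x, x''` and rename. -/
instance : Mul (PartitionMonoid n) :=
  ⟨fun ρ π => Setoid.comap outer (stack ρ π)⟩

/-- The permutation `σ`, viewed as the partition with parts `{x, σ(x)'}`. -/
@[reducible] def ofPerm (σ : Equiv.Perm (Fin n)) : PartitionMonoid n :=
  Setoid.ker (Sum.elim σ id : Fin n ⊕ Fin n → Fin n)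

instance : One (PartitionMonoid n) := ⟨ofPerm 1⟩

theorem mul_def (ρ π : PartitionMonoid n) : ρ * π = Setoid.comap outer (stack ρ π) := rfl

theorem stack_le_iff (ρ π : PartitionMonoid n) (s : Setoid (Three n)) :
    stack ρ π ≤ s ↔ (π : Setoid _) ≤ s.comap lower ∧ (ρ : Setoid _) ≤ s.comap upper := by
  unfold stack
  rw [sup_le_iff, setoid_map_le_iff, setoid_map_le_iff]

theorem stack_lower (ρ π : PartitionMonoid n) {a b : Fin n ⊕ Fin n}
    (h : (π : Setoid _) a b) : stack ρ π (lower a) (lower b) :=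
  ((stack_le_iff ρ π _).1 le_rfl).1 h

theorem stack_upper (ρ π : PartitionMonoid n) {a b : Fin n ⊕ Fin n}
    (h : (ρ : Setoid _) a b) : stack ρ π (upper a) (upper b) :=
  ((stack_le_iff ρ π _).1 le_rfl).2 h

protected theorem mul_assoc (ω ρ π : PartitionMonoid n) : ω * ρ * π = ω * (ρ * π) := by
  let e123 : Three n → Fin n ⊕ Three n := Sum.elim Sum.inl
    (Sum.elim (Sum.inr ∘ Sum.inl) (Sum.inr ∘ Sum.inr ∘ Sum.inl))
  let e234 : Three n → Fin n ⊕ Three n := Sum.inr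
  let e134 : Three n → Fin n ⊕ Three n := Sum.elim Sum.inl (Sum.inr ∘ Sum.inr)
  let e124 : Three n → Fin n ⊕ Three n := Sum.elim Sum.inl
    (Sum.elim (Sum.inr ∘ Sum.inl) (Sum.inr ∘ Sum.inr ∘ Sum.inr))
  have i123 : Function.Injective e123 := by
    rintro (a | a | a) (b | b | b) h <;> simp_all [e123]
  have i234 : Function.Injective e234 := Sum.inr_injective
  have i134 : Function.Injective e134 := by
    rintro (a | a | a) (b | b | b) h <;> simp_all [e134]
  have i124 : Function.Injective e124 := by
    rintro (a | a | a) (b | b | b) h <;> simp_all [e124]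
  have key1 : stack ω (ρ * π) =
      Setoid.comap e134 (Setoid.map (r := stack ρ π) e123 ⊔
        Setoid.map (r := Setoid.map (r := ω) upper) e134) := by
    rw [setoid_comap_sup_map, setoid_comap_map e123 e134 outer lower i123 i134]
    · rfl
    · rintro (a | a) <;> rfl
    · rintro (a | a | a) (b | b | b) h <;> simp [e123, e134] at h <;> subst h
      · exact ⟨Sum.inl a, rfl, rfl⟩
      · exact ⟨Sum.inr a, rfl, rfl⟩
  have key2 : stack (ω * ρ) π =
      Setoid.comap e124 (Setoid.map (r := stack ω ρ) e234 ⊔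
        Setoid.map (r := Setoid.map (r := π) lower) e124) := by
    rw [setoid_comap_sup_map, setoid_comap_map e234 e124 outer upper i234 i124]
    · exact sup_comm _ _
    · rintro (a | a) <;> rfl
    · rintro (a | a | a) (b | b | b) h <;> simp [e234, e124] at h <;> subst h
      · exact ⟨Sum.inl a, rfl, rfl⟩
      · exact ⟨Sum.inr a, rfl, rfl⟩
  have h12 : e124 ∘ lower = e123 ∘ (lower (n := n)) := by ext (a | a) <;> rfl
  have h34 : e134 ∘ upper = e234 ∘ (upper (n := n)) := by ext (a | a) <;> rfl
  have h23 : e123 ∘ upper = e234 ∘ (lower (n := n)) := by ext (a | a) <;> rfl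
  have ho : e124 ∘ outer = e134 ∘ (outer (n := n)) := by ext (a | a) <;> rfl
  have heq : Setoid.map (r := stack ρ π) e123 ⊔ Setoid.map (r := Setoid.map (r := ω) upper) e134 =
      Setoid.map (r := stack ω ρ) e234 ⊔ Setoid.map (r := Setoid.map (r := π) lower) e124 := by
    unfold stack
    simp only [setoid_map_sup, setoid_map_map, h12, h34, h23]
    exact (sup_comm _ _).trans ((congrArg _ (sup_comm _ _)).trans
      ((sup_assoc _ _ _).symm.trans (congrArg (· ⊔ _) (sup_comm _ _))))
  rw [mul_def (ω * ρ) π, mul_def ω (ρ * π), key1, key2, heq]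
  exact (Setoid.comap_comp _ e124 outer).symm.trans
    ((congrArg (fun f => Setoid.comap f _) ho).trans (Setoid.comap_comp _ e134 outer))

theorem ofPerm_mul_eq (σ : Equiv.Perm (Fin n)) (ρ : PartitionMonoid n) :
    ofPerm σ * ρ = Setoid.comap (Sum.map id σ.symm) ρ := by
  let c : Three n → Fin n ⊕ Fin n := Sum.elim Sum.inl (Sum.elim Sum.inr (Sum.inr ∘ σ.symm))
  have h1 : stack (ofPerm σ) ρ ≤ Setoid.comap c ρ := by
    rw [stack_le_iff]
    refine ⟨?_, ?_⟩
    · rintro (a | a) (b | b) h <;> exact h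
    · rintro (a | a) (b | b) h <;> replace h : _ = _ := h <;>
        simp only [Sum.elim_inl, Sum.elim_inr, id, EmbeddingLike.apply_eq_iff_eq] at h <;>
        subst h <;> simp [Setoid.comap_rel, upper, c]
  have h2 : ∀ t, stack (ofPerm σ) ρ t (lower (c t)) := by
    rintro (a | a | a)
    · exact Setoid.refl' _ _
    · exact Setoid.refl' _ _
    · refine Setoid.symm' _ (stack_upper (ofPerm σ) ρ (a := Sum.inl (σ.symm a)) (b := Sum.inr a) ?_)
      exact (Equiv.apply_symm_apply σ a)
  rw [mul_def]
  ext a b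
  have hc : ∀ a, c (outer a) = Sum.map id σ.symm a := by rintro (a | a) <;> rfl
  rw [Setoid.comap_rel outer, Setoid.comap_rel (Sum.map _ _), ← hc, ← hc]
  constructor
  · intro h; exact h1 h
  · intro h
    exact Setoid.trans' _ (h2 _) (Setoid.trans' _ (stack_lower _ _ h) (Setoid.symm' _ (h2 _)))

theorem mul_ofPerm_eq (σ : Equiv.Perm (Fin n)) (ρ : PartitionMonoid n) :
    ρ * ofPerm σ = Setoid.comap (Sum.map σ id) ρ := by
  let c : Three n → Fin n ⊕ Fin n := Sum.elim (Sum.inl ∘ σ) id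
  have h1 : stack ρ (ofPerm σ) ≤ Setoid.comap c ρ := by
    rw [stack_le_iff]
    refine ⟨?_, ?_⟩
    · rintro (a | a) (b | b) h <;> replace h : _ = _ := h <;>
        simp only [Sum.elim_inl, Sum.elim_inr, id, EmbeddingLike.apply_eq_iff_eq] at h <;>
        subst h <;> simp [Setoid.comap_rel, lower, c]
    · rintro (a | a) (b | b) h <;> exact h
  have h2 : ∀ t, stack ρ (ofPerm σ) t (upper (c t)) := by
    rintro (a | a | a)
    · refine (stack_lower ρ (ofPerm σ) (a := Sum.inl a) (b := Sum.inr (σ a)) ?_)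
      exact rfl
    · exact Setoid.refl' _ _
    · exact Setoid.refl' _ _
  rw [mul_def]
  ext a b
  have hc : ∀ a, c (outer a) = Sum.map σ id a := by rintro (a | a) <;> rfl
  rw [Setoid.comap_rel outer, Setoid.comap_rel (Sum.map _ _), ← hc, ← hc]
  constructor
  · intro h; exact h1 h
  · intro h
    exact Setoid.trans' _ (h2 _) (Setoid.trans' _ (stack_upper _ _ h) (Setoid.symm' _ (h2 _)))

instance : Monoid (PartitionMonoid n) where
  mul_assoc := PartitionMonoid.mul_assoc
  one_mul ρ := by
    refine (ofPerm_mul_eq 1 ρ).trans ?_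
    have : (Sum.map id (Equiv.symm (1 : Equiv.Perm (Fin n))) : Fin n ⊕ Fin n → _) = id := by ext (a | a) <;> rfl
    rw [this]; rfl
  mul_one ρ := by
    refine (mul_ofPerm_eq 1 ρ).trans ?_
    have : (Sum.map (1 : Equiv.Perm (Fin n)) id : Fin n ⊕ Fin n → _) = id := by
      ext (a | a) <;> rfl
    rw [this]; rfl

theorem ofPerm_one : ofPerm (1 : Equiv.Perm (Fin n)) = 1 := rfl

theorem ofPerm_mul (σ τ : Equiv.Perm (Fin n)) : ofPerm (σ * τ) = ofPerm σ * ofPerm τ := by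
  rw [mul_ofPerm_eq]
  ext (a | a) (b | b) <;> rfl

theorem ofPerm_mul_inv (σ : Equiv.Perm (Fin n)) : ofPerm σ * ofPerm σ⁻¹ = 1 := by
  rw [← ofPerm_mul, mul_inv_cancel, ofPerm_one]

theorem ofPerm_inv_mul (σ : Equiv.Perm (Fin n)) : ofPerm σ⁻¹ * ofPerm σ = 1 := by
  rw [← ofPerm_mul, inv_mul_cancel, ofPerm_one]

theorem mul_mono {ρ ρ' π π' : PartitionMonoid n} (h : ρ ≤ ρ') (k : π ≤ π') :
    ρ * π ≤ ρ' * π' := by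
  have : stack ρ π ≤ stack ρ' π' :=
    (stack_le_iff ρ π _).2 ⟨fun _ _ hab => stack_lower _ _ (k hab),
      fun _ _ hab => stack_upper _ _ (h hab)⟩
  intro a b hab
  exact this hab

theorem ofPerm_mul_sup (σ : Equiv.Perm (Fin n)) (a b : PartitionMonoid n) :
    ofPerm σ * (a ⊔ b) = ofPerm σ * a ⊔ ofPerm σ * b := by
  apply le_antisymm
  · have h : a ⊔ b ≤ ofPerm σ⁻¹ * (ofPerm σ * a ⊔ ofPerm σ * b) := by
      refine sup_le ?_ ?_
      · calc a = ofPerm σ⁻¹ * (ofPerm σ * a) := by rw [← mul_assoc, ofPerm_inv_mul, one_mul]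
          _ ≤ _ := mul_mono le_rfl le_sup_left
      · calc b = ofPerm σ⁻¹ * (ofPerm σ * b) := by rw [← mul_assoc, ofPerm_inv_mul, one_mul]
          _ ≤ _ := mul_mono le_rfl le_sup_right
    calc ofPerm σ * (a ⊔ b) ≤ ofPerm σ * (ofPerm σ⁻¹ * (ofPerm σ * a ⊔ ofPerm σ * b)) :=
          mul_mono le_rfl h
      _ = _ := by rw [← mul_assoc, ofPerm_mul_inv, one_mul]
  · exact sup_le (mul_mono le_rfl le_sup_left) (mul_mono le_rfl le_sup_right)

theorem sup_mul_ofPerm (σ : Equiv.Perm (Fin n)) (a b : PartitionMonoid n) :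
    (a ⊔ b) * ofPerm σ = a * ofPerm σ ⊔ b * ofPerm σ := by
  apply le_antisymm
  · have h : a ⊔ b ≤ (a * ofPerm σ ⊔ b * ofPerm σ) * ofPerm σ⁻¹ := by
      refine sup_le ?_ ?_
      · calc a = (a * ofPerm σ) * ofPerm σ⁻¹ := by rw [mul_assoc, ofPerm_mul_inv, mul_one]
          _ ≤ _ := mul_mono le_sup_left le_rfl
      · calc b = (b * ofPerm σ) * ofPerm σ⁻¹ := by rw [mul_assoc, ofPerm_mul_inv, mul_one]
          _ ≤ _ := mul_mono le_sup_right le_rfl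
    calc (a ⊔ b) * ofPerm σ ≤ ((a * ofPerm σ ⊔ b * ofPerm σ) * ofPerm σ⁻¹) * ofPerm σ :=
          mul_mono h le_rfl
      _ = _ := by rw [mul_assoc, ofPerm_inv_mul, mul_one]
  · exact sup_le (mul_mono le_sup_left le_rfl) (mul_mono le_sup_right le_rfl)

/-- For partitions containing the identity the product is the join. -/
theorem mul_eq_sup {a b : PartitionMonoid n} (ha : 1 ≤ a) (hb : 1 ≤ b) : a * b = a ⊔ b := by
  apply le_antisymm
  · let c : Three n → Fin n ⊕ Fin n := Sum.elim Sum.inl (Sum.elim Sum.inl Sum.inr)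
    have hab : ∀ x : Fin n, (a ⊔ b : Setoid _) (Sum.inl x) (Sum.inr x) := fun x =>
      (le_sup_left : a ≤ a ⊔ b) (ha (show (Sum.elim (1 : Equiv.Perm (Fin n)) id) _ = _ from rfl))
    have h : stack a b ≤ Setoid.comap c (a ⊔ b : Setoid _) := by
      rw [stack_le_iff]
      have hl : ∀ t : Fin n ⊕ Fin n, (a ⊔ b : Setoid _) (c (lower t)) t := by
        rintro (t | t)
        · exact Setoid.refl' _ _
        · exact hab t
      refine ⟨?_, ?_⟩
      · intro s t h
        exact Setoid.trans' (a ⊔ b) (hl s) (Setoid.trans' (a ⊔ b)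
          ((le_sup_right : b ≤ a ⊔ b) h) (Setoid.symm' (a ⊔ b) (hl t)))
      · have hu : ∀ t : Fin n ⊕ Fin n, c (upper t) = t := by rintro (t | t) <;> rfl
        intro s t h
        change (a ⊔ b : Setoid _) (c (upper s)) (c (upper t))
        rw [hu, hu]
        exact (le_sup_left : a ≤ a ⊔ b) h
    intro s t hst
    have := h hst
    have hc : ∀ t : Fin n ⊕ Fin n, c (outer t) = t := by rintro (t | t) <;> rfl
    change (a ⊔ b : Setoid _) (c (outer s)) (c (outer t)) at this
    rwa [hc, hc] at this
  · refine sup_le ?_ ?_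
    · simpa using mul_mono (le_refl a) hb
    · simpa using mul_mono ha (le_refl b)

/-- For `η ≥ f, g` and `θ ≥ h, i` the product `θ η` is `θ f ∨ i η`. -/
theorem mul_eq_sup_of_le {σ τ : Equiv.Perm (Fin n)} {η θ : PartitionMonoid n}
    (hη : ofPerm σ ≤ η) (hθ : ofPerm τ ≤ θ) : θ * η = θ * ofPerm σ ⊔ ofPerm τ * η := by
  have h1 : 1 ≤ η * ofPerm σ⁻¹ := by
    rw [← ofPerm_mul_inv σ]; exact mul_mono hη le_rfl
  have h2 : 1 ≤ ofPerm τ⁻¹ * θ := by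
    rw [← ofPerm_inv_mul τ]; exact mul_mono le_rfl hθ
  have e1 : η * ofPerm σ⁻¹ * ofPerm σ = η := by rw [mul_assoc, ofPerm_inv_mul, mul_one]
  have e2 : ofPerm τ * (ofPerm τ⁻¹ * θ) = θ := by rw [← mul_assoc, ofPerm_mul_inv, one_mul]
  calc θ * η = ofPerm τ * ((ofPerm τ⁻¹ * θ) * (η * ofPerm σ⁻¹)) * ofPerm σ := by
        rw [← mul_assoc (ofPerm τ), e2, mul_assoc, e1]
    _ = _ := by
        rw [mul_eq_sup h2 h1, ofPerm_mul_sup, sup_mul_ofPerm, e2, mul_assoc, e1]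

/-- A partition is propagating if each of its parts meets both `{1, …, n}` and `{1', …, n'}`. -/
def IsPropagating (ρ : PartitionMonoid n) : Prop :=
  (∀ x : Fin n, ∃ y : Fin n, (ρ : Setoid _) (Sum.inl x) (Sum.inr y)) ∧
    ∀ y : Fin n, ∃ x : Fin n, (ρ : Setoid _) (Sum.inl x) (Sum.inr y)

theorem ofPerm_rel (σ : Equiv.Perm (Fin n)) (x : Fin n) :
    (ofPerm σ : Setoid _) (Sum.inl x) (Sum.inr (σ x)) :=
  show Sum.elim σ id (Sum.inl x) = Sum.elim σ id (Sum.inr (σ x)) from rfl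

theorem isPropagating_of_le {σ : Equiv.Perm (Fin n)} {ρ : PartitionMonoid n} (h : ofPerm σ ≤ ρ) :
    IsPropagating ρ :=
  ⟨fun x => ⟨σ x, h (ofPerm_rel σ x)⟩,
    fun y => ⟨σ.symm y, h (by simp)⟩⟩

theorem mul_rel {ρ π : PartitionMonoid n} {x y z : Fin n} (h : (π : Setoid _) (Sum.inl x) (Sum.inr y))
    (k : (ρ : Setoid _) (Sum.inl y) (Sum.inr z)) : (ρ * π : Setoid _) (Sum.inl x) (Sum.inr z) :=
  Setoid.trans' (stack ρ π) (stack_lower ρ π h) (stack_upper ρ π k)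

end PartitionMonoid

open PartitionMonoid

/-- The dual symmetric inverse monoid `I*_n`, realised as the monoid of propagating partitions:
such a partition is the same thing as a bijection between two quotient sets of `{1, …, n}`. -/
def DualSymmetricInverseMonoid (n : ℕ) : Submonoid (PartitionMonoid n) where
  carrier := {ρ | IsPropagating ρ}
  one_mem' := isPropagating_of_le (σ := 1) le_rfl
  mul_mem' := by
    rintro ρ π ⟨h1, h2⟩ ⟨k1, k2⟩
    refine ⟨fun x => ?_, fun z => ?_⟩
    · obtain ⟨y, hy⟩ := k1 x
      obtain ⟨z, hz⟩ := h1 y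
      exact ⟨z, mul_rel hy hz⟩
    · obtain ⟨y, hy⟩ := h2 z
      obtain ⟨x, hx⟩ := k2 y
      exact ⟨x, mul_rel hx hy⟩

/-- An idempotent of `I*_n` contains the identity. -/
theorem one_le_of_idem {n : ℕ} {ε : PartitionMonoid n} (h : ε ∈ DualSymmetricInverseMonoid n)
    (hε : ε * ε = ε) : 1 ≤ ε := by
  have key : ∀ x, (ε : Setoid _) (Sum.inl x) (Sum.inr x) := by
    intro x
    obtain ⟨w, hw⟩ := h.2 x
    obtain ⟨z, hz⟩ := h.1 x
    have hwz : (ε : Setoid _) (Sum.inl w) (Sum.inr z) := by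
      have := mul_rel hw hz
      rwa [hε] at this
    exact Setoid.trans' _ hz (Setoid.trans' _ (Setoid.symm' _ hwz) hw)
  have key' : ∀ t : Fin n ⊕ Fin n,
      (ε : Setoid _) t (Sum.inr (Sum.elim (1 : Equiv.Perm (Fin n)) id t)) := by
    rintro (t | t)
    · exact key t
    · exact Setoid.refl' _ _
  intro a b hab
  replace hab : Sum.elim (1 : Equiv.Perm (Fin n)) id a = Sum.elim (1 : Equiv.Perm (Fin n)) id b :=
    hab
  have := key' b
  rw [← hab] at this
  exact Setoid.trans' _ (key' a) (Setoid.symm' _ this)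

theorem idem_of_one_le {n : ℕ} {ε : PartitionMonoid n} (h : 1 ≤ ε) : ε * ε = ε := by
  rw [mul_eq_sup h h, sup_idem]

/-- `ρ = σ ε` with `σ ∈ S_n` and `ε` an idempotent of `I*_n` iff `ρ` is coarser than a
permutation. -/
theorem factorizable_iff {n : ℕ} (ρ : PartitionMonoid n) :
    (∃ (σ : Equiv.Perm (Fin n)) (ε : PartitionMonoid n), ε ∈ DualSymmetricInverseMonoid n ∧
      ε * ε = ε ∧ ρ = ofPerm σ * ε) ↔ ∃ σ : Equiv.Perm (Fin n), ofPerm σ ≤ ρ := by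
  constructor
  · rintro ⟨σ, ε, h, hε, rfl⟩
    exact ⟨σ, by simpa using mul_mono (le_refl (ofPerm σ)) (one_le_of_idem h hε)⟩
  · rintro ⟨σ, h⟩
    have h1 : 1 ≤ ofPerm σ⁻¹ * ρ := by
      rw [← ofPerm_inv_mul σ]; exact mul_mono le_rfl h
    refine ⟨σ, ofPerm σ⁻¹ * ρ, isPropagating_of_le (σ := 1) h1, idem_of_one_le h1, ?_⟩
    rw [← mul_assoc, ofPerm_mul_inv, one_mul]

/-- The maximal factorizable submonoid of `I*_n`: all products `σ ε` with `σ ∈ S_n` and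
`ε` an idempotent of `I*_n`. -/
def factorizableSubmonoid (n : ℕ) : Submonoid (PartitionMonoid n) where
  carrier := {ρ | ∃ (σ : Equiv.Perm (Fin n)) (ε : PartitionMonoid n),
    ε ∈ DualSymmetricInverseMonoid n ∧ ε * ε = ε ∧ ρ = ofPerm σ * ε}
  one_mem' := (factorizable_iff 1).2 ⟨1, le_rfl⟩
  mul_mem' := by
    intro a b ha hb
    rw [Set.mem_ofPred_eq, factorizable_iff] at ha hb ⊢
    obtain ⟨σ, hσ⟩ := ha
    obtain ⟨τ, hτ⟩ := hb
    exact ⟨σ * τ, by rw [ofPerm_mul]; exact mul_mono hσ hτ⟩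

/-- The monoid `F*_n`. -/
def FStar (n : ℕ) : Type := factorizableSubmonoid n

namespace FStar

variable {n : ℕ}

instance : Monoid (FStar n) := inferInstanceAs (Monoid (factorizableSubmonoid n))

/-- The underlying partition of an element of `F*_n`. -/
@[reducible] def val (s : FStar n) : PartitionMonoid n := Subtype.val s

theorem val_injective : Function.Injective (val (n := n)) := Subtype.val_injective

theorem val_mul (s t : FStar n) : (s * t).val = s.val * t.val := rfl

theorem exists_ofPerm_le (s : FStar n) : ∃ σ : Equiv.Perm (Fin n), ofPerm σ ≤ s.val :=
  (factorizable_iff _).1 s.2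

/-- An element of `F*_n` from a partition that is coarser than a permutation. -/
def mk {σ : Equiv.Perm (Fin n)} (ρ : PartitionMonoid n) (h : ofPerm σ ≤ ρ) : FStar n :=
  ⟨ρ, (factorizable_iff _).2 ⟨σ, h⟩⟩

/-- On `F*_n`, the relation `s = e t` with `e` idempotent says that `s` is coarser than `t`. -/
theorem natural_iff (s t : FStar n) : (∃ e : FStar n, e * e = e ∧ s = e * t) ↔ t.val ≤ s.val := by
  constructor
  · rintro ⟨e, he, rfl⟩
    have : 1 ≤ e.val := by
      obtain ⟨σ, hσ⟩ := e.exists_ofPerm_le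
      exact one_le_of_idem (isPropagating_of_le hσ) (congrArg val he)
    rw [val_mul]
    simpa using mul_mono this (le_refl t.val)
  · intro h
    obtain ⟨σ, hσ⟩ := t.exists_ofPerm_le
    have h1 : 1 ≤ t.val * ofPerm σ⁻¹ := by
      rw [← ofPerm_mul_inv σ]; exact mul_mono hσ le_rfl
    have h2 : t.val * ofPerm σ⁻¹ ≤ s.val * ofPerm σ⁻¹ := mul_mono h le_rfl
    have h3 := h1.trans h2
    have e1 : ∀ x : PartitionMonoid n, x * ofPerm σ⁻¹ * ofPerm σ = x := fun x => by
      rw [mul_assoc, ofPerm_inv_mul, mul_one]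
    refine ⟨mk (σ := 1) (s.val * ofPerm σ⁻¹) h3, Subtype.ext (idem_of_one_le h3),
      val_injective ?_⟩
    change s.val = s.val * ofPerm σ⁻¹ * t.val
    calc s.val = (s.val * ofPerm σ⁻¹) * (t.val * ofPerm σ⁻¹) * ofPerm σ := by
          rw [mul_eq_sup h3 h1, sup_eq_left.2 h2, e1]
      _ = _ := by rw [mul_assoc, e1]

/-- The natural partial order of the inverse monoid `F*_n`: `s ≤ t` iff `s = e t` for some
idempotent `e`. -/
instance : PartialOrder (FStar n) where
  le s t := ∃ e : FStar n, e * e = e ∧ s = e * t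
  le_refl s := (natural_iff s s).2 le_rfl
  le_trans s t u h k := (natural_iff s u).2 (((natural_iff t u).1 k).trans ((natural_iff s t).1 h))
  le_antisymm s t h k :=
    val_injective (le_antisymm ((natural_iff t s).1 k) ((natural_iff s t).1 h))

theorem le_iff (s t : FStar n) : s ≤ t ↔ t.val ≤ s.val :=
  natural_iff s t

instance : MulLeftMono (FStar n) :=
  ⟨fun a _ _ h => (le_iff _ _).2 (mul_mono (le_refl a.val) ((le_iff _ _).1 h))⟩

instance : MulRightMono (FStar n) :=
  ⟨fun a _ _ h => (le_iff _ _).2 (mul_mono ((le_iff _ _).1 h) (le_refl a.val))⟩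

instance : Finite (FStar n) :=
  Finite.of_injective (fun (s : FStar n) => fun a b => s.val a b) (fun _ _ h => val_injective
    (Setoid.ext fun a b => iff_of_eq (congrFun (congrFun h a) b)))

end FStar

end FiatCat

namespace FiatCat

open CategoryTheory PartitionMonoid

/-! ### The 2-category `B_n` -/

/-- The type of objects of the 2-category `B_n`, with a single element. -/
inductive BCat (n : ℕ) : Type
  | pt : BCat n

namespace BCat

variable {n : ℕ}

/-- The 1-morphisms of `B_n` are the elements of the symmetric group `S_n`. -/
@[ext]
structure Hom₁ (n : ℕ) : Type where
  perm : Equiv.Perm (Fin n)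

/-- The 2-morphisms `π ⟶ σ` of `B_n`: propagating partitions `α` with `π ≤ α` and `σ ≤ α`. -/
@[ext]
structure Hom₂ (π σ : Hom₁ n) : Type where
  val : PartitionMonoid n
  propagating : val ∈ DualSymmetricInverseMonoid n
  left_le : ofPerm π.perm ≤ val
  right_le : ofPerm σ.perm ≤ val

/-- Vertical composition `β ∘₁ α` is the join; the identity of `π` is `π`. -/
instance : Category (Hom₁ n) where
  Hom := Hom₂
  id π := ⟨ofPerm π.perm, isPropagating_of_le le_rfl, le_rfl, le_rfl⟩
  comp α β := ⟨β.val ⊔ α.val, isPropagating_of_le (α.left_le.trans le_sup_right),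
    α.left_le.trans le_sup_right, β.right_le.trans le_sup_left⟩
  id_comp α := Hom₂.ext (sup_eq_left.2 α.left_le)
  comp_id α := Hom₂.ext (sup_eq_right.2 α.right_le)
  assoc _ _ _ := Hom₂.ext (sup_assoc _ _ _).symm

@[ext]
theorem hom₂_ext {π σ : Hom₁ n} {α β : π ⟶ σ} (h : α.val = β.val) : α = β := Hom₂.ext h

theorem id_val (π : Hom₁ n) : Hom₂.val (𝟙 π) = ofPerm π.perm := rfl

theorem comp_val {π σ τ : Hom₁ n} (α : π ⟶ σ) (β : σ ⟶ τ) :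
    Hom₂.val (α ≫ β) = β.val ⊔ α.val := rfl

/-- Composition `τ ∘ π` in `S_n`. -/
def comp₁ (π τ : Hom₁ n) : Hom₁ n := ⟨τ.perm * π.perm⟩

/-- Horizontal composition `β ∘₀ α` of 2-morphisms is the product `β α` of partitions. -/
def hcomp {π σ τ ρ : Hom₁ n} (α : π ⟶ σ) (β : τ ⟶ ρ) : comp₁ π τ ⟶ comp₁ σ ρ where
  val := β.val * α.val
  propagating := mul_mem β.propagating α.propagating
  left_le := by rw [comp₁, ofPerm_mul]; exact mul_mono β.left_le α.left_le
  right_le := by rw [comp₁, ofPerm_mul]; exact mul_mono β.right_le α.right_le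

theorem hcomp_val {π σ τ ρ : Hom₁ n} (α : π ⟶ σ) (β : τ ⟶ ρ) :
    Hom₂.val (hcomp α β) = β.val * α.val := rfl

/-- The identity 2-morphism between equal 1-morphisms. -/
def isoOfEq {π σ : Hom₁ n} (h : π.perm = σ.perm) : π ≅ σ where
  hom := ⟨ofPerm π.perm, isPropagating_of_le le_rfl, le_rfl, h ▸ le_rfl⟩
  inv := ⟨ofPerm π.perm, isPropagating_of_le le_rfl, h ▸ le_rfl, le_rfl⟩
  hom_inv_id := hom₂_ext (sup_idem _)
  inv_hom_id := hom₂_ext ((sup_idem _).trans (congrArg ofPerm h))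

theorem isoOfEq_hom_val {π σ : Hom₁ n} (h : π.perm = σ.perm) :
    (isoOfEq h).hom.val = ofPerm π.perm := rfl

theorem isoOfEq_inv_val {π σ : Hom₁ n} (h : π.perm = σ.perm) :
    (isoOfEq h).inv.val = ofPerm π.perm := rfl

theorem conj_val {π σ τ ρ : Hom₁ n} (h : π.perm = σ.perm) (k : ρ.perm = τ.perm) (α : σ ⟶ τ) :
    Hom₂.val ((isoOfEq h).hom ≫ α ≫ (isoOfEq k).inv) = α.val := by
  rw [comp_val, comp_val, isoOfEq_hom_val, isoOfEq_inv_val, h, k, sup_eq_right.2 α.right_le,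
    sup_eq_left.2 α.left_le]

theorem conj_val' {π σ τ ρ : Hom₁ n} (h : σ.perm = π.perm) (k : τ.perm = ρ.perm) (α : σ ⟶ τ) :
    Hom₂.val ((isoOfEq h).inv ≫ α ≫ (isoOfEq k).hom) = α.val := by
  rw [comp_val, comp_val, isoOfEq_hom_val, isoOfEq_inv_val, sup_eq_right.2 α.right_le,
    sup_eq_left.2 α.left_le]

theorem hcomp_id_comp (f : Hom₁ n) {g h i : Hom₁ n} (η : g ⟶ h) (θ : h ⟶ i) :
    hcomp (𝟙 f) (η ≫ θ) = hcomp (𝟙 f) η ≫ hcomp (𝟙 f) θ :=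
  hom₂_ext (sup_mul_ofPerm _ _ _)

theorem hcomp_comp_id {f g h : Hom₁ n} (η : f ⟶ g) (θ : g ⟶ h) (i : Hom₁ n) :
    hcomp (η ≫ θ) (𝟙 i) = hcomp η (𝟙 i) ≫ hcomp θ (𝟙 i) :=
  hom₂_ext (ofPerm_mul_sup _ _ _)

theorem hcomp_id_id (f g : Hom₁ n) : hcomp (𝟙 f) (𝟙 g) = 𝟙 (comp₁ f g) :=
  hom₂_ext (ofPerm_mul _ _).symm

/-- The associator, an identity 2-morphism. -/
def assoc₁ (f g h : Hom₁ n) : comp₁ (comp₁ f g) h ≅ comp₁ f (comp₁ g h) :=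
  isoOfEq (mul_assoc h.perm g.perm f.perm).symm

theorem assoc₁_hom_val (f g h : Hom₁ n) :
    (assoc₁ f g h).hom.val = ofPerm (h.perm * (g.perm * f.perm)) := rfl

/-- The left unitor, an identity 2-morphism. -/
def left₁ (f : Hom₁ n) : comp₁ ⟨1⟩ f ≅ f := isoOfEq (mul_one f.perm)

/-- The right unitor, an identity 2-morphism. -/
def right₁ (f : Hom₁ n) : comp₁ f ⟨1⟩ ≅ f := isoOfEq (one_mul f.perm)

theorem exchange₁ {f g h i : Hom₁ n} (η : f ⟶ g) (θ : h ⟶ i) :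
    hcomp (𝟙 f) θ ≫ hcomp η (𝟙 i) = hcomp η (𝟙 h) ≫ hcomp (𝟙 g) θ := by
  apply hom₂_ext
  simp only [comp_val, hcomp_val, id_val]
  rw [sup_comm, ← mul_eq_sup_of_le η.left_le θ.right_le, ← mul_eq_sup_of_le η.right_le θ.left_le]

theorem pentagon₁ (f g h i : Hom₁ n) :
    hcomp (assoc₁ f g h).hom (𝟙 i) ≫ (assoc₁ f (comp₁ g h) i).hom ≫ hcomp (𝟙 f) (assoc₁ g h i).hom =
      (assoc₁ (comp₁ f g) h i).hom ≫ (assoc₁ f g (comp₁ h i)).hom := by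
  apply hom₂_ext
  rw [comp_val, comp_val, comp_val, hcomp_val, hcomp_val]
  simp only [id_val, assoc₁_hom_val, ← ofPerm_mul, comp₁, mul_assoc, sup_idem]

theorem triangle₁ (f g : Hom₁ n) :
    (assoc₁ f ⟨1⟩ g).hom ≫ hcomp (𝟙 f) (left₁ g).hom = hcomp (right₁ f).hom (𝟙 g) := by
  apply hom₂_ext
  rw [comp_val, hcomp_val, hcomp_val]
  simp only [id_val, assoc₁, left₁, right₁, isoOfEq_hom_val, ← ofPerm_mul,
    comp₁, mul_one, one_mul, sup_idem]

instance : Bicategory (BCat n) where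
  Hom _ _ := Hom₁ n
  id _ := ⟨1⟩
  comp := comp₁
  homCategory _ _ := inferInstanceAs (Category (Hom₁ n))
  whiskerLeft f _ _ η := hcomp (𝟙 (f : Hom₁ n)) η
  whiskerRight η h := hcomp η (𝟙 (h : Hom₁ n))
  associator := assoc₁
  leftUnitor := left₁
  rightUnitor := right₁
  whiskerLeft_id f g := hcomp_id_id f g
  whiskerLeft_comp f _ _ _ η θ := hcomp_id_comp f η θ
  id_whiskerLeft η := hom₂_ext ((mul_one (Hom₂.val η)).trans (conj_val _ _ _).symm)
  comp_whiskerLeft f g _ _ η := hom₂_ext ((congrArg (Hom₂.val η * ·)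
    (ofPerm_mul (Hom₁.perm g) (Hom₁.perm f))).trans
    ((mul_assoc (Hom₂.val η) (ofPerm (Hom₁.perm g)) (ofPerm (Hom₁.perm f))).symm.trans
      (conj_val _ _ (hcomp (𝟙 (f : Hom₁ n)) (hcomp (𝟙 (g : Hom₁ n)) η))).symm))
  id_whiskerRight f g := hcomp_id_id f g
  comp_whiskerRight η θ i := hcomp_comp_id η θ i
  whiskerRight_id η := hom₂_ext ((one_mul (Hom₂.val η)).trans (conj_val _ _ _).symm)
  whiskerRight_comp η g h := hom₂_ext ((congrArg (· * Hom₂.val η)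
    (ofPerm_mul (Hom₁.perm h) (Hom₁.perm g))).trans
    ((mul_assoc (ofPerm (Hom₁.perm h)) (ofPerm (Hom₁.perm g)) (Hom₂.val η)).trans
      (conj_val' _ _ (hcomp (hcomp η (𝟙 (g : Hom₁ n))) (𝟙 (h : Hom₁ n)))).symm))
  whisker_assoc f _ _ η h := hom₂_ext
    ((mul_assoc (ofPerm (Hom₁.perm h)) (Hom₂.val η) (ofPerm (Hom₁.perm f))).symm.trans
      (conj_val _ _ (hcomp (𝟙 (f : Hom₁ n)) (hcomp η (𝟙 (h : Hom₁ n))))).symm)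
  whisker_exchange η θ := exchange₁ η θ
  pentagon := pentagon₁
  triangle := triangle₁

theorem eqToHom_val {π σ : Hom₁ n} (h : π = σ) : Hom₂.val (eqToHom h) = ofPerm π.perm := by
  subst h; rfl

theorem id_comp₁ (f : Hom₁ n) : comp₁ ⟨1⟩ f = f := Hom₁.ext (mul_one _)

theorem comp_id₁ (f : Hom₁ n) : comp₁ f ⟨1⟩ = f := Hom₁.ext (one_mul _)

theorem assoc_comp₁ (f g h : Hom₁ n) : comp₁ (comp₁ f g) h = comp₁ f (comp₁ g h) :=
  Hom₁.ext (mul_assoc _ _ _).symm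

/-- `B_n` is a strict 2-category. -/
instance : Bicategory.Strict (BCat n) where
  id_comp := id_comp₁
  comp_id := comp_id₁
  assoc := assoc_comp₁
  leftUnitor_eqToIso f := Iso.ext (hom₂_ext (eqToHom_val (id_comp₁ f)).symm)
  rightUnitor_eqToIso f := Iso.ext (hom₂_ext (eqToHom_val (comp_id₁ f)).symm)
  associator_eqToIso f g h := Iso.ext (hom₂_ext (eqToHom_val (assoc_comp₁ f g h)).symm)

end BCat

/-! ### The 2-category of an ordered monoid -/

/-- The type of objects, with a single element, of the 2-category `S_S` attached to a monoid `S`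
with an admissible partial order. -/
inductive OrdMonCat (S : Type*) : Type
  | pt : OrdMonCat S

namespace OrdMonCat

/-- The 1-morphisms are the elements of `S`. -/
@[ext]
structure Hom₁ (S : Type*) where
  val : S

variable {S : Type*} [Monoid S] [PartialOrder S]

/-- There is exactly one 2-morphism from `s` to `t` if `s ≤ t`, and none otherwise. -/
instance : Category (Hom₁ S) where
  Hom s t := PLift (s.val ≤ t.val)
  id s := ⟨le_rfl⟩
  comp f g := ⟨f.down.trans g.down⟩

instance (s t : Hom₁ S) : Subsingleton (s ⟶ t) :=
  inferInstanceAs (Subsingleton (PLift (s.val ≤ t.val)))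

/-- Composition `t · s`. -/
def comp₁ (s t : Hom₁ S) : Hom₁ S := ⟨t.val * s.val⟩

/-- The identity 2-morphism between equal 1-morphisms. -/
def isoOfEq {s t : Hom₁ S} (h : s.val = t.val) : s ≅ t where
  hom := ⟨h.le⟩
  inv := ⟨h.ge⟩
  hom_inv_id := Subsingleton.elim _ _
  inv_hom_id := Subsingleton.elim _ _

/-- Horizontal composition of 2-morphisms. -/
def hcomp [MulLeftMono S] [MulRightMono S] {s t u v : Hom₁ S} (η : s ⟶ t) (θ : u ⟶ v) :
    comp₁ s u ⟶ comp₁ t v :=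
  ⟨mul_le_mul' θ.down η.down⟩

/-- The associator, an identity 2-morphism. -/
def assoc₁ (f g h : Hom₁ S) : comp₁ (comp₁ f g) h ≅ comp₁ f (comp₁ g h) :=
  isoOfEq (mul_assoc h.val g.val f.val).symm

/-- The left unitor, an identity 2-morphism. -/
def left₁ (f : Hom₁ S) : comp₁ ⟨1⟩ f ≅ f := isoOfEq (mul_one f.val)

/-- The right unitor, an identity 2-morphism. -/
def right₁ (f : Hom₁ S) : comp₁ f ⟨1⟩ ≅ f := isoOfEq (one_mul f.val)

instance [MulLeftMono S] [MulRightMono S] : Bicategory (OrdMonCat S) where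
  Hom _ _ := Hom₁ S
  id _ := ⟨1⟩
  comp := comp₁
  homCategory _ _ := inferInstanceAs (Category (Hom₁ S))
  whiskerLeft f _ _ η := hcomp (𝟙 (f : Hom₁ S)) η
  whiskerRight η h := hcomp η (𝟙 (h : Hom₁ S))
  associator := assoc₁
  leftUnitor := left₁
  rightUnitor := right₁
  whiskerLeft_id _ _ := Subsingleton.elim (α := _ ⟶ (_ : Hom₁ S)) _ _
  whiskerLeft_comp _ _ _ _ _ _ := Subsingleton.elim (α := _ ⟶ (_ : Hom₁ S)) _ _
  id_whiskerLeft _ := Subsingleton.elim (α := _ ⟶ (_ : Hom₁ S)) _ _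
  comp_whiskerLeft _ _ _ _ _ := Subsingleton.elim (α := _ ⟶ (_ : Hom₁ S)) _ _
  id_whiskerRight _ _ := Subsingleton.elim (α := _ ⟶ (_ : Hom₁ S)) _ _
  comp_whiskerRight _ _ _ := Subsingleton.elim (α := _ ⟶ (_ : Hom₁ S)) _ _
  whiskerRight_id _ := Subsingleton.elim (α := _ ⟶ (_ : Hom₁ S)) _ _
  whiskerRight_comp _ _ _ := Subsingleton.elim (α := _ ⟶ (_ : Hom₁ S)) _ _
  whisker_assoc _ _ _ _ _ := Subsingleton.elim (α := _ ⟶ (_ : Hom₁ S)) _ _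
  whisker_exchange _ _ := Subsingleton.elim (α := _ ⟶ (_ : Hom₁ S)) _ _
  pentagon _ _ _ _ := Subsingleton.elim (α := _ ⟶ (_ : Hom₁ S)) _ _
  triangle _ _ := Subsingleton.elim (α := _ ⟶ (_ : Hom₁ S)) _ _

/-- An element of `S` as a 1-morphism. -/
def hom [MulLeftMono S] [MulRightMono S] (s : S) : (pt : OrdMonCat S) ⟶ pt := Hom₁.mk s

instance [MulLeftMono S] [MulRightMono S] : Bicategory.Strict (OrdMonCat S) where
  id_comp f := (Hom₁.ext (mul_one _) : comp₁ ⟨1⟩ (f : Hom₁ S) = f)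
  comp_id f := (Hom₁.ext (one_mul _) : comp₁ (f : Hom₁ S) ⟨1⟩ = f)
  assoc f g h := (Hom₁.ext (mul_assoc _ _ _).symm :
    comp₁ (comp₁ (f : Hom₁ S) g) h = comp₁ (f : Hom₁ S) (comp₁ g h))
  leftUnitor_eqToIso _ := Iso.ext (Subsingleton.elim (α := _ ⟶ (_ : Hom₁ S)) _ _)
  rightUnitor_eqToIso _ := Iso.ext (Subsingleton.elim (α := _ ⟶ (_ : Hom₁ S)) _ _)
  associator_eqToIso _ _ _ := Iso.ext (Subsingleton.elim (α := _ ⟶ (_ : Hom₁ S)) _ _)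

end OrdMonCat

end FiatCat

namespace FiatCat

open CategoryTheory Bicategory Limits

universe w v u w' v' u'

/-! ### Horizontal composition in a bicategory -/

section HComp

variable {B : Type u} [Bicategory.{w, v} B] {a b c d : B}

/-- Horizontal composition of 2-morphisms in a bicategory. -/
def hc {f f' : a ⟶ b} {g g' : b ⟶ c} (η : f ⟶ f') (θ : g ⟶ g') : f ≫ g ⟶ f' ≫ g' :=
  η ▷ g ≫ f' ◁ θ

theorem hc_id (f : a ⟶ b) (g : b ⟶ c) : hc (𝟙 f) (𝟙 g) = 𝟙 (f ≫ g) := by simp [hc]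

theorem hc_comp {f f' f'' : a ⟶ b} {g g' g'' : b ⟶ c} (η : f ⟶ f') (η' : f' ⟶ f'')
    (θ : g ⟶ g') (θ' : g' ⟶ g'') : hc (η ≫ η') (θ ≫ θ') = hc η θ ≫ hc η' θ' := by
  simp [hc, whisker_exchange_assoc]

theorem id_hc (f : a ⟶ b) {g g' : b ⟶ c} (θ : g ⟶ g') : hc (𝟙 f) θ = f ◁ θ := by simp [hc]

theorem hc_one {f f' : a ⟶ b} (η : f ⟶ f') (g : b ⟶ c) : hc η (𝟙 g) = η ▷ g := by simp [hc]

theorem hc_assoc {f f' : a ⟶ b} {g g' : b ⟶ c} {h h' : c ⟶ d} (η : f ⟶ f') (θ : g ⟶ g')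
    (κ : h ⟶ h') : hc (hc η θ) κ ≫ (α_ f' g' h').hom = (α_ f g h).hom ≫ hc η (hc θ κ) := by
  simp [hc]

theorem hc_left {f f' : a ⟶ b} (η : f ⟶ f') :
    hc (𝟙 (𝟙 a)) η ≫ (λ_ f').hom = (λ_ f).hom ≫ η := by
  simp [hc]

theorem hc_right {f f' : a ⟶ b} (η : f ⟶ f') :
    hc η (𝟙 (𝟙 b)) ≫ (ρ_ f').hom = (ρ_ f).hom ≫ η := by
  simp [hc]

end HComp

/-- A bicategory with preadditive morphism categories and biadditive composition. -/
class PreadditiveBicategory (B : Type u) [Bicategory.{w, v} B] where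
  preadditive : ∀ a b : B, Preadditive (a ⟶ b)
  whiskerLeft_add : ∀ {a b c : B} (f : a ⟶ b) {g h : b ⟶ c} (η θ : g ⟶ h),
    f ◁ (η + θ) = f ◁ η + f ◁ θ
  add_whiskerRight : ∀ {a b c : B} {f g : a ⟶ b} (η θ : f ⟶ g) (h : b ⟶ c),
    (η + θ) ▷ h = η ▷ h + θ ▷ h

attribute [reducible, instance] PreadditiveBicategory.preadditive

theorem conj_of_eq {C : Type*} [Category* C] {X X' Y Y' : C} {f : X ⟶ Y} {g : X' ⟶ Y'}
    {φ : X ≅ X'} {ψ : Y ≅ Y'} (h : f ≫ ψ.hom = φ.hom ≫ g) : f = φ.hom ≫ g ≫ ψ.inv := by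
  rw [← Category.assoc, ← h, Category.assoc, ψ.hom_inv_id, Category.comp_id]

theorem conj_of_eq' {C : Type*} [Category* C] {X X' Y Y' : C} {f : X ⟶ Y} {g : X' ⟶ Y'}
    {φ : X ≅ X'} {ψ : Y ≅ Y'} (h : f ≫ ψ.hom = φ.hom ≫ g) : g = φ.inv ≫ f ≫ ψ.hom := by
  rw [h, φ.inv_hom_id_assoc]

section

variable {B : Type u} [Bicategory.{w, v} B] [PreadditiveBicategory B] {a b c d : B}

/-- Whiskering as an additive map. -/
noncomputable def wLHom (f : a ⟶ b) (g h : b ⟶ c) : (g ⟶ h) →+ (f ≫ g ⟶ f ≫ h) :=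
  AddMonoidHom.mk' (fun η => f ◁ η) (PreadditiveBicategory.whiskerLeft_add f)

/-- Whiskering as an additive map. -/
noncomputable def wRHom (f g : a ⟶ b) (h : b ⟶ c) : (f ⟶ g) →+ (f ≫ h ⟶ g ≫ h) :=
  AddMonoidHom.mk' (fun η => η ▷ h) (fun η θ => PreadditiveBicategory.add_whiskerRight η θ h)

theorem whiskerLeft_zero (f : a ⟶ b) (g h : b ⟶ c) : f ◁ (0 : g ⟶ h) = 0 :=
  map_zero (wLHom f g h)

theorem zero_whiskerRight (f g : a ⟶ b) (h : b ⟶ c) : (0 : f ⟶ g) ▷ h = 0 :=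
  map_zero (wRHom f g h)

theorem whiskerLeft_sum {ι : Type*} (s : Finset ι) (f : a ⟶ b) {g h : b ⟶ c} (η : ι → (g ⟶ h)) :
    f ◁ (∑ i ∈ s, η i) = ∑ i ∈ s, f ◁ η i :=
  map_sum (wLHom f g h) η s

theorem sum_whiskerRight {ι : Type*} (s : Finset ι) {f g : a ⟶ b} (η : ι → (f ⟶ g)) (h : b ⟶ c) :
    (∑ i ∈ s, η i) ▷ h = ∑ i ∈ s, η i ▷ h :=
  map_sum (wRHom f g h) η s

theorem hc_add {f f' : a ⟶ b} {g g' : b ⟶ c} (η : f ⟶ f') (θ θ' : g ⟶ g') :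
    hc η (θ + θ') = hc η θ + hc η θ' := by
  simp only [hc, PreadditiveBicategory.whiskerLeft_add, Preadditive.comp_add]

theorem add_hc {f f' : a ⟶ b} {g g' : b ⟶ c} (η η' : f ⟶ f') (θ : g ⟶ g') :
    hc (η + η') θ = hc η θ + hc η' θ := by
  simp only [hc, PreadditiveBicategory.add_whiskerRight, Preadditive.add_comp]

theorem hc_zero {f f' : a ⟶ b} {g g' : b ⟶ c} (η : f ⟶ f') : hc η (0 : g ⟶ g') = 0 := by
  rw [hc, whiskerLeft_zero, comp_zero]

theorem zero_hc {f f' : a ⟶ b} {g g' : b ⟶ c} (η : g ⟶ g') : hc (0 : f ⟶ f') η = 0 := by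
  rw [hc, zero_whiskerRight, zero_comp]

theorem hc_sum_sum {ι κ : Type*} (s : Finset ι) (t : Finset κ) {f f' : a ⟶ b} {g g' : b ⟶ c}
    (η : ι → (f ⟶ f')) (θ : κ → (g ⟶ g')) :
    hc (∑ i ∈ s, η i) (∑ j ∈ t, θ j) = ∑ i ∈ s, ∑ j ∈ t, hc (η i) (θ j) := by
  simp only [hc, sum_whiskerRight, whiskerLeft_sum, Preadditive.sum_comp, Preadditive.comp_sum]
  exact Finset.sum_comm

end

/-! ### `𝕜`-linearization of the morphism categories -/

section Lin

variable (𝕜 : Type w') [CommRing 𝕜]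

/-- The bicategory obtained from `B` by replacing each set of 2-morphisms by the vector space of
formal `𝕜`-linear combinations; it has the same objects and 1-morphisms. -/
structure LinCat (𝕜 : Type w') (B : Type u) where
  of : B

namespace LinCat

section

variable {𝕜} {C : Type v} [Category.{w} C]

/-- The multiple `r f` of a basis element. -/
noncomputable def sg {X Y : C} (f : X ⟶ Y) (r : 𝕜) : Free.of 𝕜 X ⟶ Free.of 𝕜 Y :=
  Finsupp.single f r

theorem sg_comp {X Y Z : C} (f : X ⟶ Y) (g : Y ⟶ Z) (r s : 𝕜) :
    sg f r ≫ sg g s = sg (f ≫ g) (r * s) :=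
  Free.single_comp_single 𝕜 C f g r s

theorem sg_id (X : C) : 𝟙 (Free.of 𝕜 X) = sg (𝟙 X) 1 := rfl

theorem sg_induction {X Y : C} {P : (Free.of 𝕜 X ⟶ Free.of 𝕜 Y) → Prop} (h0 : P 0)
    (hadd : ∀ f g, P f → P g → P (f + g)) (hs : ∀ f r, P (sg f r)) (f) : P f :=
  Finsupp.induction_linear (motive := P) f h0 hadd hs

end

variable {𝕜} {B : Type u} [Bicategory.{w, v} B] {a b c d e : B}

/-- Linear extension of whiskering. -/
noncomputable def wL (f : a ⟶ b) {g h : b ⟶ c} (η : Free.of 𝕜 g ⟶ Free.of 𝕜 h) :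
    Free.of 𝕜 (f ≫ g) ⟶ Free.of 𝕜 (f ≫ h) :=
  Finsupp.mapDomain (M := 𝕜) (fun x : g ⟶ h => f ◁ x) η

/-- Linear extension of whiskering. -/
noncomputable def wR {f g : a ⟶ b} (η : Free.of 𝕜 f ⟶ Free.of 𝕜 g) (h : b ⟶ c) :
    Free.of 𝕜 (f ≫ h) ⟶ Free.of 𝕜 (g ≫ h) :=
  Finsupp.mapDomain (M := 𝕜) (fun x : f ⟶ g => x ▷ h) η

theorem wL_sg (f : a ⟶ b) {g h : b ⟶ c} (η : g ⟶ h) (r : 𝕜) : wL f (sg η r) = sg (f ◁ η) r :=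
  Finsupp.mapDomain_single

theorem wR_sg {f g : a ⟶ b} (η : f ⟶ g) (h : b ⟶ c) (r : 𝕜) : wR (sg η r) h = sg (η ▷ h) r :=
  Finsupp.mapDomain_single

theorem wL_add (f : a ⟶ b) {g h : b ⟶ c} (η θ : Free.of 𝕜 g ⟶ Free.of 𝕜 h) :
    wL f (η + θ) = wL f η + wL f θ :=
  Finsupp.mapDomain_add

theorem wR_add {f g : a ⟶ b} (η θ : Free.of 𝕜 f ⟶ Free.of 𝕜 g) (h : b ⟶ c) :
    wR (η + θ) h = wR η h + wR θ h :=
  Finsupp.mapDomain_add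

theorem wL_zero (f : a ⟶ b) (g h : b ⟶ c) :
    wL f (0 : Free.of 𝕜 g ⟶ Free.of 𝕜 h) = 0 :=
  Finsupp.mapDomain_zero

theorem wR_zero (f g : a ⟶ b) (h : b ⟶ c) :
    wR (0 : Free.of 𝕜 f ⟶ Free.of 𝕜 g) h = 0 :=
  Finsupp.mapDomain_zero

/-- A 2-isomorphism of `B` as a 2-isomorphism of the linearization. -/
noncomputable def isoOf {f g : a ⟶ b} (φ : f ≅ g) : Free.of 𝕜 f ≅ Free.of 𝕜 g where
  hom := sg φ.hom 1
  inv := sg φ.inv 1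
  hom_inv_id := by rw [sg_comp, φ.hom_inv_id, one_mul, sg_id]
  inv_hom_id := by rw [sg_comp, φ.inv_hom_id, one_mul, sg_id]

theorem wL_id (f : a ⟶ b) (g : b ⟶ c) : wL f (𝟙 (Free.of 𝕜 g)) = 𝟙 (Free.of 𝕜 (f ≫ g)) := by
  rw [sg_id, wL_sg, Bicategory.whiskerLeft_id, sg_id]

theorem wR_id (f : a ⟶ b) (g : b ⟶ c) : wR (𝟙 (Free.of 𝕜 f)) g = 𝟙 (Free.of 𝕜 (f ≫ g)) := by
  rw [sg_id, wR_sg, Bicategory.id_whiskerRight, sg_id]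

theorem wL_comp (f : a ⟶ b) {g h i : b ⟶ c} (η : Free.of 𝕜 g ⟶ Free.of 𝕜 h)
    (θ : Free.of 𝕜 h ⟶ Free.of 𝕜 i) : wL f (η ≫ θ) = wL f η ≫ wL f θ := by
  induction η using sg_induction with
  | h0 => simp only [zero_comp, wL_zero]
  | hadd x y hx hy => simp only [Preadditive.add_comp, wL_add, hx, hy]
  | hs x r =>
    induction θ using sg_induction with
    | h0 => simp only [comp_zero, wL_zero]
    | hadd x y hx hy => simp only [Preadditive.comp_add, wL_add, hx, hy]
    | hs y s => simp only [sg_comp, wL_sg, Bicategory.whiskerLeft_comp]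

theorem wR_comp {f g h : a ⟶ b} (η : Free.of 𝕜 f ⟶ Free.of 𝕜 g)
    (θ : Free.of 𝕜 g ⟶ Free.of 𝕜 h) (i : b ⟶ c) : wR (η ≫ θ) i = wR η i ≫ wR θ i := by
  induction η using sg_induction with
  | h0 => simp only [zero_comp, wR_zero]
  | hadd x y hx hy => simp only [Preadditive.add_comp, wR_add, hx, hy]
  | hs x r =>
    induction θ using sg_induction with
    | h0 => simp only [comp_zero, wR_zero]
    | hadd x y hx hy => simp only [Preadditive.comp_add, wR_add, hx, hy]
    | hs y s => simp only [sg_comp, wR_sg, Bicategory.comp_whiskerRight]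

theorem wL_one {f g : a ⟶ b} (η : Free.of 𝕜 f ⟶ Free.of 𝕜 g) :
    wL (𝟙 a) η = (isoOf (λ_ f)).hom ≫ η ≫ (isoOf (λ_ g)).inv := by
  induction η using sg_induction with
  | h0 => simp only [zero_comp, comp_zero, wL_zero]
  | hadd x y hx hy => simp only [Preadditive.add_comp, Preadditive.comp_add, wL_add, hx, hy]
  | hs x r => simp only [isoOf, sg_comp, wL_sg, Bicategory.id_whiskerLeft, one_mul, mul_one]

theorem wR_one {f g : a ⟶ b} (η : Free.of 𝕜 f ⟶ Free.of 𝕜 g) :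
    wR η (𝟙 b) = (isoOf (ρ_ f)).hom ≫ η ≫ (isoOf (ρ_ g)).inv := by
  induction η using sg_induction with
  | h0 => simp only [zero_comp, comp_zero, wR_zero]
  | hadd x y hx hy => simp only [Preadditive.add_comp, Preadditive.comp_add, wR_add, hx, hy]
  | hs x r => simp only [isoOf, sg_comp, wR_sg, Bicategory.whiskerRight_id, one_mul, mul_one]

theorem wL_wL (f : a ⟶ b) (g : b ⟶ c) {h i : c ⟶ d} (η : Free.of 𝕜 h ⟶ Free.of 𝕜 i) :
    wL (f ≫ g) η = (isoOf (α_ f g h)).hom ≫ wL f (wL g η) ≫ (isoOf (α_ f g i)).inv := by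
  induction η using sg_induction with
  | h0 => simp only [zero_comp, comp_zero, wL_zero]
  | hadd x y hx hy => simp only [Preadditive.add_comp, Preadditive.comp_add, wL_add, hx, hy]
  | hs x r => simp only [isoOf, sg_comp, wL_sg, Bicategory.comp_whiskerLeft, one_mul, mul_one]

theorem wR_wR {f g : a ⟶ b} (η : Free.of 𝕜 f ⟶ Free.of 𝕜 g) (h : b ⟶ c) (i : c ⟶ d) :
    wR η (h ≫ i) = (isoOf (α_ f h i)).inv ≫ wR (wR η h) i ≫ (isoOf (α_ g h i)).hom := by
  induction η using sg_induction with
  | h0 => simp only [zero_comp, comp_zero, wR_zero]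
  | hadd x y hx hy => simp only [Preadditive.add_comp, Preadditive.comp_add, wR_add, hx, hy]
  | hs x r => simp only [isoOf, sg_comp, wR_sg, Bicategory.whiskerRight_comp, one_mul, mul_one]

theorem wR_wL (f : a ⟶ b) {g h : b ⟶ c} (η : Free.of 𝕜 g ⟶ Free.of 𝕜 h) (i : c ⟶ d) :
    wR (wL f η) i = (isoOf (α_ f g i)).hom ≫ wL f (wR η i) ≫ (isoOf (α_ f h i)).inv := by
  induction η using sg_induction with
  | h0 => simp only [zero_comp, comp_zero, wL_zero, wR_zero]
  | hadd x y hx hy =>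
    simp only [Preadditive.add_comp, Preadditive.comp_add, wL_add, wR_add, hx, hy]
  | hs x r => simp only [isoOf, sg_comp, wL_sg, wR_sg, Bicategory.whisker_assoc, one_mul, mul_one]

theorem w_exchange {f g : a ⟶ b} {h i : b ⟶ c} (η : Free.of 𝕜 f ⟶ Free.of 𝕜 g)
    (θ : Free.of 𝕜 h ⟶ Free.of 𝕜 i) : wL f θ ≫ wR η i = wR η h ≫ wL g θ := by
  induction η using sg_induction with
  | h0 => simp only [zero_comp, comp_zero, wR_zero]
  | hadd x y hx hy => simp only [Preadditive.add_comp, Preadditive.comp_add, wR_add, hx, hy]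
  | hs x r =>
    induction θ using sg_induction with
    | h0 => simp only [zero_comp, comp_zero, wL_zero]
    | hadd x y hx hy => simp only [Preadditive.add_comp, Preadditive.comp_add, wL_add, hx, hy]
    | hs y s => rw [wR_sg, wR_sg, wL_sg, wL_sg, sg_comp, sg_comp, whisker_exchange, mul_comm]

theorem w_pentagon (f : a ⟶ b) (g : b ⟶ c) (h : c ⟶ d) (i : d ⟶ e) :
    wR (isoOf (𝕜 := 𝕜) (α_ f g h)).hom i ≫ (isoOf (α_ f (g ≫ h) i)).hom ≫
      wL f (isoOf (α_ g h i)).hom =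
    (isoOf (α_ (f ≫ g) h i)).hom ≫ (isoOf (α_ f g (h ≫ i))).hom := by
  simp only [isoOf, wR_sg, wL_sg, sg_comp, pentagon, mul_one]

theorem w_triangle (f : a ⟶ b) (g : b ⟶ c) :
    (isoOf (𝕜 := 𝕜) (α_ f (𝟙 b) g)).hom ≫ wL f (isoOf (λ_ g)).hom = wR (isoOf (ρ_ f)).hom g := by
  simp only [isoOf, wR_sg, wL_sg, sg_comp, triangle, mul_one]

noncomputable instance : Bicategory (LinCat 𝕜 B) where
  Hom x y := Free 𝕜 (x.of ⟶ y.of)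
  id x := Free.of 𝕜 (𝟙 x.of)
  comp {x y z} f g := Free.of 𝕜 ((show x.of ⟶ y.of from f) ≫ (show y.of ⟶ z.of from g))
  homCategory x y := inferInstanceAs (Category (Free 𝕜 (x.of ⟶ y.of)))
  whiskerLeft {x y _} f _ _ η := wL (show x.of ⟶ y.of from f) η
  whiskerRight {_ y z _ _} η h := wR η (show y.of ⟶ z.of from h)
  associator {x y z t} f g h := isoOf (α_ (show x.of ⟶ y.of from f) (show y.of ⟶ z.of from g)
    (show z.of ⟶ t.of from h))
  leftUnitor {x y} f := isoOf (λ_ (show x.of ⟶ y.of from f))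
  rightUnitor {x y} f := isoOf (ρ_ (show x.of ⟶ y.of from f))
  whiskerLeft_id _ _ := wL_id _ _
  whiskerLeft_comp _ _ _ _ _ _ := wL_comp _ _ _
  id_whiskerLeft _ := wL_one _
  comp_whiskerLeft _ _ _ _ _ := wL_wL _ _ _
  id_whiskerRight _ _ := wR_id _ _
  comp_whiskerRight _ _ _ := wR_comp _ _ _
  whiskerRight_id _ := wR_one _
  whiskerRight_comp _ _ _ := wR_wR _ _ _
  whisker_assoc _ _ _ _ _ := wR_wL _ _ _
  whisker_exchange _ _ := w_exchange _ _
  pentagon _ _ _ _ := w_pentagon _ _ _ _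
  triangle _ _ := w_triangle _ _

noncomputable instance : PreadditiveBicategory (LinCat 𝕜 B) where
  preadditive x y := inferInstanceAs (Preadditive (Free 𝕜 (x.of ⟶ y.of)))
  whiskerLeft_add _ _ _ _ _ := wL_add _ _ _
  add_whiskerRight _ _ _ := wR_add _ _ _

end LinCat

end Lin

end FiatCat

namespace FiatCat

open CategoryTheory Bicategory Limits

universe w v u

/-! ### Additive closure of the morphism categories -/

/-- The bicategory obtained from `B` by replacing each morphism category by its additive closure:
1-morphisms are finite families `⨁ i, F i` of 1-morphisms of `B`, 2-morphisms are matrices of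
2-morphisms of `B`, vertical composition is matrix multiplication, and the composition of
1-morphisms is `(⨁ i, F i) ≫ (⨁ j, G j) = ⨁ (i, j), F i ≫ G j`. -/
structure MatCat (B : Type u) where
  of : B

namespace MatCat

section

variable {C : Type v} [Category.{w} C] [Preadditive C]

/-- The entries of a morphism of `Mat_ C`. -/
noncomputable def ent {M N : Mat_ C} (f : M ⟶ N) (i : M.ι) (j : N.ι) : M.X i ⟶ N.X j := f i j

/-- The morphism of `Mat_ C` with given entries. -/
noncomputable def mat {M N : Mat_ C} (f : ∀ i j, M.X i ⟶ N.X j) : M ⟶ N := f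

theorem ent_mat {M N : Mat_ C} (f : ∀ (i : M.ι) (j : N.ι), M.X i ⟶ N.X j) (i : M.ι) (j : N.ι) :
    ent (mat f) i j = f i j := rfl

theorem mat_ext {M N : Mat_ C} {f g : M ⟶ N} (h : ∀ i j, ent f i j = ent g i j) : f = g :=
  Mat_.hom_ext _ _ h

theorem ent_add {M N : Mat_ C} (f g : M ⟶ N) (i : M.ι) (j : N.ι) :
    ent (f + g) i j = ent f i j + ent g i j := rfl

theorem ent_comp {K M N : Mat_ C} (f : K ⟶ M) (g : M ⟶ N) (i : K.ι) (j : N.ι) :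
    ent (f ≫ g) i j = ∑ k, ent f i k ≫ ent g k j := rfl

theorem ent_id (M : Mat_ C) (i : M.ι) : ent (𝟙 M) i i = 𝟙 (M.X i) := Mat_.id_apply_self M i

theorem ent_id_ne (M : Mat_ C) {i j : M.ι} (h : i ≠ j) : ent (𝟙 M) i j = 0 :=
  Mat_.id_apply_of_ne M i j h

theorem comp_one_apply {M N : Mat_ C} (f : M ⟶ N) (i : M.ι) (j : N.ι) :
    ∑ k, ent f i k ≫ ent (𝟙 N) k j = ent f i j := by
  rw [← ent_comp, Category.comp_id]

theorem one_comp_apply {M N : Mat_ C} (f : M ⟶ N) (i : M.ι) (j : N.ι) :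
    ∑ k, ent (𝟙 M) i k ≫ ent f k j = ent f i j := by
  rw [← ent_comp, Category.id_comp]

/-- Isomorphism of families given by a bijection of the index types and isomorphisms between the
members. -/
noncomputable def rx {M N : Mat_ C} (e : N.ι ≃ M.ι) (φ : ∀ j, M.X (e j) ≅ N.X j) : M ≅ N where
  hom := mat fun i j => ent (𝟙 M) i (e j) ≫ (φ j).hom
  inv := mat fun j i => (φ j).inv ≫ ent (𝟙 M) (e j) i
  hom_inv_id := by
    apply mat_ext
    intro i j
    rw [ent_comp]
    simp only [ent_mat, Category.assoc, Iso.hom_inv_id_assoc]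
    rw [e.sum_comp (fun k => ent (𝟙 M) i k ≫ ent (𝟙 M) k j)]
    exact one_comp_apply (𝟙 M) i j
  inv_hom_id := by
    classical
    apply mat_ext
    intro i j
    rw [ent_comp]
    have : ∀ k, ((φ i).inv ≫ ent (𝟙 M) (e i) k) ≫ ent (𝟙 M) k (e j) ≫ (φ j).hom =
        (φ i).inv ≫ (ent (𝟙 M) (e i) k ≫ ent (𝟙 M) k (e j)) ≫ (φ j).hom := by
      intro k; simp only [Category.assoc]
    simp only [ent_mat]
    rw [Finset.sum_congr rfl (fun k _ => this k), ← Preadditive.comp_sum, ← Preadditive.sum_comp,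
      one_comp_apply (𝟙 M)]
    by_cases h : i = j
    · subst h
      rw [ent_id, ent_id, Category.id_comp, Iso.inv_hom_id]
    · rw [ent_id_ne M (fun h' => h (e.injective h')), ent_id_ne N h, zero_comp, comp_zero]

theorem rx_hom_ent {M N : Mat_ C} (e : N.ι ≃ M.ι) (φ : ∀ j, M.X (e j) ≅ N.X j) (i : M.ι)
    (j : N.ι) : ent (rx e φ).hom i j = ent (𝟙 M) i (e j) ≫ (φ j).hom := rfl

theorem comp_rx {K M N : Mat_ C} (e : N.ι ≃ M.ι) (φ : ∀ j, M.X (e j) ≅ N.X j) (f : K ⟶ M)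
    (i : K.ι) (j : N.ι) : ent (f ≫ (rx e φ).hom) i j = ent f i (e j) ≫ (φ j).hom := by
  rw [ent_comp]
  simp only [rx_hom_ent, ← Category.assoc]
  rw [← Preadditive.sum_comp, comp_one_apply]

theorem rx_comp {K M N : Mat_ C} (e : N.ι ≃ M.ι) (φ : ∀ j, M.X (e j) ≅ N.X j) (f : N ⟶ K)
    (i : N.ι) (k : K.ι) : ent ((rx e φ).hom ≫ f) (e i) k = (φ i).hom ≫ ent f i k := by
  rw [ent_comp, Finset.sum_eq_single i]
  · rw [rx_hom_ent, ent_id, Category.id_comp]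
  · intro j _ h
    rw [rx_hom_ent, ent_id_ne M (fun h' => h (e.injective h').symm), zero_comp, zero_comp]
  · intro h; exact absurd (Finset.mem_univ _) h

theorem rx_ext {K M N : Mat_ C} (e : N.ι ≃ M.ι) {f g : M ⟶ K}
    (h : ∀ i k, ent f (e i) k = ent g (e i) k) : f = g := by
  apply mat_ext
  intro i k
  obtain ⟨i, rfl⟩ := e.surjective i
  exact h i k

end

variable {B : Type u} [Bicategory.{w, v} B] [PreadditiveBicategory B] {a b c d : B}

/-- Composition of families of 1-morphisms. -/
@[reducible] noncomputable def comp₁ (F : Mat_ (a ⟶ b)) (G : Mat_ (b ⟶ c)) : Mat_ (a ⟶ c) where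
  ι := F.ι × G.ι
  X p := F.X p.1 ≫ G.X p.2

/-- The identity 1-morphism as a family with one element. -/
@[reducible] noncomputable def one₁ (a : B) : Mat_ (a ⟶ a) where
  ι := Unit
  X _ := 𝟙 a

/-- Horizontal composition of matrices of 2-morphisms. -/
noncomputable def mhc {F F' : Mat_ (a ⟶ b)} {G G' : Mat_ (b ⟶ c)} (η : F ⟶ F') (θ : G ⟶ G') :
    comp₁ F G ⟶ comp₁ F' G' :=
  mat fun p q => hc (ent η p.1 q.1) (ent θ p.2 q.2)

theorem mhc_ent {F F' : Mat_ (a ⟶ b)} {G G' : Mat_ (b ⟶ c)} (η : F ⟶ F') (θ : G ⟶ G')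
    (p : F.ι × G.ι) (q : F'.ι × G'.ι) :
    ent (mhc η θ) p q = hc (ent η p.1 q.1) (ent θ p.2 q.2) := rfl

theorem mhc_id (F : Mat_ (a ⟶ b)) (G : Mat_ (b ⟶ c)) : mhc (𝟙 F) (𝟙 G) = 𝟙 (comp₁ F G) := by
  apply mat_ext
  rintro ⟨i, j⟩ ⟨i', j'⟩
  rw [mhc_ent]
  by_cases h : i = i'
  · by_cases h' : j = j'
    · subst h h'
      rw [ent_id (comp₁ F G)]
      dsimp only
      rw [ent_id, ent_id, hc_id]
    · rw [ent_id_ne (comp₁ F G) (fun e => h' (congrArg Prod.snd e))]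
      dsimp only
      rw [ent_id_ne G h', hc_zero]
  · rw [ent_id_ne (comp₁ F G) (fun e => h (congrArg Prod.fst e))]
    dsimp only
    rw [ent_id_ne F h, zero_hc]

theorem mhc_comp {F F' F'' : Mat_ (a ⟶ b)} {G G' G'' : Mat_ (b ⟶ c)} (η : F ⟶ F') (η' : F' ⟶ F'')
    (θ : G ⟶ G') (θ' : G' ⟶ G'') : mhc (η ≫ η') (θ ≫ θ') = mhc η θ ≫ mhc η' θ' := by
  apply mat_ext
  rintro ⟨i, j⟩ ⟨i', j'⟩
  rw [mhc_ent, ent_comp, ent_comp, ent_comp, hc_sum_sum]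
  simp only [hc_comp, mhc_ent]
  exact (Fintype.sum_prod_type' (fun x y => hc (ent η i x) (ent θ j y) ≫
    hc (ent η' x i') (ent θ' y j'))).symm

theorem mhc_add {F F' : Mat_ (a ⟶ b)} {G G' : Mat_ (b ⟶ c)} (η : F ⟶ F') (θ θ' : G ⟶ G') :
    mhc η (θ + θ') = mhc η θ + mhc η θ' := by
  apply mat_ext
  rintro p q
  rw [ent_add, mhc_ent, mhc_ent, mhc_ent, ent_add, hc_add]

theorem add_mhc {F F' : Mat_ (a ⟶ b)} {G G' : Mat_ (b ⟶ c)} (η η' : F ⟶ F') (θ : G ⟶ G') :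
    mhc (η + η') θ = mhc η θ + mhc η' θ := by
  apply mat_ext
  rintro p q
  rw [ent_add, mhc_ent, mhc_ent, mhc_ent, ent_add, add_hc]

/-- Reindexing for the associator. -/
def eA (F : Mat_ (a ⟶ b)) (G : Mat_ (b ⟶ c)) (H : Mat_ (c ⟶ d)) :
    (comp₁ F (comp₁ G H)).ι ≃ (comp₁ (comp₁ F G) H).ι := (Equiv.prodAssoc F.ι G.ι H.ι).symm

/-- The entries of the associator. -/
def φA (F : Mat_ (a ⟶ b)) (G : Mat_ (b ⟶ c)) (H : Mat_ (c ⟶ d)) (p : (comp₁ F (comp₁ G H)).ι) :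
    (comp₁ (comp₁ F G) H).X (eA F G H p) ≅ (comp₁ F (comp₁ G H)).X p :=
  α_ (F.X p.1) (G.X p.2.1) (H.X p.2.2)

/-- Reindexing for the left unitor. -/
def eL (F : Mat_ (a ⟶ b)) : F.ι ≃ (comp₁ (one₁ a) F).ι := (Equiv.punitProd F.ι).symm

/-- The entries of the left unitor. -/
def φL (F : Mat_ (a ⟶ b)) (i : F.ι) : (comp₁ (one₁ a) F).X (eL F i) ≅ F.X i := λ_ (F.X i)

/-- Reindexing for the right unitor. -/
def eR (F : Mat_ (a ⟶ b)) : F.ι ≃ (comp₁ F (one₁ b)).ι := (Equiv.prodPUnit F.ι).symm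

/-- The entries of the right unitor. -/
def φR (F : Mat_ (a ⟶ b)) (i : F.ι) : (comp₁ F (one₁ b)).X (eR F i) ≅ F.X i := ρ_ (F.X i)

/-- The associator. -/
noncomputable def assoc₁ (F : Mat_ (a ⟶ b)) (G : Mat_ (b ⟶ c)) (H : Mat_ (c ⟶ d)) :
    comp₁ (comp₁ F G) H ≅ comp₁ F (comp₁ G H) :=
  rx (eA F G H) (φA F G H)

/-- The left unitor. -/
noncomputable def left₁ (F : Mat_ (a ⟶ b)) : comp₁ (one₁ a) F ≅ F := rx (eL F) (φL F)

/-- The right unitor. -/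
noncomputable def right₁ (F : Mat_ (a ⟶ b)) : comp₁ F (one₁ b) ≅ F := rx (eR F) (φR F)

theorem mhc_assoc {F F' : Mat_ (a ⟶ b)} {G G' : Mat_ (b ⟶ c)} {H H' : Mat_ (c ⟶ d)}
    (η : F ⟶ F') (θ : G ⟶ G') (κ : H ⟶ H') :
    mhc (mhc η θ) κ ≫ (assoc₁ F' G' H').hom = (assoc₁ F G H).hom ≫ mhc η (mhc θ κ) := by
  apply rx_ext (eA F G H)
  intro p q
  refine (comp_rx _ _ _ _ _).trans (Eq.trans ?_ (rx_comp _ _ _ _ _).symm)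
  exact hc_assoc _ _ _

theorem mhc_left {F F' : Mat_ (a ⟶ b)} (η : F ⟶ F') :
    mhc (𝟙 (one₁ a)) η ≫ (left₁ F').hom = (left₁ F).hom ≫ η := by
  apply rx_ext (eL F)
  intro p q
  refine (comp_rx _ _ _ _ _).trans (Eq.trans ?_ (rx_comp _ _ _ _ _).symm)
  refine Eq.trans ?_ (hc_left (ent η p q))
  exact congrArg (fun x => hc x (ent η p q) ≫ (λ_ (F'.X q)).hom) (ent_id (one₁ a) ())

theorem mhc_right {F F' : Mat_ (a ⟶ b)} (η : F ⟶ F') :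
    mhc η (𝟙 (one₁ b)) ≫ (right₁ F').hom = (right₁ F).hom ≫ η := by
  apply rx_ext (eR F)
  intro p q
  refine (comp_rx _ _ _ _ _).trans (Eq.trans ?_ (rx_comp _ _ _ _ _).symm)
  refine Eq.trans ?_ (hc_right (ent η p q))
  exact congrArg (fun x => hc (ent η p q) x ≫ (ρ_ (F'.X q)).hom) (ent_id (one₁ b) ())

theorem rx_mhc {M N : Mat_ (a ⟶ b)} (e : N.ι ≃ M.ι) (φ : ∀ j, M.X (e j) ≅ N.X j)
    (H : Mat_ (b ⟶ c)) : mhc (rx e φ).hom (𝟙 H) =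
      (rx (M := comp₁ M H) (N := comp₁ N H) (e.prodCongr (Equiv.refl H.ι))
        (fun p => whiskerRightIso (φ p.1) (H.X p.2))).hom := by
  apply mat_ext
  rintro ⟨i, k⟩ ⟨j, l⟩
  change hc (ent (𝟙 M) i (e j) ≫ (φ j).hom) (ent (𝟙 H) k l) =
    ent (𝟙 (comp₁ M H)) (i, k) (e j, l) ≫ (φ j).hom ▷ H.X l
  rw [← mhc_id, mhc_ent, ← hc_one, ← hc_comp, Category.comp_id]

theorem mhc_rx (F : Mat_ (a ⟶ b)) {M N : Mat_ (b ⟶ c)} (e : N.ι ≃ M.ι)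
    (φ : ∀ j, M.X (e j) ≅ N.X j) : mhc (𝟙 F) (rx e φ).hom =
      (rx (M := comp₁ F M) (N := comp₁ F N) ((Equiv.refl F.ι).prodCongr e)
        (fun p => whiskerLeftIso (F.X p.1) (φ p.2))).hom := by
  apply mat_ext
  rintro ⟨i, k⟩ ⟨j, l⟩
  change hc (ent (𝟙 F) i j) (ent (𝟙 M) k (e l) ≫ (φ l).hom) =
    ent (𝟙 (comp₁ F M)) (i, k) (j, e l) ≫ F.X j ◁ (φ l).hom
  rw [← mhc_id, mhc_ent, ← id_hc, ← hc_comp, Category.comp_id]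

theorem mhc_pentagon {e : B} (F : Mat_ (a ⟶ b)) (G : Mat_ (b ⟶ c)) (H : Mat_ (c ⟶ d))
    (I : Mat_ (d ⟶ e)) :
    mhc (assoc₁ F G H).hom (𝟙 I) ≫ (assoc₁ F (comp₁ G H) I).hom ≫ mhc (𝟙 F) (assoc₁ G H I).hom =
      (assoc₁ (comp₁ F G) H I).hom ≫ (assoc₁ F G (comp₁ H I)).hom := by
  rw [← Category.assoc]
  apply mat_ext
  intro p q
  unfold assoc₁
  rw [mhc_rx, rx_mhc]
  refine (comp_rx _ _ _ _ _).trans ?_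
  refine (congrArg (· ≫ _) (comp_rx _ _ _ _ _)).trans ?_
  refine Eq.trans ?_ (comp_rx _ _ _ _ _).symm
  refine (Category.assoc _ _ _).trans ((Category.assoc _ _ _).trans ?_)
  refine Eq.trans ?_ (Category.assoc _ _ _).symm
  exact congrArg _ (pentagon _ _ _ _)

theorem mhc_triangle (F : Mat_ (a ⟶ b)) (G : Mat_ (b ⟶ c)) :
    (assoc₁ F (one₁ b) G).hom ≫ mhc (𝟙 F) (left₁ G).hom = mhc (right₁ F).hom (𝟙 G) := by
  apply mat_ext
  intro p q
  unfold assoc₁ left₁ right₁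
  rw [mhc_rx, rx_mhc]
  refine (comp_rx _ _ _ _ _).trans ?_
  refine (Category.assoc _ _ _).trans ?_
  exact congrArg _ (triangle _ _)

noncomputable instance : Bicategory (MatCat B) where
  Hom x y := Mat_ (x.of ⟶ y.of)
  id x := one₁ x.of
  comp F G := comp₁ F G
  homCategory x y := inferInstanceAs (Category (Mat_ (x.of ⟶ y.of)))
  whiskerLeft F _ _ η := mhc (𝟙 F) η
  whiskerRight η H := mhc η (𝟙 H)
  associator F G H := assoc₁ F G H
  leftUnitor F := left₁ F
  rightUnitor F := right₁ F
  whiskerLeft_id _ _ := mhc_id _ _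
  whiskerLeft_comp _ _ _ _ _ _ := by
    refine Eq.trans ?_ (mhc_comp _ _ _ _)
    rw [Category.comp_id]
  id_whiskerLeft _ := conj_of_eq (mhc_left _)
  comp_whiskerLeft _ _ _ _ _ := by
    refine conj_of_eq (Eq.trans ?_ (mhc_assoc _ _ _))
    rw [mhc_id]
  id_whiskerRight _ _ := mhc_id _ _
  comp_whiskerRight _ _ _ := by
    refine Eq.trans ?_ (mhc_comp _ _ _ _)
    rw [Category.comp_id]
  whiskerRight_id _ := conj_of_eq (mhc_right _)
  whiskerRight_comp _ _ _ := by
    refine conj_of_eq' (Eq.trans (mhc_assoc _ _ _) ?_)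
    rw [mhc_id]
  whisker_assoc _ _ _ _ _ := conj_of_eq (mhc_assoc _ _ _)
  whisker_exchange _ _ := by
    refine (mhc_comp _ _ _ _).symm.trans (Eq.trans ?_ (mhc_comp _ _ _ _))
    rw [Category.id_comp, Category.comp_id, Category.id_comp, Category.comp_id]
  pentagon _ _ _ _ := mhc_pentagon _ _ _ _
  triangle _ _ := mhc_triangle _ _

noncomputable instance : PreadditiveBicategory (MatCat B) where
  preadditive x y := inferInstanceAs (Preadditive (Mat_ (x.of ⟶ y.of)))
  whiskerLeft_add _ _ _ η θ := mhc_add _ η θ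
  add_whiskerRight η θ _ := add_mhc η θ _

end MatCat

end FiatCat

namespace FiatCat

open CategoryTheory Bicategory Limits Idempotents

universe w v u

/-! ### Idempotent completion of the morphism categories -/

/-- The bicategory obtained from `B` by replacing each morphism category by its idempotent
completion: 1-morphisms are pairs `(F, p)` with `p` an idempotent 2-endomorphism of `F`. -/
structure KarCat (B : Type u) where
  of : B

namespace KarCat

section

variable {C : Type v} [Category.{w} C]

/-- Isomorphism of objects of the idempotent completion from an isomorphism that intertwines the
idempotents. -/
def isoOf {P Q : Karoubi C} (φ : P.X ≅ Q.X) (h : P.p ≫ φ.hom = φ.hom ≫ Q.p) : P ≅ Q where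
  hom := ⟨P.p ≫ φ.hom, by rw [Category.assoc, ← h, P.idem_assoc, P.idem_assoc]⟩
  inv := ⟨φ.inv ≫ P.p, by
    have h' : φ.inv ≫ P.p = Q.p ≫ φ.inv := by
      rw [Iso.inv_comp_eq, ← Category.assoc, ← h, Category.assoc, φ.hom_inv_id, Category.comp_id]
    rw [Category.assoc, P.idem, h', Q.idem_assoc]⟩
  hom_inv_id := by
    ext
    simp
  inv_hom_id := by
    ext
    simp only [Karoubi.comp_f, Category.assoc, Karoubi.idem_assoc, Karoubi.id_f]
    rw [h, φ.inv_hom_id_assoc]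

theorem isoOf_hom_f {P Q : Karoubi C} (φ : P.X ≅ Q.X) (h : P.p ≫ φ.hom = φ.hom ≫ Q.p) :
    (isoOf φ h).hom.f = P.p ≫ φ.hom := rfl

end

variable {B : Type u} [Bicategory.{w, v} B] {a b c d e : B}

/-- Composition of 1-morphisms. -/
@[reducible] def comp₁ (F : Karoubi (a ⟶ b)) (G : Karoubi (b ⟶ c)) : Karoubi (a ⟶ c) where
  X := F.X ≫ G.X
  p := hc F.p G.p
  idem := by rw [← hc_comp, F.idem, G.idem]

/-- The identity 1-morphism. -/
@[reducible] def one₁ (a : B) : Karoubi (a ⟶ a) where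
  X := 𝟙 a
  p := 𝟙 (𝟙 a)
  idem := Category.comp_id _

/-- Horizontal composition of 2-morphisms. -/
def khc {F F' : Karoubi (a ⟶ b)} {G G' : Karoubi (b ⟶ c)} (η : F ⟶ F') (θ : G ⟶ G') :
    comp₁ F G ⟶ comp₁ F' G' :=
  ⟨hc η.f θ.f, by
    rw [← hc_comp, ← hc_comp]
    exact congrArg₂ hc η.comm θ.comm⟩

theorem khc_f {F F' : Karoubi (a ⟶ b)} {G G' : Karoubi (b ⟶ c)} (η : F ⟶ F') (θ : G ⟶ G') :
    (khc η θ).f = hc η.f θ.f := rfl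

theorem khc_id (F : Karoubi (a ⟶ b)) (G : Karoubi (b ⟶ c)) : khc (𝟙 F) (𝟙 G) = 𝟙 (comp₁ F G) := rfl

theorem khc_comp {F F' F'' : Karoubi (a ⟶ b)} {G G' G'' : Karoubi (b ⟶ c)} (η : F ⟶ F')
    (η' : F' ⟶ F'') (θ : G ⟶ G') (θ' : G' ⟶ G'') :
    khc (η ≫ η') (θ ≫ θ') = khc η θ ≫ khc η' θ' := by
  ext
  exact hc_comp _ _ _ _

/-- The associator. -/
def assoc₁ (F : Karoubi (a ⟶ b)) (G : Karoubi (b ⟶ c)) (H : Karoubi (c ⟶ d)) :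
    comp₁ (comp₁ F G) H ≅ comp₁ F (comp₁ G H) :=
  isoOf (α_ F.X G.X H.X) (hc_assoc _ _ _)

/-- The left unitor. -/
def left₁ (F : Karoubi (a ⟶ b)) : comp₁ (one₁ a) F ≅ F := isoOf (λ_ F.X) (hc_left _)

/-- The right unitor. -/
def right₁ (F : Karoubi (a ⟶ b)) : comp₁ F (one₁ b) ≅ F := isoOf (ρ_ F.X) (hc_right _)

theorem khc_assoc {F F' : Karoubi (a ⟶ b)} {G G' : Karoubi (b ⟶ c)} {H H' : Karoubi (c ⟶ d)}
    (η : F ⟶ F') (θ : G ⟶ G') (κ : H ⟶ H') :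
    khc (khc η θ) κ ≫ (assoc₁ F' G' H').hom = (assoc₁ F G H).hom ≫ khc η (khc θ κ) := by
  ext
  change hc (hc η.f θ.f) κ.f ≫ hc (hc F'.p G'.p) H'.p ≫ (α_ _ _ _).hom =
    (hc (hc F.p G.p) H.p ≫ (α_ _ _ _).hom) ≫ hc η.f (hc θ.f κ.f)
  rw [Category.assoc, ← hc_assoc, ← Category.assoc, ← Category.assoc, ← hc_comp, ← hc_comp,
    ← hc_comp, ← hc_comp]
  simp only [Karoubi.comp_p, Karoubi.p_comp]

theorem khc_left {F F' : Karoubi (a ⟶ b)} (η : F ⟶ F') :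
    khc (𝟙 (one₁ a)) η ≫ (left₁ F').hom = (left₁ F).hom ≫ η := by
  ext
  change hc (𝟙 (𝟙 a)) η.f ≫ hc (𝟙 (𝟙 a)) F'.p ≫ (λ_ _).hom =
    (hc (𝟙 (𝟙 a)) F.p ≫ (λ_ _).hom) ≫ η.f
  rw [Category.assoc, ← hc_left, ← Category.assoc, ← Category.assoc, ← hc_comp, ← hc_comp]
  simp only [Karoubi.comp_p, Karoubi.p_comp]

theorem khc_right {F F' : Karoubi (a ⟶ b)} (η : F ⟶ F') :
    khc η (𝟙 (one₁ b)) ≫ (right₁ F').hom = (right₁ F).hom ≫ η := by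
  ext
  change hc η.f (𝟙 (𝟙 b)) ≫ hc F'.p (𝟙 (𝟙 b)) ≫ (ρ_ _).hom =
    (hc F.p (𝟙 (𝟙 b)) ≫ (ρ_ _).hom) ≫ η.f
  rw [Category.assoc, ← hc_right, ← Category.assoc, ← Category.assoc, ← hc_comp, ← hc_comp]
  simp only [Karoubi.comp_p, Karoubi.p_comp]

theorem khc_pentagon (F : Karoubi (a ⟶ b)) (G : Karoubi (b ⟶ c)) (H : Karoubi (c ⟶ d))
    (I : Karoubi (d ⟶ e)) :
    khc (assoc₁ F G H).hom (𝟙 I) ≫ (assoc₁ F (comp₁ G H) I).hom ≫ khc (𝟙 F) (assoc₁ G H I).hom =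
      (assoc₁ (comp₁ F G) H I).hom ≫ (assoc₁ F G (comp₁ H I)).hom := by
  ext
  change hc (hc (hc F.p G.p) H.p ≫ (α_ _ _ _).hom) I.p ≫
    (hc (hc F.p (hc G.p H.p)) I.p ≫ (α_ _ _ _).hom) ≫ hc F.p (hc (hc G.p H.p) I.p ≫ (α_ _ _ _).hom) =
    (hc (hc (hc F.p G.p) H.p) I.p ≫ (α_ _ _ _).hom) ≫ hc (hc F.p G.p) (hc H.p I.p) ≫ (α_ _ _ _).hom
  have e1 : hc (hc (hc F.p G.p) H.p ≫ (α_ F.X G.X H.X).hom) I.p =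
      hc (hc (hc F.p G.p) H.p) I.p ≫ (α_ F.X G.X H.X).hom ▷ I.X := by
    rw [← hc_one, ← hc_comp, Category.comp_id]
  have e2 : hc F.p (hc (hc G.p H.p) I.p ≫ (α_ G.X H.X I.X).hom) =
      hc F.p (hc (hc G.p H.p) I.p) ≫ F.X ◁ (α_ G.X H.X I.X).hom := by
    rw [← id_hc, ← hc_comp, Category.comp_id]
  have e3 : (α_ F.X G.X H.X).hom ▷ I.X ≫ hc (hc F.p (hc G.p H.p)) I.p =
      hc (hc (hc F.p G.p) H.p) I.p ≫ (α_ F.X G.X H.X).hom ▷ I.X := by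
    rw [← hc_one, ← hc_comp, ← hc_comp, ← hc_assoc, Category.comp_id, Category.id_comp]
  rw [e1, e2]
  simp only [Category.assoc]
  rw [← reassoc_of% (hc_assoc (hc F.p G.p) H.p I.p), ← reassoc_of% (hc_assoc F.p (hc G.p H.p) I.p)]
  rw [reassoc_of% e3, reassoc_of% e3]
  simp only [← Category.assoc, ← hc_comp, Karoubi.idem]
  simp only [Category.assoc, pentagon]

theorem khc_triangle (F : Karoubi (a ⟶ b)) (G : Karoubi (b ⟶ c)) :
    (assoc₁ F (one₁ b) G).hom ≫ khc (𝟙 F) (left₁ G).hom = khc (right₁ F).hom (𝟙 G) := by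
  ext
  change (hc (hc F.p (𝟙 (𝟙 b))) G.p ≫ (α_ _ _ _).hom) ≫ hc F.p (hc (𝟙 (𝟙 b)) G.p ≫ (λ_ _).hom) =
    hc (hc F.p (𝟙 (𝟙 b)) ≫ (ρ_ _).hom) G.p
  have e1 : hc F.p (hc (𝟙 (𝟙 b)) G.p ≫ (λ_ G.X).hom) =
      hc F.p (hc (𝟙 (𝟙 b)) G.p) ≫ F.X ◁ (λ_ G.X).hom := by
    rw [← id_hc, ← hc_comp, Category.comp_id]
  have e2 : hc (hc F.p (𝟙 (𝟙 b)) ≫ (ρ_ F.X).hom) G.p =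
      hc (hc F.p (𝟙 (𝟙 b))) G.p ≫ (ρ_ F.X).hom ▷ G.X := by
    rw [← hc_one, ← hc_comp, Category.comp_id]
  rw [e1, e2, Category.assoc, ← reassoc_of% (hc_assoc F.p (𝟙 (𝟙 b)) G.p), triangle]
  simp only [← Category.assoc, ← hc_comp, Karoubi.idem, Category.id_comp]

instance : Bicategory (KarCat B) where
  Hom x y := Karoubi (x.of ⟶ y.of)
  id x := one₁ x.of
  comp F G := comp₁ F G
  homCategory x y := inferInstanceAs (Category (Karoubi (x.of ⟶ y.of)))
  whiskerLeft F _ _ η := khc (𝟙 F) η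
  whiskerRight η H := khc η (𝟙 H)
  associator F G H := assoc₁ F G H
  leftUnitor F := left₁ F
  rightUnitor F := right₁ F
  whiskerLeft_id _ _ := khc_id _ _
  whiskerLeft_comp _ _ _ _ _ _ := by
    refine Eq.trans ?_ (khc_comp _ _ _ _)
    rw [Category.comp_id]
  id_whiskerLeft _ := conj_of_eq (khc_left _)
  comp_whiskerLeft _ _ _ _ _ := by
    refine conj_of_eq (Eq.trans ?_ (khc_assoc _ _ _))
    rw [khc_id]
  id_whiskerRight _ _ := khc_id _ _
  comp_whiskerRight _ _ _ := by
    refine Eq.trans ?_ (khc_comp _ _ _ _)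
    rw [Category.comp_id]
  whiskerRight_id _ := conj_of_eq (khc_right _)
  whiskerRight_comp _ _ _ := by
    refine conj_of_eq' (Eq.trans (khc_assoc _ _ _) ?_)
    rw [khc_id]
  whisker_assoc _ _ _ _ _ := conj_of_eq (khc_assoc _ _ _)
  whisker_exchange _ _ := by
    refine (khc_comp _ _ _ _).symm.trans (Eq.trans ?_ (khc_comp _ _ _ _))
    rw [Category.id_comp, Category.comp_id, Category.id_comp, Category.comp_id]
  pentagon _ _ _ _ := khc_pentagon _ _ _ _
  triangle _ _ := khc_triangle _ _

variable [PreadditiveBicategory B]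

theorem khc_add {F F' : Karoubi (a ⟶ b)} {G G' : Karoubi (b ⟶ c)} (η : F ⟶ F') (θ θ' : G ⟶ G') :
    khc η (θ + θ') = khc η θ + khc η θ' := by
  ext
  exact hc_add _ _ _

theorem add_khc {F F' : Karoubi (a ⟶ b)} {G G' : Karoubi (b ⟶ c)} (η η' : F ⟶ F') (θ : G ⟶ G') :
    khc (η + η') θ = khc η θ + khc η' θ := by
  ext
  exact add_hc _ _ _

instance : PreadditiveBicategory (KarCat B) where
  preadditive x y := inferInstanceAs (Preadditive (Karoubi (x.of ⟶ y.of)))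
  whiskerLeft_add _ _ _ η θ := khc_add _ η θ
  add_whiskerRight η θ _ := add_khc η θ _

end KarCat

end FiatCat

namespace FiatCat

open CategoryTheory Bicategory Limits Idempotents

universe w v u

/-! ### Splitting the identity 1-morphisms -/

/-- A primitive idempotent in the (commutative) endomorphism algebra of an identity 1-morphism. -/
structure PrimitiveIdempotent {C : Type u} [Bicategory.{w, v} C] [PreadditiveBicategory C]
    (i : C) where
  val : 𝟙 i ⟶ 𝟙 i
  idem : val ≫ val = val
  ne_zero : val ≠ 0
  primitive : ∀ f : 𝟙 i ⟶ 𝟙 i, f ≫ f = f → val ≫ f = f → f ≫ val = f → f = 0 ∨ f = val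

/-- The objects of the 2-category obtained from `C` by splitting the identity 1-morphisms: pairs
`(i, ε)` of an object `i` of `C` and a primitive idempotent `ε` of the endomorphism algebra of
`𝟙 i`. -/
structure SplitCat (C : Type u) [Bicategory.{w, v} C] [PreadditiveBicategory C] where
  obj : C
  idem : PrimitiveIdempotent obj

namespace SplitCat

section

variable {C : Type u} [Bicategory.{w, v} C] {a b c : C}

/-- The 2-endomorphism `id_F ∘₀ ε` of `F`. -/
def lact (ε₀ : 𝟙 a ⟶ 𝟙 a) (F : a ⟶ b) : F ⟶ F := (λ_ F).inv ≫ ε₀ ▷ F ≫ (λ_ F).hom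

/-- The 2-endomorphism `δ ∘₀ id_F` of `F`. -/
def ract (F : a ⟶ b) (δ : 𝟙 b ⟶ 𝟙 b) : F ⟶ F := (ρ_ F).inv ≫ F ◁ δ ≫ (ρ_ F).hom

theorem lact_naturality (ε₀ : 𝟙 a ⟶ 𝟙 a) {F G : a ⟶ b} (f : F ⟶ G) :
    lact ε₀ F ≫ f = f ≫ lact ε₀ G := by
  simp only [lact, Category.assoc]
  rw [← leftUnitor_naturality, leftUnitor_inv_naturality_assoc, whisker_exchange_assoc]

theorem ract_naturality (δ : 𝟙 b ⟶ 𝟙 b) {F G : a ⟶ b} (f : F ⟶ G) :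
    ract F δ ≫ f = f ≫ ract G δ := by
  simp only [ract, Category.assoc]
  rw [← rightUnitor_naturality, rightUnitor_inv_naturality_assoc, whisker_exchange_assoc]

theorem lact_idem {ε₀ : 𝟙 a ⟶ 𝟙 a} (h : ε₀ ≫ ε₀ = ε₀) (F : a ⟶ b) :
    lact ε₀ F ≫ lact ε₀ F = lact ε₀ F := by
  simp only [lact, Category.assoc, Iso.hom_inv_id_assoc]
  rw [← comp_whiskerRight_assoc, h]

theorem ract_idem {δ : 𝟙 b ⟶ 𝟙 b} (h : δ ≫ δ = δ) (F : a ⟶ b) :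
    ract F δ ≫ ract F δ = ract F δ := by
  simp only [ract, Category.assoc, Iso.hom_inv_id_assoc]
  rw [← whiskerLeft_comp_assoc, h]

theorem lact_comp (ε₀ : 𝟙 a ⟶ 𝟙 a) (F : a ⟶ b) (G : b ⟶ c) :
    lact ε₀ (F ≫ G) = lact ε₀ F ▷ G := by
  simp [lact]

theorem ract_comp (F : a ⟶ b) (G : b ⟶ c) (δ : 𝟙 c ⟶ 𝟙 c) :
    ract (F ≫ G) δ = F ◁ ract G δ := by
  simp [ract]

theorem lact_one (ε₀ : 𝟙 a ⟶ 𝟙 a) : lact ε₀ (𝟙 a) = ε₀ := by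
  simp [lact, unitors_equal, unitors_inv_equal]

theorem ract_one (ε₀ : 𝟙 a ⟶ 𝟙 a) : ract (𝟙 a) ε₀ = ε₀ := by
  simp [ract, ← unitors_equal, ← unitors_inv_equal]

end

variable {C : Type u} [Bicategory.{w, v} C] [PreadditiveBicategory C]

/-- The 1-morphisms `(i, ε) ⟶ (j, δ)` are the same as the 1-morphisms `i ⟶ j` of `C`. -/
structure Hom₁ (x y : SplitCat C) where
  of : x.obj ⟶ y.obj

variable {x y z t s : SplitCat C}

/-- The idempotent 2-endomorphism `δ ∘₀ id_F ∘₀ ε` of `F : (i, ε) ⟶ (j, δ)`. -/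
def cut (x y : SplitCat C) (F : x.obj ⟶ y.obj) : F ⟶ F := lact x.idem.val F ≫ ract F y.idem.val

theorem cut_naturality {F G : x.obj ⟶ y.obj} (f : F ⟶ G) : cut x y F ≫ f = f ≫ cut x y G := by
  simp only [cut, Category.assoc]
  rw [ract_naturality, ← Category.assoc, lact_naturality, Category.assoc]

theorem cut_lact (F : x.obj ⟶ y.obj) : cut x y F ≫ lact x.idem.val F = cut x y F := by
  rw [cut, Category.assoc, ract_naturality, ← Category.assoc, lact_idem x.idem.idem]

theorem cut_ract (F : x.obj ⟶ y.obj) : cut x y F ≫ ract F y.idem.val = cut x y F := by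
  rw [cut, Category.assoc, ract_idem y.idem.idem]

theorem cut_idem (F : x.obj ⟶ y.obj) : cut x y F ≫ cut x y F = cut x y F := by
  have h : cut x y F ≫ lact x.idem.val F ≫ ract F y.idem.val = cut x y F := by
    rw [← Category.assoc, cut_lact, cut_ract]
  exact h

/-- `F` together with the idempotent `δ ∘₀ id_F ∘₀ ε`. -/
@[reducible] def toKaroubi (F : Hom₁ x y) : Karoubi (x.obj ⟶ y.obj) where
  X := F.of
  p := cut x y F.of
  idem := cut_idem F.of

/-- The 2-morphisms `F ⟶ G` between 1-morphisms `(i, ε) ⟶ (j, δ)` are the 2-morphisms of `C` in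
`δ ∘₀ Hom(F, G) ∘₀ ε`, i.e. those fixed under composition with `δ ∘₀ id_F ∘₀ ε` and with
`δ ∘₀ id_G ∘₀ ε`. -/
instance : Category (Hom₁ x y) where
  Hom F G := toKaroubi F ⟶ toKaroubi G
  id F := 𝟙 (toKaroubi F)
  comp f g := Karoubi.Hom.mk (f.f ≫ g.f) (Karoubi.comp_proof g f)
  id_comp f := Category.id_comp (X := toKaroubi _) f
  comp_id f := Category.comp_id (X := toKaroubi _) f
  assoc f g h := Category.assoc (W := toKaroubi _) f g h

instance : Preadditive (Hom₁ x y) where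
  homGroup F G := inferInstanceAs (AddCommGroup (toKaroubi F ⟶ toKaroubi G))
  add_comp F _ _ f g h := Preadditive.add_comp (toKaroubi F) _ _ f g h
  comp_add F _ _ f g h := Preadditive.comp_add (toKaroubi F) _ _ f g h

/-- The underlying 2-morphism of `C`. -/
def u {F G : Hom₁ x y} (f : F ⟶ G) : F.of ⟶ G.of := Karoubi.Hom.f f

theorem u_ext {F G : Hom₁ x y} {f g : F ⟶ G} (h : u f = u g) : f = g := Karoubi.Hom.ext h

theorem u_id (F : Hom₁ x y) : u (𝟙 F) = cut x y F.of := rfl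

theorem u_comp {F G H : Hom₁ x y} (f : F ⟶ G) (g : G ⟶ H) : u (f ≫ g) = u f ≫ u g := rfl

theorem u_add {F G : Hom₁ x y} (f g : F ⟶ G) : u (f + g) = u f + u g := rfl

theorem u_zero (F G : Hom₁ x y) : u (0 : F ⟶ G) = 0 := rfl

theorem cut_u {F G : Hom₁ x y} (f : F ⟶ G) : cut x y F.of ≫ u f = u f := Karoubi.p_comp f

theorem u_cut {F G : Hom₁ x y} (f : F ⟶ G) : u f ≫ cut x y G.of = u f := Karoubi.comp_p f

/-- The 2-morphism `f` of `C` as a 2-morphism, if `f` is fixed by the idempotent. -/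
def ofCut {F G : Hom₁ x y} (f : F.of ⟶ G.of) (h : cut x y F.of ≫ f = f) : F ⟶ G :=
  Karoubi.Hom.mk f (by
    change cut x y F.of ≫ f ≫ cut x y G.of = f
    rw [← Category.assoc, h, ← cut_naturality, h])

theorem u_ofCut {F G : Hom₁ x y} (f : F.of ⟶ G.of) (h : cut x y F.of ≫ f = f) : u (ofCut f h) = f := rfl

/-- The full functor from `C(i, j)`, identical on 1-morphisms, that cuts 2-morphisms. -/
def cutFunctor (x y : SplitCat C) : (x.obj ⟶ y.obj) ⥤ Hom₁ x y where
  obj F := ⟨F⟩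
  map {F G} f := ofCut (F := ⟨F⟩) (G := ⟨G⟩) (cut x y F ≫ f) (by rw [← Category.assoc, cut_idem])
  map_id F := u_ext (Category.comp_id (cut x y F))
  map_comp {F G H} f g := by
    apply u_ext
    change cut x y F ≫ f ≫ g = (cut x y F ≫ f) ≫ cut x y G ≫ g
    rw [cut_naturality f, Category.assoc, ← Category.assoc (cut x y G), cut_idem,
      ← Category.assoc f, ← cut_naturality f, Category.assoc]

instance : (cutFunctor x y).Additive where
  map_add := u_ext (Preadditive.comp_add _ _ _ _ _ _)

instance [∀ a b : C, HasBinaryBiproducts (a ⟶ b)] : HasBinaryBiproducts (Hom₁ x y) where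
  has_binary_biproduct F G :=
    haveI := preservesBinaryBiproducts_of_preservesBiproducts (cutFunctor x y)
    Functor.hasBinaryBiproduct_of_preserves (cutFunctor x y) F.of G.of

instance [∀ a b : C, HasZeroObject (a ⟶ b)] : HasZeroObject (Hom₁ x y) :=
  ((cutFunctor x y).map_isZero (isZero_zero (x.obj ⟶ y.obj))).hasZeroObject


section comp

variable [∀ a b : C, IsIdempotentComplete (a ⟶ b)]

/-- The direct summand of `F : (i, ε) ⟶ (j, δ)` cut out by `δ ∘₀ id_F ∘₀ ε`. -/
noncomputable def im (F : Hom₁ x y) : x.obj ⟶ y.obj :=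
  (IsIdempotentComplete.idempotents_split F.of (cut x y F.of) (cut_idem F.of)).choose

/-- The inclusion of the direct summand. -/
noncomputable def ι (F : Hom₁ x y) : im F ⟶ F.of :=
  (IsIdempotentComplete.idempotents_split F.of (cut x y F.of) (cut_idem F.of)).choose_spec.choose

/-- The projection to the direct summand. -/
noncomputable def π (F : Hom₁ x y) : F.of ⟶ im F :=
  (IsIdempotentComplete.idempotents_split F.of (cut x y F.of)
    (cut_idem F.of)).choose_spec.choose_spec.choose

theorem ι_π (F : Hom₁ x y) : ι F ≫ π F = 𝟙 (im F) :=
  (IsIdempotentComplete.idempotents_split F.of (cut x y F.of)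
    (cut_idem F.of)).choose_spec.choose_spec.choose_spec.1

theorem π_ι (F : Hom₁ x y) : π F ≫ ι F = cut x y F.of :=
  (IsIdempotentComplete.idempotents_split F.of (cut x y F.of)
    (cut_idem F.of)).choose_spec.choose_spec.choose_spec.2

theorem ι_cut (F : Hom₁ x y) : ι F ≫ cut x y F.of = ι F := by
  rw [← π_ι, ← Category.assoc, ι_π, Category.id_comp]

theorem cut_π (F : Hom₁ x y) : cut x y F.of ≫ π F = π F := by
  rw [← π_ι, Category.assoc, ι_π, Category.comp_id]

theorem lact_im (F : Hom₁ x y) : lact x.idem.val (im F) = 𝟙 (im F) := by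
  have h : lact x.idem.val (im F) ≫ ι F = ι F := by
    rw [lact_naturality]
    conv_lhs => rw [← ι_cut, Category.assoc, cut_lact]
    exact ι_cut F
  rw [← Category.comp_id (lact _ _), ← ι_π, ← Category.assoc, h]

theorem ract_im (F : Hom₁ x y) : ract (im F) y.idem.val = 𝟙 (im F) := by
  have h : ract (im F) y.idem.val ≫ ι F = ι F := by
    rw [ract_naturality]
    conv_lhs => rw [← ι_cut, Category.assoc, cut_ract]
    exact ι_cut F
  rw [← Category.comp_id (ract _ _), ← ι_π, ← Category.assoc, h]

/-- A 2-morphism `F ⟶ G` as a 2-morphism between the direct summands. -/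
noncomputable def E {F G : Hom₁ x y} (f : F ⟶ G) : im F ⟶ im G := ι F ≫ u f ≫ π G

theorem E_id (F : Hom₁ x y) : E (𝟙 F) = 𝟙 (im F) := by
  rw [E, u_id, cut_π, ι_π]

theorem E_comp {F G H : Hom₁ x y} (f : F ⟶ G) (g : G ⟶ H) : E (f ≫ g) = E f ≫ E g := by
  simp only [E, Category.assoc, u_comp]
  rw [← Category.assoc (π G), π_ι, ← Category.assoc (cut x y _), cut_u]

theorem E_ι {F G : Hom₁ x y} (f : F ⟶ G) : E f ≫ ι G = ι F ≫ u f := by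
  rw [E, Category.assoc, Category.assoc, π_ι, u_cut]

theorem π_E {F G : Hom₁ x y} (f : F ⟶ G) : π F ≫ E f = u f ≫ π G := by
  rw [E, ← Category.assoc, π_ι, ← Category.assoc, cut_u]

theorem E_add {F G : Hom₁ x y} (f g : F ⟶ G) : E (f + g) = E f + E g := by
  simp only [E, u_add, Preadditive.add_comp, Preadditive.comp_add]

/-- Composition of 1-morphisms is induced by composition in `C`, where the factors are cut by
the idempotents.  Up to isomorphism this is `F ≫ G` with its summand cut out by the idempotent of
the middle object. -/
@[reducible] noncomputable def comp₁ (F : Hom₁ x y) (G : Hom₁ y z) : Hom₁ x z := ⟨im F ≫ im G⟩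

theorem cut_comp₁ (F : Hom₁ x y) (G : Hom₁ y z) : cut x z (im F ≫ im G) = 𝟙 (im F ≫ im G) := by
  rw [cut, lact_comp, ract_comp, lact_im, ract_im]
  simp

theorem π_ι_comp₁ (F : Hom₁ x y) (G : Hom₁ y z) :
    π (comp₁ F G) ≫ ι (comp₁ F G) = 𝟙 (im F ≫ im G) :=
  (π_ι _).trans (cut_comp₁ F G)

/-- The identity 1-morphism of `(i, ε)` is `𝟙 i`. -/
@[reducible] def one₁ (x : SplitCat C) : Hom₁ x x := ⟨𝟙 x.obj⟩

theorem π_ι_one₁ (x : SplitCat C) : π (one₁ x) ≫ ι (one₁ x) = x.idem.val := by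
  refine (π_ι _).trans ?_
  change lact x.idem.val (𝟙 _) ≫ ract (𝟙 _) x.idem.val = _
  rw [lact_one, ract_one, x.idem.idem]

/-- Horizontal composition of 2-morphisms is induced by that in `C`. -/
noncomputable def hcomp {F F' : Hom₁ x y} {G G' : Hom₁ y z} (η : F ⟶ F') (θ : G ⟶ G') :
    comp₁ F G ⟶ comp₁ F' G' :=
  ofCut (hc (E η) (E θ)) ((congrArg (· ≫ _) (cut_comp₁ F G)).trans (Category.id_comp _))

theorem u_hcomp {F F' : Hom₁ x y} {G G' : Hom₁ y z} (η : F ⟶ F') (θ : G ⟶ G') :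
    u (hcomp η θ) = hc (E η) (E θ) := rfl

theorem u_id_comp₁ (F : Hom₁ x y) (G : Hom₁ y z) : u (𝟙 (comp₁ F G)) = 𝟙 (im F ≫ im G) :=
  cut_comp₁ F G

theorem hcomp_id (F : Hom₁ x y) (G : Hom₁ y z) : hcomp (𝟙 F) (𝟙 G) = 𝟙 (comp₁ F G) := by
  apply u_ext
  rw [u_hcomp, E_id, E_id, u_id_comp₁, hc_id]

theorem hcomp_comp {F F' F'' : Hom₁ x y} {G G' G'' : Hom₁ y z} (η : F ⟶ F') (η' : F' ⟶ F'')
    (θ : G ⟶ G') (θ' : G' ⟶ G'') : hcomp (η ≫ η') (θ ≫ θ') = hcomp η θ ≫ hcomp η' θ' := by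
  apply u_ext
  rw [u_comp, u_hcomp, u_hcomp, u_hcomp, E_comp, E_comp]
  exact hc_comp _ _ _ _

/-- The associator. -/
noncomputable def assoc₁ (F : Hom₁ x y) (G : Hom₁ y z) (H : Hom₁ z t) :
    comp₁ (comp₁ F G) H ≅ comp₁ F (comp₁ G H) where
  hom := ofCut (ι (comp₁ F G) ▷ im H ≫ (α_ (im F) (im G) (im H)).hom ≫ im F ◁ π (comp₁ G H))
    ((congrArg (· ≫ _) (cut_comp₁ _ _)).trans (Category.id_comp _))
  inv := ofCut (im F ◁ ι (comp₁ G H) ≫ (α_ (im F) (im G) (im H)).inv ≫ π (comp₁ F G) ▷ im H)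
    ((congrArg (· ≫ _) (cut_comp₁ _ _)).trans (Category.id_comp _))
  hom_inv_id := by
    apply u_ext
    rw [u_comp, u_id_comp₁, u_ofCut, u_ofCut]
    simp only [Category.assoc]
    rw [← whiskerLeft_comp_assoc, π_ι_comp₁, Bicategory.whiskerLeft_id, Category.id_comp,
      Iso.hom_inv_id_assoc, ← comp_whiskerRight, ι_π, id_whiskerRight]
  inv_hom_id := by
    apply u_ext
    rw [u_comp, u_id_comp₁, u_ofCut, u_ofCut]
    simp only [Category.assoc]
    rw [← comp_whiskerRight_assoc, π_ι_comp₁, id_whiskerRight, Category.id_comp,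
      Iso.inv_hom_id_assoc, ← whiskerLeft_comp, ι_π, Bicategory.whiskerLeft_id]

/-- The left unitor. -/
noncomputable def left₁ (F : Hom₁ x y) : comp₁ (one₁ x) F ≅ F where
  hom := ofCut (ι (one₁ x) ▷ im F ≫ (λ_ (im F)).hom ≫ ι F)
    ((congrArg (· ≫ _) (cut_comp₁ _ _)).trans (Category.id_comp _))
  inv := ofCut (π F ≫ (λ_ (im F)).inv ≫ π (one₁ x) ▷ im F) (by rw [← Category.assoc, cut_π])
  hom_inv_id := by
    apply u_ext
    rw [u_comp, u_id_comp₁, u_ofCut, u_ofCut]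
    simp only [Category.assoc]
    rw [← Category.assoc (ι F), ι_π, Category.id_comp, Iso.hom_inv_id_assoc, ← comp_whiskerRight,
      ι_π, id_whiskerRight]
  inv_hom_id := by
    apply u_ext
    rw [u_comp, u_id, u_ofCut, u_ofCut]
    simp only [Category.assoc]
    rw [← comp_whiskerRight_assoc, π_ι_one₁]
    have h : (λ_ (im F)).inv ≫ x.idem.val ▷ im F ≫ (λ_ (im F)).hom = 𝟙 _ := lact_im F
    have h' := congrArg (fun f => π F ≫ f ≫ ι F) h
    simp only [Category.assoc, Category.id_comp, π_ι] at h'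
    exact h'

/-- The right unitor. -/
noncomputable def right₁ (F : Hom₁ x y) : comp₁ F (one₁ y) ≅ F where
  hom := ofCut (im F ◁ ι (one₁ y) ≫ (ρ_ (im F)).hom ≫ ι F)
    ((congrArg (· ≫ _) (cut_comp₁ _ _)).trans (Category.id_comp _))
  inv := ofCut (π F ≫ (ρ_ (im F)).inv ≫ im F ◁ π (one₁ y)) (by rw [← Category.assoc, cut_π])
  hom_inv_id := by
    apply u_ext
    rw [u_comp, u_id_comp₁, u_ofCut, u_ofCut]
    simp only [Category.assoc]
    rw [← Category.assoc (ι F), ι_π, Category.id_comp, Iso.hom_inv_id_assoc, ← whiskerLeft_comp,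
      ι_π, Bicategory.whiskerLeft_id]
  inv_hom_id := by
    apply u_ext
    rw [u_comp, u_id, u_ofCut, u_ofCut]
    simp only [Category.assoc]
    rw [← whiskerLeft_comp_assoc, π_ι_one₁]
    have h : (ρ_ (im F)).inv ≫ im F ◁ y.idem.val ≫ (ρ_ (im F)).hom = 𝟙 _ := ract_im F
    have h' := congrArg (fun f => π F ≫ f ≫ ι F) h
    simp only [Category.assoc, Category.id_comp, π_ι] at h'
    exact h'

theorem u_assoc₁ (F : Hom₁ x y) (G : Hom₁ y z) (H : Hom₁ z t) : u (assoc₁ F G H).hom =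
    ι (comp₁ F G) ▷ im H ≫ (α_ (im F) (im G) (im H)).hom ≫ im F ◁ π (comp₁ G H) := rfl

theorem u_left₁ (F : Hom₁ x y) :
    u (left₁ F).hom = ι (one₁ x) ▷ im F ≫ (λ_ (im F)).hom ≫ ι F := rfl

theorem u_right₁ (F : Hom₁ x y) :
    u (right₁ F).hom = im F ◁ ι (one₁ y) ≫ (ρ_ (im F)).hom ≫ ι F := rfl

theorem hcomp_assoc {F F' : Hom₁ x y} {G G' : Hom₁ y z} {H H' : Hom₁ z t}
    (η : F ⟶ F') (θ : G ⟶ G') (κ : H ⟶ H') :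
    hcomp (hcomp η θ) κ ≫ (assoc₁ F' G' H').hom = (assoc₁ F G H).hom ≫ hcomp η (hcomp θ κ) := by
  apply u_ext
  rw [u_comp, u_comp, u_hcomp, u_hcomp, u_assoc₁, u_assoc₁]
  have h1 : hc (E (hcomp η θ)) (E κ) ≫ ι (comp₁ F' G') ▷ im H' =
      ι (comp₁ F G) ▷ im H ≫ hc (hc (E η) (E θ)) (E κ) := by
    rw [← hc_one, ← hc_one, ← hc_comp, E_ι, u_hcomp, Category.comp_id]
    exact ((congrArg (hc _) (Category.id_comp _).symm).trans (hc_comp _ _ _ _))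
  have h2 : im F ◁ π (comp₁ G H) ≫ hc (E η) (E (hcomp θ κ)) =
      hc (E η) (hc (E θ) (E κ)) ≫ im F' ◁ π (comp₁ G' H') := by
    rw [← id_hc, ← id_hc, ← hc_comp, π_E, u_hcomp, Category.id_comp]
    exact ((congrArg (hc · _) (Category.comp_id _).symm).trans (hc_comp _ _ _ _))
  calc _ = (hc (E (hcomp η θ)) (E κ) ≫ ι (comp₁ F' G') ▷ im H') ≫
        (α_ (im F') (im G') (im H')).hom ≫ im F' ◁ π (comp₁ G' H') := (Category.assoc _ _ _).symm
    _ = ι (comp₁ F G) ▷ im H ≫ (hc (hc (E η) (E θ)) (E κ) ≫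
        (α_ (im F') (im G') (im H')).hom) ≫ im F' ◁ π (comp₁ G' H') := by
          rw [h1]; simp only [Category.assoc]
    _ = ι (comp₁ F G) ▷ im H ≫ (α_ (im F) (im G) (im H)).hom ≫
        hc (E η) (hc (E θ) (E κ)) ≫ im F' ◁ π (comp₁ G' H') := by
          rw [hc_assoc]; simp only [Category.assoc]
    _ = _ := by rw [← h2]; simp only [Category.assoc]

theorem hcomp_left {F F' : Hom₁ x y} (η : F ⟶ F') :
    hcomp (𝟙 (one₁ x)) η ≫ (left₁ F').hom = (left₁ F).hom ≫ η := by
  apply u_ext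
  rw [u_comp, u_comp, u_hcomp, u_left₁, u_left₁, E_id, id_hc]
  have := E_ι η
  simp only [Category.assoc]
  rw [← this, ← leftUnitor_naturality_assoc, whisker_exchange_assoc]

theorem hcomp_right {F F' : Hom₁ x y} (η : F ⟶ F') :
    hcomp η (𝟙 (one₁ y)) ≫ (right₁ F').hom = (right₁ F).hom ≫ η := by
  apply u_ext
  rw [u_comp, u_comp, u_hcomp, u_right₁, u_right₁, E_id, hc_one]
  have := E_ι η
  simp only [Category.assoc]
  rw [← this, ← rightUnitor_naturality_assoc, whisker_exchange_assoc]

theorem E_assoc₁ (F : Hom₁ x y) (G : Hom₁ y z) (H : Hom₁ z t) : E (assoc₁ F G H).hom =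
    ι (comp₁ (comp₁ F G) H) ≫ (ι (comp₁ F G) ▷ im H ≫ (α_ (im F) (im G) (im H)).hom ≫
      im F ◁ π (comp₁ G H)) ≫ π (comp₁ F (comp₁ G H)) := rfl

theorem hcomp_pentagon (F : Hom₁ x y) (G : Hom₁ y z) (H : Hom₁ z t) (I : Hom₁ t s) :
    hcomp (assoc₁ F G H).hom (𝟙 I) ≫ (assoc₁ F (comp₁ G H) I).hom ≫
        hcomp (𝟙 F) (assoc₁ G H I).hom =
      (assoc₁ (comp₁ F G) H I).hom ≫ (assoc₁ F G (comp₁ H I)).hom := by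
  apply u_ext
  rw [u_comp, u_comp, u_comp, u_hcomp, u_hcomp, E_id, E_id, id_hc, hc_one, E_assoc₁, E_assoc₁,
    u_assoc₁, u_assoc₁, u_assoc₁]
  have h1 : π (comp₁ F (comp₁ G H)) ▷ im I ≫ ι (comp₁ F (comp₁ G H)) ▷ im I =
      𝟙 ((im F ≫ im (comp₁ G H)) ≫ im I) := by
    rw [← comp_whiskerRight, π_ι_comp₁, id_whiskerRight]
  have h2 : im F ◁ π (comp₁ (comp₁ G H) I) ≫ im F ◁ ι (comp₁ (comp₁ G H) I) =
      𝟙 (im F ≫ im (comp₁ G H) ≫ im I) := by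
    rw [← whiskerLeft_comp, π_ι_comp₁, Bicategory.whiskerLeft_id]
  have h3 : im F ◁ (π (comp₁ G H) ▷ im I) ≫ im F ◁ (ι (comp₁ G H) ▷ im I) =
      𝟙 (im F ≫ (im G ≫ im H) ≫ im I) := by
    rw [← whiskerLeft_comp, ← comp_whiskerRight, π_ι_comp₁, id_whiskerRight,
      Bicategory.whiskerLeft_id]
  simp only [comp_whiskerRight, whiskerLeft_comp, Category.assoc]
  rw [reassoc_of% h1, reassoc_of% h2, associator_naturality_middle_assoc, reassoc_of% h3,
    pentagon_assoc, whisker_exchange_assoc, associator_naturality_left_assoc,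
    associator_naturality_right_assoc]

theorem hcomp_triangle (F : Hom₁ x y) (G : Hom₁ y z) :
    (assoc₁ F (one₁ y) G).hom ≫ hcomp (𝟙 F) (left₁ G).hom = hcomp (right₁ F).hom (𝟙 G) := by
  apply u_ext
  rw [u_comp, u_hcomp, u_hcomp, E_id, E_id, id_hc, hc_one, E, E, u_assoc₁, u_left₁, u_right₁]
  have h2 : im F ◁ π (comp₁ (one₁ y) G) ≫ im F ◁ ι (comp₁ (one₁ y) G) =
      𝟙 (im F ≫ im (one₁ y) ≫ im G) := by
    rw [← whiskerLeft_comp, π_ι_comp₁, Bicategory.whiskerLeft_id]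
  simp only [comp_whiskerRight, whiskerLeft_comp, Category.assoc]
  rw [reassoc_of% h2, ← whiskerLeft_comp (im F) (ι G), ι_π, Bicategory.whiskerLeft_id,
    ← comp_whiskerRight (ι F), ι_π, id_whiskerRight, Category.comp_id, Category.comp_id,
    ← associator_naturality_middle_assoc, triangle]

noncomputable instance : Bicategory (SplitCat C) where
  Hom x y := Hom₁ x y
  id x := one₁ x
  comp F G := comp₁ F G
  homCategory x y := inferInstanceAs (Category (Hom₁ x y))
  whiskerLeft F _ _ η := hcomp (𝟙 F) η
  whiskerRight η H := hcomp η (𝟙 H)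
  associator F G H := assoc₁ F G H
  leftUnitor F := left₁ F
  rightUnitor F := right₁ F
  whiskerLeft_id _ _ := hcomp_id _ _
  whiskerLeft_comp _ _ _ _ _ _ := by
    refine Eq.trans ?_ (hcomp_comp _ _ _ _)
    rw [Category.comp_id]
  id_whiskerLeft _ := conj_of_eq (hcomp_left _)
  comp_whiskerLeft _ _ _ _ _ := by
    refine conj_of_eq (Eq.trans ?_ (hcomp_assoc _ _ _))
    rw [hcomp_id]
  id_whiskerRight _ _ := hcomp_id _ _
  comp_whiskerRight _ _ _ := by
    refine Eq.trans ?_ (hcomp_comp _ _ _ _)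
    rw [Category.comp_id]
  whiskerRight_id _ := conj_of_eq (hcomp_right _)
  whiskerRight_comp _ _ _ := by
    refine conj_of_eq' (Eq.trans (hcomp_assoc _ _ _) ?_)
    rw [hcomp_id]
  whisker_assoc _ _ _ _ _ := conj_of_eq (hcomp_assoc _ _ _)
  whisker_exchange _ _ := by
    refine (hcomp_comp _ _ _ _).symm.trans (Eq.trans ?_ (hcomp_comp _ _ _ _))
    rw [Category.id_comp, Category.comp_id, Category.id_comp, Category.comp_id]
  pentagon _ _ _ _ := hcomp_pentagon _ _ _ _
  triangle _ _ := hcomp_triangle _ _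

theorem hcomp_add {F F' : Hom₁ x y} {G G' : Hom₁ y z} (η : F ⟶ F') (θ θ' : G ⟶ G') :
    hcomp η (θ + θ') = hcomp η θ + hcomp η θ' := by
  apply u_ext
  rw [u_add, u_hcomp, u_hcomp, u_hcomp, E_add]
  exact hc_add _ _ _

theorem add_hcomp {F F' : Hom₁ x y} {G G' : Hom₁ y z} (η η' : F ⟶ F') (θ : G ⟶ G') :
    hcomp (η + η') θ = hcomp η θ + hcomp η' θ := by
  apply u_ext
  rw [u_add, u_hcomp, u_hcomp, u_hcomp, E_add]
  exact add_hc _ _ _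

noncomputable instance : PreadditiveBicategory (SplitCat C) where
  preadditive x y := inferInstanceAs (Preadditive (Hom₁ x y))
  whiskerLeft_add _ _ _ η θ := hcomp_add _ η θ
  add_whiskerRight η θ _ := add_hcomp η θ _

end comp

end SplitCat

end FiatCat

namespace FiatCat

open CategoryTheory Bicategory Limits Idempotents

universe w v u

instance {B : Type u} [Bicategory.{w, v} B] [PreadditiveBicategory B] (x y : MatCat B) :
    HasFiniteBiproducts (x ⟶ y) :=
  inferInstanceAs (HasFiniteBiproducts (Mat_ (x.of ⟶ y.of)))

instance {B : Type u} [Bicategory.{w, v} B] [PreadditiveBicategory B]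
    [∀ a b : B, HasFiniteBiproducts (a ⟶ b)] (x y : KarCat B) : HasFiniteBiproducts (x ⟶ y) :=
  inferInstanceAs (HasFiniteBiproducts (Karoubi (x.of ⟶ y.of)))

instance {B : Type u} [Bicategory.{w, v} B] [PreadditiveBicategory B]
    [∀ a b : B, HasFiniteBiproducts (a ⟶ b)] (x y : KarCat B) : HasBinaryBiproducts (x ⟶ y) :=
  hasBinaryBiproducts_of_finite_biproducts _

instance {B : Type u} [Bicategory.{w, v} B] [PreadditiveBicategory B]
    [∀ a b : B, HasFiniteBiproducts (a ⟶ b)] (x y : KarCat B) : HasZeroObject (x ⟶ y) :=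
  hasZeroObject_of_hasFiniteBiproducts _

instance {B : Type u} [Bicategory.{w, v} B] (x y : KarCat B) : IsIdempotentComplete (x ⟶ y) :=
  inferInstanceAs (IsIdempotentComplete (Karoubi (x.of ⟶ y.of)))

instance {C : Type u} [Bicategory.{w, v} C] [PreadditiveBicategory C]
    [∀ a b : C, IsIdempotentComplete (a ⟶ b)] [∀ a b : C, HasBinaryBiproducts (a ⟶ b)]
    (x y : SplitCat C) : HasBinaryBiproducts (x ⟶ y) :=
  inferInstanceAs (HasBinaryBiproducts (SplitCat.Hom₁ x y))

instance {C : Type u} [Bicategory.{w, v} C] [PreadditiveBicategory C]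
    [∀ a b : C, IsIdempotentComplete (a ⟶ b)] [∀ a b : C, HasZeroObject (a ⟶ b)]
    (x y : SplitCat C) : HasZeroObject (x ⟶ y) :=
  inferInstanceAs (HasZeroObject (SplitCat.Hom₁ x y))

/-- The finitarization `𝕜 B` of a 2-category `B`: each `𝕜 B (i, j)` is the idempotent completion of
the additive closure of the `𝕜`-linearization of `B (i, j)`. -/
abbrev Finitarization (𝕜 : Type*) [Field 𝕜] (B : Type*) : Type _ := KarCat (MatCat (LinCat 𝕜 B))

/-! ### Split Grothendieck groups -/

/-- The set of isomorphism classes of objects. -/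
def IsoClass (C : Type u) [Category.{v} C] : Type u := Quotient (isIsomorphicSetoid C)

namespace IsoClass

variable {C : Type u} [Category.{v} C]

/-- The isomorphism class of an object. -/
def of (X : C) : IsoClass C := Quotient.mk (isIsomorphicSetoid C) X

theorem sound {X Y : C} (e : X ≅ Y) : of X = of Y := Quotient.sound ⟨e⟩

theorem ind {P : IsoClass C → Prop} (h : ∀ X, P (of X)) (x : IsoClass C) : P x :=
  Quotient.inductionOn x h

variable [Preadditive C] [HasZeroObject C] [HasBinaryBiproducts C]

open ZeroObject

/-- Addition of isomorphism classes is the direct sum. -/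
noncomputable instance : Add (IsoClass C) :=
  ⟨Quotient.map₂ (fun X Y => X ⊞ Y) (by
    rintro X X' ⟨e⟩ Y Y' ⟨f⟩
    exact ⟨biprod.mapIso e f⟩)⟩

noncomputable instance : Zero (IsoClass C) := ⟨of 0⟩

noncomputable instance : AddCommMonoid (IsoClass C) where
  add_assoc := by
    refine ind fun X => ind fun Y => ind fun Z => ?_
    exact sound (biprod.associator X Y Z)
  zero_add := by
    refine ind fun X => ?_
    exact sound (isoZeroBiprod (isZero_zero C)).symm
  add_zero := by
    refine ind fun X => ?_
    exact sound (isoBiprodZero (isZero_zero C)).symm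
  add_comm := by
    refine ind fun X => ind fun Y => ?_
    exact sound (biprod.braiding X Y)
  nsmul := nsmulRec

end IsoClass

/-- The split Grothendieck group of an additive category. -/
abbrev SplitK₀ (C : Type u) [Category.{v} C] [Preadditive C] [HasZeroObject C]
    [HasBinaryBiproducts C] : Type u :=
  Algebra.GrothendieckAddGroup (IsoClass C)

namespace SplitK₀

section

variable {C : Type u} [Category.{v} C] [Preadditive C] [HasZeroObject C] [HasBinaryBiproducts C]

/-- The class of an object in the split Grothendieck group. -/
noncomputable def cls (X : C) : SplitK₀ C := Algebra.GrothendieckAddGroup.of (IsoClass.of X)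

theorem hom_ext {A : Type*} [AddCommGroup A] {f g : SplitK₀ C →+ A}
    (h : ∀ X, f (cls X) = g (cls X)) : f = g := by
  apply Algebra.GrothendieckAddGroup.lift.symm.injective
  ext x
  induction x using IsoClass.ind with
  | h X => exact h X

theorem lift_cls {A : Type*} [AddCommGroup A] (f : IsoClass C →+ A) (X : C) :
    Algebra.GrothendieckAddGroup.lift f (cls X) = f (IsoClass.of X) :=
  DFunLike.congr_fun (Algebra.GrothendieckAddGroup.lift.symm_apply_apply f) (IsoClass.of X)

theorem cls_eq {X Y : C} (e : X ≅ Y) : cls X = cls Y :=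
  congrArg (fun x => (Algebra.GrothendieckAddGroup.of x : SplitK₀ C)) (IsoClass.sound e)

theorem induct {P : SplitK₀ C → Prop} (cls : ∀ X, P (cls X))
    (sub : ∀ x y, P x → P y → P (x - y)) (x : SplitK₀ C) : P x := by
  let H : AddSubgroup (SplitK₀ C) := AddSubgroup.closure (Set.range SplitK₀.cls)
  have h : QuotientAddGroup.mk' H = 0 := hom_ext fun X =>
    (QuotientAddGroup.eq_zero_iff _).2 (AddSubgroup.subset_closure ⟨X, rfl⟩)
  have hx : x ∈ H := (QuotientAddGroup.eq_zero_iff x).1 (DFunLike.congr_fun h x)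
  obtain ⟨X⟩ : Nonempty C := ⟨(HasZeroObject.zero' C).zero⟩
  have h0 : P 0 := by
    have := sub (SplitK₀.cls X) (SplitK₀.cls X) (cls X) (cls X)
    rwa [sub_self] at this
  have key : ∀ y, y ∈ H → P y := by
    intro y hy
    induction hy using AddSubgroup.closure_induction with
    | mem y hy => obtain ⟨X, rfl⟩ := hy; exact cls X
    | zero => exact h0
    | add y z _ _ hy hz =>
      have := sub y (0 - z) hy (sub 0 z h0 hz)
      rwa [zero_sub, sub_neg_eq_add] at this
    | neg y _ hy =>
      have := sub 0 y h0 hy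
      rwa [zero_sub] at this
  exact key x hx

end

variable {B : Type u} [Bicategory.{w, v} B] [PreadditiveBicategory B]
  [∀ a b : B, HasZeroObject (a ⟶ b)] [∀ a b : B, HasBinaryBiproducts (a ⟶ b)] {a b c d : B}

/-- Composition with `F` as a functor. -/
def whL (F : a ⟶ b) (c : B) : (b ⟶ c) ⥤ (a ⟶ c) where
  obj G := F ≫ G
  map η := F ◁ η

/-- Composition with `G` as a functor. -/
def whR (a : B) (G : b ⟶ c) : (a ⟶ b) ⥤ (a ⟶ c) where
  obj F := F ≫ G
  map η := η ▷ G

instance (F : a ⟶ b) (c : B) : (whL F c).Additive :=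
  ⟨PreadditiveBicategory.whiskerLeft_add F _ _⟩

instance (a : B) (G : b ⟶ c) : (whR a G).Additive :=
  ⟨PreadditiveBicategory.add_whiskerRight _ _ G⟩

section

variable {C D : Type*} [Category* C] [Category* D] [Preadditive C] [HasZeroObject C]
  [HasBinaryBiproducts C] [Preadditive D] [HasZeroObject D] [HasBinaryBiproducts D]

/-- The homomorphism of monoids of isomorphism classes given by an additive functor. -/
noncomputable def mapIsoClass (F : C ⥤ D) [F.Additive] : IsoClass C →+ IsoClass D where
  toFun := Quotient.map F.obj (by rintro X Y ⟨e⟩; exact ⟨F.mapIso e⟩)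
  map_zero' := IsoClass.sound ((F.map_isZero (isZero_zero C)).iso (isZero_zero D))
  map_add' := by
    have := preservesBinaryBiproducts_of_preservesBiproducts F
    refine IsoClass.ind fun X => IsoClass.ind fun Y => ?_
    exact IsoClass.sound (F.mapBiprod X Y)

end

/-- Composition of 1-morphisms on isomorphism classes. -/
def isoComp : IsoClass (a ⟶ b) → IsoClass (b ⟶ c) → IsoClass (a ⟶ c) :=
  Quotient.map₂ (fun F G => F ≫ G) (by
    rintro F F' ⟨e⟩ G G' ⟨f⟩
    exact ⟨whiskerRightIso e G ≪≫ whiskerLeftIso F' f⟩)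

theorem isoComp_zero (F : IsoClass (a ⟶ b)) : isoComp F (0 : IsoClass (b ⟶ c)) = 0 := by
  induction F using IsoClass.ind with
  | h F => exact (mapIsoClass (whL F c)).map_zero

theorem isoComp_add (F : IsoClass (a ⟶ b)) (G H : IsoClass (b ⟶ c)) :
    isoComp F (G + H) = isoComp F G + isoComp F H := by
  induction F using IsoClass.ind with
  | h F => exact (mapIsoClass (whL F c)).map_add G H

theorem zero_isoComp (G : IsoClass (b ⟶ c)) : isoComp (0 : IsoClass (a ⟶ b)) G = 0 := by
  induction G using IsoClass.ind with
  | h G => exact (mapIsoClass (whR a G)).map_zero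

theorem add_isoComp (F F' : IsoClass (a ⟶ b)) (G : IsoClass (b ⟶ c)) :
    isoComp (F + F') G = isoComp F G + isoComp F' G := by
  induction G using IsoClass.ind with
  | h G => exact (mapIsoClass (whR a G)).map_add F F'

/-- Composition with a fixed isomorphism class of 1-morphisms. -/
noncomputable def comp₀ (F : IsoClass (a ⟶ b)) : SplitK₀ (b ⟶ c) →+ SplitK₀ (a ⟶ c) :=
  Algebra.GrothendieckAddGroup.lift
    { toFun := fun G => Algebra.GrothendieckAddGroup.of (isoComp F G)
      map_zero' := by rw [isoComp_zero, map_zero]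
      map_add' := fun G H => by rw [isoComp_add, map_add] }

theorem comp₀_apply (F : IsoClass (a ⟶ b)) (G : b ⟶ c) :
    comp₀ F (cls G) = Algebra.GrothendieckAddGroup.of (isoComp F (IsoClass.of G)) :=
  lift_cls _ _

theorem comp₀_cls (F : a ⟶ b) (G : b ⟶ c) : comp₀ (IsoClass.of F) (cls G) = cls (F ≫ G) :=
  lift_cls _ _

/-- The biadditive composition of split Grothendieck groups with `[F] ⋅ [G] ↦ [F ≫ G]`. -/
noncomputable def comp : SplitK₀ (a ⟶ b) →+ SplitK₀ (b ⟶ c) →+ SplitK₀ (a ⟶ c) :=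
  Algebra.GrothendieckAddGroup.lift
    { toFun := comp₀
      map_zero' := by
        refine hom_ext fun G => ?_
        refine (lift_cls _ _).trans ?_
        exact (congrArg (fun x => (Algebra.GrothendieckAddGroup.of x : SplitK₀ (a ⟶ c)))
          (zero_isoComp _)).trans (map_zero _)
      map_add' := fun F F' => by
        refine hom_ext fun G => ?_
        refine (lift_cls _ _).trans ?_
        refine (congrArg (fun x => (Algebra.GrothendieckAddGroup.of x : SplitK₀ (a ⟶ c)))
          (add_isoComp _ _ _)).trans ((map_add _ _ _).trans ?_)
        rw [AddMonoidHom.add_apply]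
        exact congrArg₂ (fun x y : SplitK₀ (a ⟶ c) => x + y) (comp₀_apply F G).symm
          (comp₀_apply F' G).symm }

theorem comp_cls (F : a ⟶ b) (G : b ⟶ c) : comp (cls F) (cls G) = cls (F ≫ G) :=
  (DFunLike.congr_fun (lift_cls _ F) (cls G)).trans (comp₀_cls F G)

theorem comp_add_left (f f' : SplitK₀ (a ⟶ b)) (g : SplitK₀ (b ⟶ c)) :
    comp (f + f') g = comp f g + comp f' g := by rw [map_add, AddMonoidHom.add_apply]

theorem comp_add_right (f : SplitK₀ (a ⟶ b)) (g g' : SplitK₀ (b ⟶ c)) :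
    comp f (g + g') = comp f g + comp f g' := map_add _ _ _

theorem one_comp (f : SplitK₀ (a ⟶ b)) : comp (cls (𝟙 a)) f = f := by
  induction f using induct with
  | cls F => rw [comp_cls]; exact cls_eq (λ_ F)
  | sub x y hx hy => rw [map_sub, hx, hy]

theorem comp_one (f : SplitK₀ (a ⟶ b)) : comp f (cls (𝟙 b)) = f := by
  induction f using induct with
  | cls F => rw [comp_cls]; exact cls_eq (ρ_ F)
  | sub x y hx hy => rw [map_sub, AddMonoidHom.sub_apply, hx, hy]

theorem comp_assoc (f : SplitK₀ (a ⟶ b)) (g : SplitK₀ (b ⟶ c)) (h : SplitK₀ (c ⟶ d)) :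
    comp (comp f g) h = comp f (comp g h) := by
  induction f using induct with
  | sub x y hx hy => simp only [map_sub, AddMonoidHom.sub_apply, hx, hy]
  | cls F =>
    induction g using induct with
    | sub x y hx hy => simp only [map_sub, AddMonoidHom.sub_apply, hx, hy]
    | cls G =>
      induction h using induct with
      | sub x y hx hy => simp only [map_sub, hx, hy]
      | cls H =>
        rw [comp_cls, comp_cls, comp_cls, comp_cls]
        exact cls_eq (α_ F G H)

end SplitK₀

/-! ### Decategorification -/

/-- The Grothendieck decategorification `[C]` of `C`: it has the same objects, and its morphisms
`i ⟶ j` form the split Grothendieck group of `C (i, j)`. -/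
structure Decat (C : Type u) where
  of : C

namespace Decat

variable {C : Type u} [Bicategory.{w, v} C] [PreadditiveBicategory C]
  [∀ a b : C, HasZeroObject (a ⟶ b)] [∀ a b : C, HasBinaryBiproducts (a ⟶ b)]

noncomputable instance : Category (Decat C) where
  Hom x y := SplitK₀ (x.of ⟶ y.of)
  id x := SplitK₀.cls (𝟙 x.of)
  comp f g := SplitK₀.comp f g
  id_comp := SplitK₀.one_comp
  comp_id := SplitK₀.comp_one
  assoc := SplitK₀.comp_assoc

noncomputable instance : Preadditive (Decat C) where
  homGroup x y := inferInstanceAs (AddCommGroup (SplitK₀ (x.of ⟶ y.of)))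
  add_comp _ _ _ f f' g := SplitK₀.comp_add_left f f' g
  comp_add _ _ _ f g g' := SplitK₀.comp_add_right f g g'

/-- The class of a 1-morphism. -/
noncomputable def cls {i j : C} (F : i ⟶ j) : (⟨i⟩ : Decat C) ⟶ ⟨j⟩ := SplitK₀.cls F

end Decat

section CategoryAlgebra

variable (D : Type u) [Category.{v} D] [Preadditive D]

/-- The direct sum of all groups of morphisms of a preadditive category. -/
def CategoryAlgebra : Type (max u v) := DirectSum (D × D) fun p => p.1 ⟶ p.2

namespace CategoryAlgebra

noncomputable instance : AddCommGroup (CategoryAlgebra D) :=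
  inferInstanceAs (AddCommGroup (DirectSum (D × D) fun p => p.1 ⟶ p.2))

variable {D}

/-- The element of the category algebra given by a morphism. -/
noncomputable def of (x y : D) : (x ⟶ y) →+ CategoryAlgebra D :=
  letI : DecidableEq (D × D) := Classical.decEq _
  DirectSum.of (fun p : D × D => p.1 ⟶ p.2) (x, y)

/-- An additive map from the category algebra is given on morphisms. -/
noncomputable def lift {A : Type*} [AddCommMonoid A] (φ : ∀ x y : D, (x ⟶ y) →+ A) :
    CategoryAlgebra D →+ A :=
  letI : DecidableEq (D × D) := Classical.decEq _
  DirectSum.toAddMonoid (β := fun p : D × D => p.1 ⟶ p.2) fun p => φ p.1 p.2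

theorem lift_of {A : Type*} [AddCommMonoid A] (φ : ∀ x y : D, (x ⟶ y) →+ A) {x y : D}
    (f : x ⟶ y) : lift φ (of x y f) = φ x y f :=
  letI : DecidableEq (D × D) := Classical.decEq _
  DirectSum.toAddMonoid_of (β := fun p : D × D => p.1 ⟶ p.2) _ (x, y) f

theorem hom_ext {A : Type*} [AddCommMonoid A] {φ ψ : CategoryAlgebra D →+ A}
    (h : ∀ (x y : D) (f : x ⟶ y), φ (of x y f) = ψ (of x y f)) : φ = ψ :=
  letI : DecidableEq (D × D) := Classical.decEq _
  DirectSum.addHom_ext (β := fun p : D × D => p.1 ⟶ p.2) fun p f => h p.1 p.2 f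

open Classical in
/-- The product of a morphism `f : y ⟶ z` with a morphism `g : x ⟶ y'`: it is the composition
`f ∘ g` if `y = y'`, and zero otherwise. -/
noncomputable def mulAux (y z x y' : D) : (y ⟶ z) →+ (x ⟶ y') →+ CategoryAlgebra D :=
  if h : y' = y then
    AddMonoidHom.mk' (fun f => AddMonoidHom.mk' (fun g => of x z (g ≫ eqToHom h ≫ f))
      (fun g g' => by rw [Preadditive.add_comp, map_add]))
      (fun f f' => by
        ext g
        change of x z _ = of x z _ + of x z _
        rw [Preadditive.comp_add, Preadditive.comp_add, map_add])
  else 0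

/-- The multiplication of the category algebra as a biadditive map. -/
noncomputable def mulHom : CategoryAlgebra D →+ CategoryAlgebra D →+ CategoryAlgebra D :=
  lift fun y z => AddMonoidHom.flip (lift fun x y' => AddMonoidHom.flip (mulAux y z x y'))

noncomputable instance : Mul (CategoryAlgebra D) := ⟨fun a b => mulHom a b⟩

theorem of_mul {x y y' z : D} (f : y ⟶ z) (g : x ⟶ y') :
    of y z f * of x y' g = mulAux y z x y' f g := by
  change mulHom (of y z f) (of x y' g) = _
  rw [mulHom, lift_of, AddMonoidHom.flip_apply, lift_of, AddMonoidHom.flip_apply]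

theorem of_mul_of {x y z : D} (f : y ⟶ z) (g : x ⟶ y) :
    of y z f * of x y g = of x z (g ≫ f) := by
  rw [of_mul, mulAux, dif_pos rfl]
  change of x z (g ≫ eqToHom rfl ≫ f) = _
  rw [eqToHom_refl, Category.id_comp]

theorem of_mul_of_ne {x y y' z : D} (f : y ⟶ z) (g : x ⟶ y') (h : y' ≠ y) :
    of y z f * of x y' g = 0 := by
  rw [of_mul, mulAux, dif_neg h, AddMonoidHom.zero_apply, AddMonoidHom.zero_apply]

theorem mul_add' (a b c : CategoryAlgebra D) : a * (b + c) = a * b + a * c :=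
  map_add (mulHom a) b c

theorem add_mul' (a b c : CategoryAlgebra D) : (a + b) * c = a * c + b * c :=
  DFunLike.congr_fun (map_add mulHom a b) c

theorem zero_mul' (a : CategoryAlgebra D) : 0 * a = 0 := DFunLike.congr_fun (map_zero mulHom) a

theorem mul_zero' (a : CategoryAlgebra D) : a * 0 = 0 := map_zero (mulHom a)

theorem induct {P : CategoryAlgebra D → Prop} (zero : P 0) (add : ∀ a b, P a → P b → P (a + b))
    (of : ∀ x y f, P (of x y f)) (a : CategoryAlgebra D) : P a :=
  letI : DecidableEq (D × D) := Classical.decEq _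
  DirectSum.induction_on (β := fun p : D × D => p.1 ⟶ p.2) a zero (fun p f => of p.1 p.2 f) add

noncomputable instance : NonUnitalRing (CategoryAlgebra D) where
  left_distrib := mul_add'
  right_distrib := add_mul'
  zero_mul := zero_mul'
  mul_zero := mul_zero'
  mul_assoc a b c := by
    induction a using induct with
    | zero => rw [zero_mul', zero_mul', zero_mul']
    | add a a' h h' => rw [add_mul', add_mul', add_mul', h, h']
    | of y z f =>
      induction b using induct with
      | zero => rw [zero_mul', mul_zero', zero_mul']
      | add b b' h h' => rw [add_mul', mul_add', mul_add', add_mul', h, h']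
      | of x y' g =>
        induction c using induct with
        | zero => rw [mul_zero', mul_zero', mul_zero']
        | add c c' h h' => rw [mul_add', mul_add', mul_add', h, h']
        | of w x' k =>
          by_cases h : y' = y
          · subst h
            by_cases h' : x' = x
            · subst h'
              rw [of_mul_of, of_mul_of, of_mul_of, of_mul_of, Category.assoc]
            · rw [of_mul_of, of_mul_of_ne _ _ h', of_mul_of_ne _ _ h', mul_zero']
          · by_cases h' : x' = x
            · subst h'
              rw [of_mul_of, of_mul_of_ne _ _ h, of_mul_of_ne _ _ h, zero_mul']
            · rw [of_mul_of_ne _ _ h, of_mul_of_ne _ _ h', mul_zero', zero_mul']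

end CategoryAlgebra

end CategoryAlgebra

/-- The decategorification of `C`: the `ℤ`-algebra `⨁ [C] (i, j)`, the sum over all objects `i` and
`j`, with multiplication `[G] [F] = [G ∘ F]` induced from composition. -/
abbrev DecatAlgebra (C : Type u) [Bicategory.{w, v} C] [PreadditiveBicategory C]
    [∀ a b : C, HasZeroObject (a ⟶ b)] [∀ a b : C, HasBinaryBiproducts (a ⟶ b)] : Type _ :=
  CategoryAlgebra (Decat C)

/-- The class of a 1-morphism in the decategorification. -/
noncomputable def DecatAlgebra.cls {C : Type u} [Bicategory.{w, v} C] [PreadditiveBicategory C]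
    [∀ a b : C, HasZeroObject (a ⟶ b)] [∀ a b : C, HasBinaryBiproducts (a ⟶ b)] {i j : C}
    (F : i ⟶ j) : DecatAlgebra C :=
  CategoryAlgebra.of (⟨i⟩ : Decat C) ⟨j⟩ (Decat.cls F)

end FiatCat

namespace FiatCat

open CategoryTheory Bicategory Limits Idempotents

universe w v u

/-- The classes of the indecomposable 1-morphisms in the decategorification. -/
def indecomposableClasses (C : Type u) [Bicategory.{w, v} C] [PreadditiveBicategory C]
    [∀ a b : C, HasZeroObject (a ⟶ b)] [∀ a b : C, HasBinaryBiproducts (a ⟶ b)] :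
    Set (DecatAlgebra C) :=
  {x | ∃ (i j : C) (F : i ⟶ j), Indecomposable F ∧ x = DecatAlgebra.cls F}

namespace Finitarization

/-- An object of `B` as an object of its finitarization. -/
def obj (𝕜 : Type*) [Field 𝕜] {B : Type u} (i : B) : Finitarization 𝕜 B := ⟨⟨⟨i⟩⟩⟩

/-- A 1-morphism of `B` as a 1-morphism of the finitarization of `B`: the family with the single
member `F`, together with the identity idempotent. -/
noncomputable def map (𝕜 : Type*) [Field 𝕜] {B : Type u} [Bicategory.{w, v} B] {i j : B}
    (F : i ⟶ j) : obj 𝕜 i ⟶ obj 𝕜 j :=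
  let F₁ : (⟨i⟩ : LinCat 𝕜 B) ⟶ ⟨j⟩ := Free.of 𝕜 F
  let F₂ : (⟨⟨i⟩⟩ : MatCat (LinCat 𝕜 B)) ⟶ ⟨⟨j⟩⟩ := (Mat_.mk Unit fun _ => F₁)
  Karoubi.mk F₂ (𝟙 F₂) (Category.comp_id _)

end Finitarization

/-! ### The Möbius basis -/

instance (α : Type*) [Finite α] : Finite (Setoid α) :=
  Finite.of_injective (fun (s : Setoid α) => fun a b => s a b) fun _ _ h =>
    Setoid.ext fun a b => iff_of_eq (congrFun (congrFun h a) b)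

open Classical in
/-- The Möbius function `μ(X, Y)` of the lattice of partitions of `{1, …, n}`, ordered by
refinement: `X ≤ Y` if every part of `X` is contained in a part of `Y`. -/
noncomputable def partitionMoebius {n : ℕ} (X Y : Setoid (Fin n)) : ℤ :=
  letI : Fintype (Setoid (Fin n)) := Fintype.ofFinite _
  letI : LocallyFiniteOrder (Setoid (Fin n)) := Fintype.toLocallyFiniteOrder
  IncidenceAlgebra.mu ℤ X Y

namespace FStar

variable {n : ℕ}

/-- The partition of `{1, …, n}` induced by an element of `F*_n`. -/
def ker (s : FStar n) : Setoid (Fin n) := Setoid.comap Sum.inl s.val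

open Classical in
/-- The element `∑ μ(ker s, ker t) t` of `ℤ[F*_n]`, where the sum is over all `t ≤ s` in the
natural partial order, i.e. over all `t` coarser than `s`. -/
noncomputable def moebius (s : FStar n) : MonoidAlgebra ℤ (FStar n) :=
  letI : Fintype (FStar n) := Fintype.ofFinite _
  ∑ t : FStar n with t ≤ s, MonoidAlgebra.single t (partitionMoebius (ker s) (ker t))

end FStar

end FiatCat

/-! ### Krull-Schmidt categories and bases of the decategorification. -/

namespace FiatCat

open CategoryTheory Bicategory Limits Idempotents

universe w v u w'

/-! For γ in F*_n let χ_γ be the linear form on the semigroup algebra that adds up the coefficients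
of all elements finer than γ (`FStar.char`). These forms govern the whole proof.

An element of F*_n coarser than a given s is determined by its kernel, so the elements between s and
t form an interval of the partition lattice. Möbius inversion then says that χ_t takes the value 1
on the Möbius element of s if s = t, and 0 otherwise (`FStar.char_moebius`): the Möbius elements are
the basis dual to the forms χ_t. Above the identity the product is the join, so each χ_t is
multiplicative there, and the Möbius elements of the idempotents are orthogonal idempotents.
Translating by permutations, the Möbius elements of s and t multiply to that of st if ker s = coker
t, and to 0 otherwise (`FStar.mob_mul_mob`). So ℤ[F*_n] is the algebra of a groupoid whose objects
are the partitions of {1, …, n}.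

The same forms describe B_n. The space of 2-morphisms π ⟶ σ over 𝕜 is the span of the elements of
F*_n coarser than π and σ. Vertical composition is the join, hence χ_γ is multiplicative for it, and
the Möbius elements become matrix units (`BCat.elem_comp_elem`). The linearized morphism category is
therefore a disjoint union of matrix categories, one for each γ, and its additive and idempotent
completion has exactly one indecomposable T_γ for each γ (`BCat.separatingChars`). Horizontal
composition is the product of the semigroup algebra (`BCat.toAlg_lhc`), so T_t ∘ T_s ≅ T_{ts} when
ker t = coker s. The primitive idempotents of the endomorphism algebra of the identity 1-morphism
are the Möbius elements of the idempotents of F*_n, one for each partition. After splitting, T_s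
survives between the objects K and L exactly when ker s = K and coker s = L (`BCat.cut_eq_id_iff`).
Thus the indecomposables compose like the groupoid above.

For the 2-category of an ordered monoid the spaces of 2-morphisms have dimension at most one. The
forms that read off the coefficient of the identity of s play the role of χ_γ, because an idempotent
matrix on which they all vanish is strictly triangular, hence zero. The indecomposables are the
elements s themselves, with T_t ∘ T_s ≅ T_{ts}.

In both cases multiplicative forms give ranks, ranks give the Krull-Schmidt property
(`SeparatingChars.krullSchmidt`), and this makes the classes of the T_s a ℤ-basis of the
decategorification, so that comparing products of basis elements suffices
(`exists_decatAlgebra_ringEquiv`). -/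

/-- An additive category in which every object is a finite direct sum of members of the family `T`,
with multiplicities that are determined by the object. -/
structure KrullSchmidt (A : Type u) [Category.{v} A] [Preadditive A] [HasZeroObject A]
    [HasBinaryBiproducts A] (S : Type w) where
  T : S → A
  mult : IsoClass A →+ (S →₀ ℕ)
  mult_T : ∀ s, mult (IsoClass.of (T s)) = Finsupp.single s 1
  exists_summand : ∀ P : A, ¬ IsZero P → ∃ (s : S) (Q : A), Nonempty (P ≅ T s ⊞ Q)

namespace IsoClass

variable {A : Type u} [Category.{v} A]

theorem exact {X Y : A} (h : of X = of Y) : Nonempty (X ≅ Y) :=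
  (Quotient.exact h : (isIsomorphicSetoid A) X Y)

theorem of_biprod [Preadditive A] [HasBinaryBiproducts A] (X Y : A) :
    of (X ⊞ Y) = of X + of Y := rfl

theorem of_eq_zero [HasZeroObject A] {X : A} (h : IsZero X) : of X = 0 :=
  sound (h.iso (isZero_zero A))

end IsoClass

namespace KrullSchmidt

variable {A : Type u} [Category.{v} A] [Preadditive A] [HasZeroObject A] [HasBinaryBiproducts A]
  {S : Type w} (ks : KrullSchmidt A S)

theorem not_isZero_T (s : S) : ¬ IsZero (ks.T s) := by
  intro h
  have := ks.mult_T s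
  rw [IsoClass.of_eq_zero h, map_zero] at this
  exact one_ne_zero (Finsupp.single_eq_zero.1 this.symm)

theorem isZero_of_mult_eq_zero {P : A} (h : ks.mult (IsoClass.of P) = 0) : IsZero P := by
  by_contra hP
  obtain ⟨s, Q, ⟨e⟩⟩ := ks.exists_summand P hP
  rw [IsoClass.sound e, IsoClass.of_biprod, map_add, ks.mult_T] at h
  have := DFunLike.congr_fun h s
  simp at this

/-- Splitting off one T s lowers the total multiplicity by one, so induction on this number
decomposes every object. The formula also shows that the multiplicities determine the isomorphism
class. -/
theorem of_eq_sum (P : A) : IsoClass.of P =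
    (ks.mult (IsoClass.of P)).sum fun s m => m • IsoClass.of (ks.T s) := by
  induction hm : (ks.mult (IsoClass.of P)).degree using Nat.strong_induction_on generalizing P with
  | _ m ih =>
    by_cases hP : IsZero P
    · rw [IsoClass.of_eq_zero hP, map_zero, Finsupp.sum_zero_index]
    · obtain ⟨s, Q, ⟨e⟩⟩ := ks.exists_summand P hP
      have h : ks.mult (IsoClass.of P) = Finsupp.single s 1 + ks.mult (IsoClass.of Q) := by
        rw [IsoClass.sound e, IsoClass.of_biprod, map_add, ks.mult_T]
      have hlt : (ks.mult (IsoClass.of Q)).degree < m := by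
        rw [← hm, h, map_add, Finsupp.degree_single]; omega
      rw [h, Finsupp.sum_add_index' (h := fun s m => m • IsoClass.of (ks.T s))
          (fun _ => zero_smul _ _) (fun _ _ _ => add_smul _ _ _),
        Finsupp.sum_single_index (h := fun s m => m • IsoClass.of (ks.T s)) (zero_smul _ _), one_smul, ← ih _ hlt Q rfl, IsoClass.sound e,
        IsoClass.of_biprod]

theorem mult_injective {P Q : A} (h : ks.mult (IsoClass.of P) = ks.mult (IsoClass.of Q)) :
    Nonempty (P ≅ Q) := by
  apply IsoClass.exact
  rw [ks.of_eq_sum P, ks.of_eq_sum Q, h]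

/-- A nonzero object splits off some T s, and if it is indecomposable the complement must vanish.
Conversely T s has total multiplicity 1, so in any decomposition one of the two summands has
multiplicity 0 and is therefore zero. -/
theorem indecomposable_iff (P : A) : Indecomposable P ↔ ∃ s, Nonempty (P ≅ ks.T s) := by
  constructor
  · rintro ⟨h0, h⟩
    obtain ⟨s, Q, ⟨e⟩⟩ := ks.exists_summand P h0
    refine ⟨s, ⟨?_⟩⟩
    have hQ : IsZero Q := (h _ _ e).resolve_left (ks.not_isZero_T s)
    exact e ≪≫ (isoBiprodZero hQ).symm
  · rintro ⟨s, ⟨e⟩⟩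
    refine ⟨fun h => ks.not_isZero_T s (h.of_iso e.symm), fun Y Z f => ?_⟩
    have h : Finsupp.single s 1 = ks.mult (IsoClass.of Y) + ks.mult (IsoClass.of Z) := by
      rw [← map_add, ← IsoClass.of_biprod, ← IsoClass.sound f, IsoClass.sound e, ks.mult_T]
    have hd := congrArg Finsupp.degree h
    rw [map_add, Finsupp.degree_single] at hd
    rcases Nat.eq_zero_or_pos (ks.mult (IsoClass.of Y)).degree with h' | h'
    · exact Or.inl (ks.isZero_of_mult_eq_zero ((Finsupp.degree_eq_zero_iff _).1 h'))
    · exact Or.inr (ks.isZero_of_mult_eq_zero ((Finsupp.degree_eq_zero_iff _).1 (by omega)))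

/-- The additive map from the split Grothendieck group with given values on the classes of the
indecomposable objects. -/
noncomputable def lift {G : Type w'} [AddCommGroup G] (b : S → G) : SplitK₀ A →+ G :=
  Algebra.GrothendieckAddGroup.lift
    ((Finsupp.liftAddHom fun s => multiplesHom G (b s)).comp ks.mult)

theorem lift_T {G : Type w'} [AddCommGroup G] (b : S → G) (s : S) :
    ks.lift b (SplitK₀.cls (ks.T s)) = b s := by
  refine (SplitK₀.lift_cls _ _).trans ?_
  rw [AddMonoidHom.comp_apply, ks.mult_T]
  simp

theorem hom_ext {G : Type w'} [AddCommGroup G] {φ ψ : SplitK₀ A →+ G}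
    (h : ∀ s, φ (SplitK₀.cls (ks.T s)) = ψ (SplitK₀.cls (ks.T s))) : φ = ψ := by
  refine SplitK₀.hom_ext fun P => ?_
  let i : IsoClass A →+ SplitK₀ A := Algebra.GrothendieckAddGroup.of
  change φ (i (IsoClass.of P)) = ψ (i (IsoClass.of P))
  rw [ks.of_eq_sum P]
  simp only [Finsupp.sum, map_sum, map_nsmul]
  exact Finset.sum_congr rfl fun s _ => congrArg _ (h s)

end KrullSchmidt

section Decategorification

variable {C : Type u} [Bicategory.{w, v} C] [PreadditiveBicategory C]
  [∀ a b : C, HasZeroObject (a ⟶ b)] [∀ a b : C, HasBinaryBiproducts (a ⟶ b)]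
  {S : C → C → Type w'} (ks : ∀ x y : C, KrullSchmidt (x ⟶ y) (S x y))

theorem DecatAlgebra.hom_ext {G : Type*} [AddCommGroup G] {φ ψ : DecatAlgebra C →+ G}
    (h : ∀ (x y : C) (s : S x y), φ (DecatAlgebra.cls ((ks x y).T s)) =
      ψ (DecatAlgebra.cls ((ks x y).T s))) : φ = ψ := by
  refine CategoryAlgebra.hom_ext fun x y f => ?_
  have := (ks x.of y.of).hom_ext (φ := φ.comp (CategoryAlgebra.of x y))
    (ψ := ψ.comp (CategoryAlgebra.of x y)) fun s => h _ _ s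
  exact DFunLike.congr_fun this f

theorem DecatAlgebra.cls_eq {x y : C} {F G : x ⟶ y} (e : F ≅ G) :
    DecatAlgebra.cls F = DecatAlgebra.cls G :=
  congrArg (CategoryAlgebra.of (⟨x⟩ : Decat C) ⟨y⟩) (SplitK₀.cls_eq e)

theorem DecatAlgebra.cls_mul_cls {x y z : C} (F : x ⟶ y) (G : y ⟶ z) :
    DecatAlgebra.cls G * DecatAlgebra.cls F = DecatAlgebra.cls (F ≫ G) :=
  (CategoryAlgebra.of_mul_of _ _).trans
    (congrArg (CategoryAlgebra.of (⟨x⟩ : Decat C) ⟨z⟩) (SplitK₀.comp_cls F G))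

theorem DecatAlgebra.cls_mul_cls_of_ne {x y y' z : C} (h : y ≠ y') (F : x ⟶ y) (G : y' ⟶ z) :
    DecatAlgebra.cls G * DecatAlgebra.cls F = 0 :=
  CategoryAlgebra.of_mul_of_ne _ _ fun e => h (congrArg Decat.of e)

/-- If the morphism categories of `C` have the Krull-Schmidt property, then the decategorification
of `C` is isomorphic to a ring with a basis which multiplies like the indecomposable
1-morphisms. -/
theorem exists_decatAlgebra_ringEquiv {R : Type*} [NonUnitalRing R] [inst : Module ℤ R]
    (b : Module.Basis (Σ p : C × C, S p.1 p.2) ℤ R)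
    (hcomp : ∀ (x y z : C) (s : S x y) (t : S y z), ∃ r : S x z,
      Nonempty ((ks x y).T s ≫ (ks y z).T t ≅ (ks x z).T r) ∧
        b ⟨(y, z), t⟩ * b ⟨(x, y), s⟩ = b ⟨(x, z), r⟩)
    (hne : ∀ (x y y' z : C) (s : S x y) (t : S y' z), y ≠ y' →
      b ⟨(y', z), t⟩ * b ⟨(x, y), s⟩ = 0) :
    ∃ φ : DecatAlgebra C ≃+* R,
      (∀ (x y : C) (s : S x y), φ (DecatAlgebra.cls ((ks x y).T s)) = b ⟨(x, y), s⟩) ∧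
        φ '' indecomposableClasses C = Set.range b := by
  -- There is only one ℤ-module structure on an abelian group; passing to the canonical one lets
  -- additive maps be treated as ℤ-linear.
  obtain rfl : inst = AddCommGroup.toIntModule R := Subsingleton.elim _ _
  let f : DecatAlgebra C →+ R :=
    CategoryAlgebra.lift fun x y => (ks x.of y.of).lift fun s => b ⟨(x.of, y.of), s⟩
  let g : R →+ DecatAlgebra C :=
    (b.constr ℤ fun p => DecatAlgebra.cls ((ks p.1.1 p.1.2).T p.2)).toAddMonoidHom
  have hf : ∀ (x y : C) (s : S x y), f (DecatAlgebra.cls ((ks x y).T s)) = b ⟨(x, y), s⟩ :=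
    fun x y s => (CategoryAlgebra.lift_of _ _).trans ((ks x y).lift_T _ s)
  have hg : ∀ (x y : C) (s : S x y), g (b ⟨(x, y), s⟩) = DecatAlgebra.cls ((ks x y).T s) :=
    fun x y s => b.constr_basis ℤ _ _
  have hgf : ∀ a, g (f a) = a := by
    have : g.comp f = AddMonoidHom.id _ := DecatAlgebra.hom_ext ks fun x y s => by
      rw [AddMonoidHom.comp_apply, hf, hg, AddMonoidHom.id_apply]
    exact DFunLike.congr_fun this
  have hfg : ∀ r, f (g r) = r := by
    have : (f.comp g).toIntLinearMap = LinearMap.id := b.ext fun ⟨⟨x, y⟩, s⟩ => by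
      change f (g _) = _
      rw [hg, hf]; rfl
    exact DFunLike.congr_fun this
  have hmul : ∀ a a', f (a * a') = f a * f a' := by
    -- Both sides are biadditive, so it suffices to compare them on pairs of indecomposables.
    -- Composable pairs are covered by `hcomp`, and for the others both products vanish.
    have : ((AddMonoidHom.compr₂ (AddMonoidHom.mul : DecatAlgebra C →+ _)) f) =
        (AddMonoidHom.compl₂ ((AddMonoidHom.mul (R := R)).comp f) f) := by
      refine DecatAlgebra.hom_ext ks fun y' z t => ?_
      refine DecatAlgebra.hom_ext ks fun x y s => ?_
      change f (_ * _) = f _ * f _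
      rw [hf, hf]
      by_cases h : y = y'
      · subst h
        obtain ⟨r, ⟨e⟩, hr⟩ := hcomp x y z s t
        rw [DecatAlgebra.cls_mul_cls, DecatAlgebra.cls_eq e, hf, hr]
      · rw [DecatAlgebra.cls_mul_cls_of_ne h, hne _ _ _ _ _ _ h, map_zero]
    intro a a'
    exact DFunLike.congr_fun (DFunLike.congr_fun this a) a'
  refine ⟨{ f with invFun := g, left_inv := hgf, right_inv := hfg, map_mul' := hmul }, hf, ?_⟩
  ext r
  constructor
  · rintro ⟨_, ⟨x, y, F, hF, rfl⟩, rfl⟩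
    obtain ⟨s, ⟨e⟩⟩ := ((ks x y).indecomposable_iff F).1 hF
    refine ⟨⟨(x, y), s⟩, ?_⟩
    rw [DecatAlgebra.cls_eq e]
    exact (hf x y s).symm
  · rintro ⟨⟨⟨x, y⟩, s⟩, rfl⟩
    exact ⟨_, ⟨x, y, (ks x y).T s, ((ks x y).indecomposable_iff _).2 ⟨s, ⟨Iso.refl _⟩⟩, rfl⟩,
      hf x y s⟩

end Decategorification

end FiatCat

/-! ### The Möbius basis of the semigroup algebra and its multiplication. -/

namespace FiatCat

open PartitionMonoid

open Classical in
-- This is the defining recursion of the Möbius function, with the interval written as a filter so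
-- that it can be matched with a sum over F*_n.
theorem sum_partitionMoebius {n : ℕ} [Fintype (Setoid (Fin n))] (X Y : Setoid (Fin n)) :
    ∑ Z with X ≤ Z ∧ Z ≤ Y, partitionMoebius X Z = if X = Y then 1 else 0 := by
  let _ : LocallyFiniteOrder (Setoid (Fin n)) := Fintype.toLocallyFiniteOrder
  rw [← IncidenceAlgebra.sum_Icc_mu_right]
  refine Finset.sum_congr (by ext; simp) fun Z _ => ?_
  unfold partitionMoebius
  congr!

namespace FStar

variable {n : ℕ}

/-- A permutation as an element of `F*_n`. -/
def perm (σ : Equiv.Perm (Fin n)) : FStar n := mk (σ := σ) (ofPerm σ) le_rfl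

theorem perm_mul_inv (σ : Equiv.Perm (Fin n)) : perm σ * perm σ⁻¹ = 1 :=
  val_injective (ofPerm_mul_inv σ)

theorem perm_inv_mul (σ : Equiv.Perm (Fin n)) : perm σ⁻¹ * perm σ = 1 :=
  val_injective (ofPerm_inv_mul σ)

/-- The partition of `{1', …, n'}` induced by an element of `F*_n`. -/
def coker (s : FStar n) : Setoid (Fin n) := Setoid.comap Sum.inr s.val

theorem exists_rel_inl (s : FStar n) (a : Fin n ⊕ Fin n) : ∃ x, s.val a (Sum.inl x) := by
  obtain ⟨σ, hσ⟩ := s.exists_ofPerm_le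
  rcases a with x | y
  · exact ⟨x, s.val.refl' _⟩
  · obtain ⟨x, hx⟩ := (isPropagating_of_le hσ).2 y
    exact ⟨x, s.val.symm' hx⟩

/-- Every part of s meets the unprimed points, so modulo s any relation can be moved to the unprimed
points. Above s, the order is thus detected by kernels. -/
theorem val_le_of_ker_le {s u v : FStar n} (hu : s.val ≤ u.val) (hv : s.val ≤ v.val)
    (h : ker u ≤ ker v) : u.val ≤ v.val := by
  intro a b hab
  obtain ⟨x, hx⟩ := s.exists_rel_inl a
  obtain ⟨y, hy⟩ := s.exists_rel_inl b
  have hxy : ker u x y := u.val.trans' (u.val.symm' (hu hx)) (u.val.trans' hab (hu hy))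
  exact v.val.trans' (hv hx) (v.val.trans' (h hxy) (v.val.symm' (hv hy)))

/-- Above a fixed s an element is determined by its kernel. For s = 1 this says that idempotents are
determined by their kernels. -/
theorem eq_of_ker_eq {s u v : FStar n} (hu : s.val ≤ u.val) (hv : s.val ≤ v.val)
    (h : ker u = ker v) : u = v :=
  val_injective (le_antisymm (val_le_of_ker_le hu hv h.le) (val_le_of_ker_le hv hu h.ge))

theorem ker_mono {s t : FStar n} (h : s.val ≤ t.val) : ker s ≤ ker t := fun _ _ k => h k

/-- The finest element of `F*_n` that is coarser than `s` and whose kernel is coarser than `K`. -/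
noncomputable def coarsen (s : FStar n) (K : Setoid (Fin n)) : FStar n :=
  mk (σ := s.exists_ofPerm_le.choose) (s.val ⊔ Setoid.map (r := K) Sum.inl)
    (s.exists_ofPerm_le.choose_spec.trans le_sup_left)

theorem val_le_coarsen (s : FStar n) (K : Setoid (Fin n)) : s.val ≤ (coarsen s K).val :=
  (le_sup_left : s.val ≤ s.val ⊔ Setoid.map (r := K) Sum.inl)

/-- Consequently every partition coarser than ker s is the kernel of some element coarser than s,
which is the surjectivity needed to identify intervals of F*_n with intervals of partitions. -/
theorem ker_coarsen (s : FStar n) (K : Setoid (Fin n)) : ker (coarsen s K) = ker s ⊔ K :=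
  setoid_comap_sup_map _ _ _

theorem ker_one : ker (1 : FStar n) = ⊥ := by
  ext x y
  exact Iff.rfl

theorem exists_one_le_ker_eq (K : Setoid (Fin n)) : ∃ f : FStar n, 1 ≤ f.val ∧ ker f = K :=
  ⟨coarsen 1 K, val_le_coarsen 1 K, by rw [ker_coarsen, ker_one, bot_sup_eq]⟩

/-- Each x is in the same part of f as x', so f induces the same partition on both copies. -/
theorem coker_eq_ker {f : FStar n} (h : 1 ≤ f.val) : coker f = ker f := by
  have key : ∀ x, f.val (Sum.inl x) (Sum.inr x) := fun x => h (ofPerm_rel 1 x)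
  ext x y
  constructor
  · intro hxy
    exact f.val.trans' (key x) (f.val.trans' hxy (f.val.symm' (key y)))
  · intro hxy
    exact f.val.trans' (f.val.symm' (key x)) (f.val.trans' hxy (key y))

theorem ker_perm_mul (σ : Equiv.Perm (Fin n)) (s : FStar n) : ker (perm σ * s) = ker s := by
  have : (perm σ * s).val = Setoid.comap (Sum.map id σ.symm) s.val := ofPerm_mul_eq σ s.val
  rw [ker, this]
  rfl

theorem coker_mul_perm (σ : Equiv.Perm (Fin n)) (s : FStar n) :
    coker (s * perm σ) = coker s := by
  have : (s * perm σ).val = Setoid.comap (Sum.map σ id) s.val := mul_ofPerm_eq σ s.val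
  rw [coker, this]
  rfl

/-- Together with its mirror image `exists_eq_mul_perm`, this reduces statements about F*_n to
idempotents: a permutation on the left does not affect the kernel, and one on the right does not
affect the cokernel. -/
theorem exists_eq_perm_mul {σ : Equiv.Perm (Fin n)} {s : FStar n} (h : ofPerm σ ≤ s.val) :
    ∃ f : FStar n, 1 ≤ f.val ∧ s = perm σ * f := by
  refine ⟨perm σ⁻¹ * s, ?_, ?_⟩
  · rw [← ofPerm_inv_mul σ]
    exact mul_mono le_rfl h
  · rw [← mul_assoc, perm_mul_inv, one_mul]

theorem exists_eq_mul_perm {σ : Equiv.Perm (Fin n)} {s : FStar n} (h : ofPerm σ ≤ s.val) :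
    ∃ f : FStar n, 1 ≤ f.val ∧ s = f * perm σ := by
  refine ⟨s * perm σ⁻¹, ?_, ?_⟩
  · rw [← ofPerm_mul_inv σ]
    exact mul_mono h le_rfl
  · rw [mul_assoc, perm_inv_mul, mul_one]

theorem perm_mul_val_le_iff (σ : Equiv.Perm (Fin n)) (s t : FStar n) :
    (perm σ * s).val ≤ t.val ↔ s.val ≤ (perm σ⁻¹ * t).val := by
  constructor <;> intro h
  · have := mul_mono (le_refl (ofPerm σ⁻¹)) h
    rwa [val_mul, ← mul_assoc, perm, mk, ofPerm_inv_mul, one_mul] at this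
  · have := mul_mono (le_refl (ofPerm σ)) h
    rwa [val_mul, ← mul_assoc, perm, mk, ofPerm_mul_inv, one_mul] at this

theorem mul_perm_val_le_iff (σ : Equiv.Perm (Fin n)) (s t : FStar n) :
    (s * perm σ).val ≤ t.val ↔ s.val ≤ (t * perm σ⁻¹).val := by
  constructor <;> intro h
  · have := mul_mono h (le_refl (ofPerm σ⁻¹))
    rwa [val_mul, mul_assoc, perm, mk, ofPerm_mul_inv, mul_one] at this
  · have := mul_mono h (le_refl (ofPerm σ))
    rwa [val_mul, mul_assoc, perm, mk, ofPerm_inv_mul, mul_one] at this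

section Character

variable (R : Type*) [CommRing R]

open Classical in
/-- The linear form that is `1` on the elements coarser than `t` and `0` on the others. -/
noncomputable def char (t : FStar n) : MonoidAlgebra R (FStar n) →+ R :=
  (Finsupp.liftAddHom fun s : FStar n => if s.val ≤ t.val then AddMonoidHom.id R else 0).comp
    MonoidAlgebra.coeffAddEquiv.toAddMonoidHom

open Classical in
theorem char_single (t s : FStar n) (r : R) :
    char R t (MonoidAlgebra.single s r) = if s.val ≤ t.val then r else 0 := by
  refine (Finsupp.liftAddHom_apply_single _ _ _).trans ?_
  split_ifs <;> rfl

variable {R}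

/-- The matrix of the forms `char R t` on the elements of F*_n is unitriangular. A finest element s
of the support of x, that is, a maximal one in the natural order, has no other element of the
support below it as a partition, so `char R s x` is just the coefficient of x at s. -/
theorem eq_zero_of_char {x : MonoidAlgebra R (FStar n)} (h : ∀ t, char R t x = 0) : x = 0 := by
  classical
  by_contra hx
  have hne : x.coeff.support.Nonempty := by
    rw [Finsupp.support_nonempty_iff]
    simpa using hx
  obtain ⟨s, hs⟩ := x.coeff.support.exists_maximal hne
  refine Finsupp.mem_support_iff.1 hs.1 ?_
  rw [← h s]
  change _ = x.coeff.sum fun u r => (if u.val ≤ s.val then AddMonoidHom.id R else 0) r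
  rw [Finsupp.sum, Finset.sum_eq_single s]
  · rw [if_pos le_rfl]; rfl
  · intro u hu hus
    rw [if_neg]; · rfl
    intro hle
    exact hus (le_antisymm (hs.2 hu ((le_iff s u).2 hle)) ((le_iff s u).2 hle))
  · intro hn; exact absurd hs.1 hn

theorem char_injective {x y : MonoidAlgebra R (FStar n)} (h : ∀ t, char R t x = char R t y) :
    x = y :=
  sub_eq_zero.1 (eq_zero_of_char fun t => by rw [map_sub, h, sub_self])

end Character

open Classical in
-- If t is coarser than s, the map u ↦ ker u is a bijection from the elements between s and t to the
-- partitions between ker s and ker t, so the value is a Möbius sum over an interval. Otherwise no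
-- element coarser than s is finer than t and the sum is empty.
theorem char_moebius (s t : FStar n) : char ℤ t (moebius s) = if s = t then 1 else 0 := by
  let _ : Fintype (FStar n) := Fintype.ofFinite _
  let _ : Fintype (Setoid (Fin n)) := Fintype.ofFinite _
  rw [moebius, map_sum]
  simp only [char_single]
  rw [← Finset.sum_filter, Finset.filter_filter]
  by_cases hst : s.val ≤ t.val
  · have h : (s = t) = (ker s = ker t) :=
      propext ⟨fun h => h ▸ rfl, fun h => eq_of_ker_eq le_rfl hst h⟩
    simp only [h]
    rw [← sum_partitionMoebius]
    refine Finset.sum_bij (fun u _ => ker u) ?_ ?_ ?_ fun _ _ => rfl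
    · intro u hu
      simp only [Finset.mem_filter_univ, le_iff] at hu ⊢
      exact ⟨ker_mono hu.1, ker_mono hu.2⟩
    · intro u hu v hv huv
      simp only [Finset.mem_filter_univ, le_iff] at hu hv
      exact eq_of_ker_eq hu.1 hv.1 huv
    · intro K hK
      simp only [Finset.mem_filter_univ] at hK
      have hker : ker (coarsen s K) = K := by rw [ker_coarsen, sup_eq_right.2 hK.1]
      refine ⟨coarsen s K, ?_, hker⟩
      simp only [Finset.mem_filter_univ, le_iff]
      exact ⟨val_le_coarsen s K, val_le_of_ker_le (val_le_coarsen s K) hst (hker.le.trans hK.2)⟩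
  · rw [if_neg (by rintro rfl; exact hst le_rfl)]
    apply Finset.sum_eq_zero
    intro u hu
    simp only [Finset.mem_filter_univ, le_iff] at hu
    exact absurd (hu.1.trans hu.2) hst

/-- The elements `moebius s` form a basis of the semigroup algebra. -/
theorem exists_basis_moebius :
    ∃ b : Module.Basis (FStar n) ℤ (MonoidAlgebra ℤ (FStar n)), ∀ s, b s = moebius s := by
  classical
  let _ : Fintype (FStar n) := Fintype.ofFinite _
  -- All forms together map the semigroup algebra isomorphically to the functions on F*_n and the
  -- Möbius elements to the standard basis. This works over ℤ because the triangular matrix has ones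
  -- on the diagonal.
  let f : MonoidAlgebra ℤ (FStar n) →ₗ[ℤ] (FStar n → ℤ) :=
    (LinearMap.pi fun t => (char ℤ t).toIntLinearMap)
  have hf : ∀ s, f (moebius s) = Pi.single s 1 := fun s => by
    ext t
    refine (char_moebius s t).trans ?_
    rw [Pi.single_apply]
    simp only [eq_comm]
  have hinj : Function.Injective f := fun x y h => char_injective fun t => congrFun h t
  have hsurj : Function.Surjective f := by
    intro g
    refine ⟨∑ s, g s • moebius s, ?_⟩
    rw [map_sum]
    simp only [map_smul, hf]
    ext t
    simp [Finset.sum_apply, Pi.single_apply]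
  let e := LinearEquiv.ofBijective f ⟨hinj, hsurj⟩
  refine ⟨(Pi.basisFun ℤ (FStar n)).map e.symm, fun s => ?_⟩
  rw [Module.Basis.map_apply, LinearEquiv.symm_apply_eq, Pi.basisFun_apply]
  exact (hf s).symm

section Product

variable (R : Type*) [CommRing R]

/-- The image of `moebius s` in the semigroup algebra over `R`. -/
noncomputable def mob (s : FStar n) : MonoidAlgebra R (FStar n) :=
  MonoidAlgebra.mapRingHom (FStar n) (Int.castRingHom R) (moebius s)

/-- Transfers the duality from ℤ, where the decategorification lives, to the field over which the
2-morphisms are linearized. -/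
theorem char_mapRingHom (t : FStar n) (x : MonoidAlgebra ℤ (FStar n)) :
    char R t (MonoidAlgebra.mapRingHom (FStar n) (Int.castRingHom R) x) = (char ℤ t x : R) := by
  classical
  induction x using MonoidAlgebra.induction_linear with
  | zero => simp
  | add x y hx hy => rw [map_add, map_add, map_add, hx, hy, Int.cast_add]
  | single s r =>
    rw [MonoidAlgebra.mapRingHom_single, char_single, char_single]
    split_ifs <;> simp

open Classical in
theorem char_mob (s t : FStar n) : char R t (mob R s) = if s = t then 1 else 0 := by
  rw [mob, char_mapRingHom, char_moebius]
  split_ifs <;> simp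

theorem mob_int (s : FStar n) : mob ℤ s = moebius s :=
  char_injective fun t => by classical rw [char_mob, char_moebius]

variable {R}

variable (R) in
/-- The elements of the semigroup algebra supported on the elements coarser than `ρ`. -/
noncomputable def above (ρ : PartitionMonoid n) : AddSubmonoid (MonoidAlgebra R (FStar n)) :=
  AddSubmonoid.closure {x | ∃ s : FStar n, ρ ≤ s.val ∧ ∃ r : R, x = MonoidAlgebra.single s r}

/-- The Möbius element of s involves only elements coarser than s. This places it in the range where
characters are multiplicative, and in a space of 2-morphisms of B_n. -/
theorem mob_mem_above {ρ : PartitionMonoid n} {s : FStar n} (h : ρ ≤ s.val) :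
    mob R s ∈ above R ρ := by
  rw [mob, moebius, map_sum]
  refine AddSubmonoid.sum_mem _ fun t ht => AddSubmonoid.subset_closure ?_
  simp only [Finset.mem_filter_univ, le_iff] at ht
  exact ⟨t, h.trans ht, _, MonoidAlgebra.mapRingHom_single _ _ _⟩

/-- Above the identity the product is the join, and a join is finer than t if and only if both of
its factors are. -/
theorem char_mul {x y : MonoidAlgebra R (FStar n)} (hx : x ∈ above R 1) (hy : y ∈ above R 1)
    (t : FStar n) : char R t (x * y) = char R t x * char R t y := by
  classical
  induction hx using AddSubmonoid.closure_induction with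
  | zero => simp
  | add x x' _ _ h h' => rw [add_mul, map_add, map_add, h, h', add_mul]
  | mem x hx =>
    obtain ⟨s, hs, r, rfl⟩ := hx
    induction hy using AddSubmonoid.closure_induction with
    | zero => simp
    | add y y' _ _ h h' => rw [mul_add, map_add, map_add, h, h', mul_add]
    | mem y hy =>
      obtain ⟨u, hu, r', rfl⟩ := hy
      rw [MonoidAlgebra.single_mul_single, char_single, char_single, char_single, val_mul,
        mul_eq_sup hs hu, sup_le_iff]
      split_ifs <;> simp_all

/-- Multiplication by a permutation is an automorphism of the refinement order, so it permutes the
forms `char R t` and hence also the dual basis. -/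
theorem single_perm_mul_mob (σ : Equiv.Perm (Fin n)) (s : FStar n) :
    MonoidAlgebra.single (perm σ) 1 * mob R s = mob R (perm σ * s) := by
  classical
  have key : ∀ (t : FStar n) (x : MonoidAlgebra R (FStar n)),
      char R t (MonoidAlgebra.single (perm σ) 1 * x) = char R (perm σ⁻¹ * t) x := by
    intro t x
    induction x using MonoidAlgebra.induction_linear with
    | zero => simp
    | add x y hx hy => rw [mul_add, map_add, map_add, hx, hy]
    | single u r =>
      rw [MonoidAlgebra.single_mul_single, char_single, char_single, perm_mul_val_le_iff, one_mul]
  refine char_injective fun t => ?_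
  rw [key, char_mob, char_mob]
  refine if_congr ⟨?_, ?_⟩ rfl rfl
  · rintro rfl; rw [← mul_assoc, perm_mul_inv, one_mul]
  · rintro rfl; rw [← mul_assoc, perm_inv_mul, one_mul]

theorem mob_mul_single_perm (σ : Equiv.Perm (Fin n)) (s : FStar n) :
    mob R s * MonoidAlgebra.single (perm σ) 1 = mob R (s * perm σ) := by
  classical
  have key : ∀ (t : FStar n) (x : MonoidAlgebra R (FStar n)),
      char R t (x * MonoidAlgebra.single (perm σ) 1) = char R (t * perm σ⁻¹) x := by
    intro t x
    induction x using MonoidAlgebra.induction_linear with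
    | zero => simp
    | add x y hx hy => rw [add_mul, map_add, map_add, hx, hy]
    | single u r =>
      rw [MonoidAlgebra.single_mul_single, char_single, char_single, mul_perm_val_le_iff, mul_one]
  refine char_injective fun t => ?_
  rw [key, char_mob, char_mob]
  refine if_congr ⟨?_, ?_⟩ rfl rfl
  · rintro rfl; rw [mul_assoc, perm_inv_mul, mul_one]
  · rintro rfl; rw [mul_assoc, perm_mul_inv, mul_one]

open Classical in
-- The characters are multiplicative above the identity and take the values of a Kronecker delta on
-- these elements, which are therefore orthogonal idempotents.
theorem mob_mul_mob_of_one_le {f g : FStar n} (hf : 1 ≤ f.val) (hg : 1 ≤ g.val) :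
    mob R f * mob R g = if ker f = ker g then mob R f else 0 := by
  refine char_injective fun t => ?_
  rw [char_mul (mob_mem_above hf) (mob_mem_above hg), char_mob, char_mob]
  have h : ker f = ker g ↔ f = g := ⟨fun h => eq_of_ker_eq (s := 1) hf hg h, fun h => h ▸ rfl⟩
  simp only [h]
  by_cases hfg : f = g
  · subst hfg
    rw [if_pos rfl, char_mob]
    split_ifs <;> simp
  · rw [if_neg hfg, map_zero]
    by_cases hft : f = t
    · rw [← hft]
      rw [if_neg (Ne.symm hfg), mul_zero]
    · rw [if_neg hft, zero_mul]

open Classical in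
/-- The elements `mob s` multiply like the morphisms of a groupoid. -/
theorem mob_mul_mob (s t : FStar n) :
    mob R s * mob R t = if ker s = coker t then mob R (s * t) else 0 := by
  obtain ⟨σ, hσ⟩ := s.exists_ofPerm_le
  obtain ⟨τ, hτ⟩ := t.exists_ofPerm_le
  -- With s = σ f and t = g τ the two idempotents f and g meet in the middle of the product. Their
  -- kernels are ker s and coker t, so the orthogonality of idempotents decides whether the product
  -- vanishes.
  obtain ⟨f, hf, rfl⟩ := exists_eq_perm_mul hσ
  obtain ⟨g, hg, rfl⟩ := exists_eq_mul_perm hτ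
  rw [ker_perm_mul, coker_mul_perm, coker_eq_ker hg, ← single_perm_mul_mob, ← mob_mul_single_perm,
    mul_assoc, ← mul_assoc (mob R f), mob_mul_mob_of_one_le hf hg]
  by_cases h : ker f = ker g
  · obtain rfl : f = g := eq_of_ker_eq (s := 1) hf hg h
    have hff : f * f = f := val_injective (idem_of_one_le hf)
    rw [if_pos rfl, if_pos rfl, mob_mul_single_perm, single_perm_mul_mob, mul_assoc,
      ← mul_assoc f, hff]
  · rw [if_neg h, if_neg h, zero_mul, mul_zero]

end Product

end FStar

end FiatCat

/-! ### Ranks and the Krull-Schmidt property from multiplicative linear forms. -/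

namespace FiatCat

open CategoryTheory Limits Idempotents Matrix ZeroObject

universe w v u w'

/-- A retract in an idempotent complete category is a direct summand. -/
theorem exists_iso_biprod_of_retract {A : Type u} [Category.{v} A] [Preadditive A]
    [HasBinaryBiproducts A] [IsIdempotentComplete A] {X P : A} (i : X ⟶ P) (r : P ⟶ X)
    (h : i ≫ r = 𝟙 X) : ∃ Q : A, Nonempty (P ≅ X ⊞ Q) := by
  have hir : (r ≫ i) ≫ (r ≫ i) = r ≫ i := by
    rw [Category.assoc, ← Category.assoc i, h, Category.id_comp]
  -- The complement of X is the summand of P cut out by the complementary idempotent 1 - r ≫ i.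
  obtain ⟨Q, j, q, h1, h2⟩ := IsIdempotentComplete.idempotents_split P (𝟙 P - r ≫ i)
    (idem_of_id_sub_idem _ hir)
  have hiq : i ≫ q = 0 := by
    calc i ≫ q = i ≫ (q ≫ j) ≫ q := by rw [Category.assoc, h1, Category.comp_id]
      _ = 0 := by
        rw [h2, Preadditive.sub_comp, Preadditive.comp_sub, Category.id_comp, Category.assoc,
          reassoc_of% h, sub_self]
  have hjr : j ≫ r = 0 := by
    calc j ≫ r = j ≫ (q ≫ j) ≫ r := by rw [Category.assoc, reassoc_of% h1]
      _ = 0 := by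
        rw [h2, Preadditive.sub_comp, Preadditive.comp_sub, Category.id_comp, Category.assoc,
          h, Category.comp_id, sub_self]
  refine ⟨Q, ⟨⟨biprod.lift r q, biprod.desc i j, ?_, ?_⟩⟩⟩
  · rw [biprod.lift_desc, h2, add_sub_cancel]
  · ext <;> simp [h, h1, hiq, hjr]

instance (C : Type u) [Category.{v} C] [Preadditive C] :
    HasBinaryBiproducts (Karoubi (Mat_ C)) :=
  hasBinaryBiproducts_of_finite_biproducts _

instance (C : Type u) [Category.{v} C] [Preadditive C] : HasZeroObject (Karoubi (Mat_ C)) :=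
  hasZeroObject_of_hasFiniteBiproducts _

/-- A family of additive maps from the groups of morphisms to a field, compatible with composition
(but not necessarily with identities). -/
structure MorphismChar (C : Type u) [Category.{v} C] [Preadditive C] (𝕜 : Type w) [Field 𝕜] where
  app : ∀ {X Y : C}, (X ⟶ Y) →+ 𝕜
  app_comp : ∀ {X Y Z : C} (f : X ⟶ Y) (g : Y ⟶ Z), app (f ≫ g) = app f * app g

namespace MorphismChar

open MatCat

variable {C : Type u} [Category.{v} C] [Preadditive C] {𝕜 : Type w} [Field 𝕜]
  (χ : MorphismChar C 𝕜)

/-- The values of a character on the entries of a matrix of morphisms. -/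
noncomputable def matrix {M N : Mat_ C} (f : M ⟶ N) : Matrix M.ι N.ι 𝕜 := fun i j => χ.app (ent f i j)

theorem matrix_comp {M N K : Mat_ C} (f : M ⟶ N) (g : N ⟶ K) :
    χ.matrix (f ≫ g) = χ.matrix f * χ.matrix g := by
  ext i j
  rw [matrix, ent_comp, map_sum, Matrix.mul_apply]
  exact Finset.sum_congr rfl fun k _ => χ.app_comp _ _

theorem matrix_add {M N : Mat_ C} (f g : M ⟶ N) :
    χ.matrix (f + g) = χ.matrix f + χ.matrix g := by
  ext i j
  exact map_add χ.app _ _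

/-- The image of the idempotent of an object under a character. -/
noncomputable def space (P : Karoubi (Mat_ C)) : Submodule 𝕜 (P.X.ι → 𝕜) :=
  LinearMap.eqLocus (χ.matrix P.p).vecMulLinear LinearMap.id

theorem mem_space (P : Karoubi (Mat_ C)) (x : P.X.ι → 𝕜) :
    x ∈ χ.space P ↔ x ᵥ* χ.matrix P.p = x := Iff.rfl

theorem vecMul_mem_space {P Q : Karoubi (Mat_ C)} (f : P ⟶ Q) (x : P.X.ι → 𝕜) :
    x ᵥ* χ.matrix f.f ∈ χ.space Q := by
  rw [mem_space, Matrix.vecMul_vecMul, ← matrix_comp, Karoubi.comp_p]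

/-- The linear map given by a morphism. -/
noncomputable def spaceMap {P Q : Karoubi (Mat_ C)} (f : P ⟶ Q) : χ.space P →ₗ[𝕜] χ.space Q :=
  (χ.matrix f.f).vecMulLinear.restrict fun x _ => χ.vecMul_mem_space f x

/-- The functor to vector spaces given by a character. -/
noncomputable def functor : Karoubi (Mat_ C) ⥤ ModuleCat.{w} 𝕜 where
  obj P := ModuleCat.of 𝕜 (χ.space P)
  map f := ModuleCat.ofHom (χ.spaceMap f)
  map_id P := by
    ext x : 2
    -- The identity of P in the idempotent completion is its idempotent, whose matrix fixes the
    -- vectors of `space P` by definition. This is why the character need not send identities to 1.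
    exact Subtype.ext x.2
  map_comp f g := by
    ext x : 2
    refine Subtype.ext ?_
    change _ ᵥ* χ.matrix (f.f ≫ g.f) = (_ ᵥ* _) ᵥ* _
    rw [matrix_comp, Matrix.vecMul_vecMul]

instance : χ.functor.Additive where
  map_add {P Q f g} := by
    ext x : 2
    refine Subtype.ext ?_
    change _ ᵥ* χ.matrix (f.f + g.f) = (_ ᵥ* _) + (_ ᵥ* _)
    rw [matrix_add, Matrix.vecMul_add]

/-- The rank of an object with respect to a character, as a map on isomorphism classes. -/
noncomputable def rank : IsoClass (Karoubi (Mat_ C)) →+ ℕ where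
  toFun := Quotient.lift (fun P => Module.finrank 𝕜 (χ.space P)) (by
    rintro P Q ⟨e⟩
    exact (χ.functor.mapIso e).toLinearEquiv.finrank_eq)
  map_zero' := by
    have : Subsingleton (χ.space (0 : Karoubi (Mat_ C))) :=
      ModuleCat.subsingleton_of_isZero (χ.functor.map_isZero (isZero_zero (Karoubi (Mat_ C))))
    exact Module.finrank_zero_of_subsingleton (R := 𝕜) (M := χ.space _)
  map_add' := by
    have := preservesBinaryBiproducts_of_preservesBiproducts χ.functor
    refine IsoClass.ind fun P => IsoClass.ind fun Q => ?_
    have e := (χ.functor.mapBiprod P Q ≪≫ ModuleCat.biprodIsoProd _ _).toLinearEquiv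
    exact e.finrank_eq.trans (Module.finrank_prod (R := 𝕜) (M := χ.space P) (M' := χ.space Q))

theorem rank_of (P : Karoubi (Mat_ C)) :
    χ.rank (IsoClass.of P) = Module.finrank 𝕜 (χ.space P) := rfl

/-- The idempotent is a 1 × 1 matrix and its character is 0 or 1, so the fixed space is zero or the
whole line. -/
theorem rank_of_unique {P : Karoubi (Mat_ C)} [Unique P.X.ι] {c : ℕ} (hc : c = 0 ∨ c = 1)
    (h : χ.app (ent P.p default default) = c) : χ.rank (IsoClass.of P) = c := by
  classical
  have hm : χ.matrix P.p = (c : 𝕜) • (1 : Matrix P.X.ι P.X.ι 𝕜) := by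
    ext i j
    obtain rfl := Unique.eq_default i
    obtain rfl := Unique.eq_default j
    simpa [matrix] using h
  rw [rank_of]
  rcases hc with rfl | rfl
  · have : χ.space P = ⊥ := by
      ext x
      rw [mem_space, hm]
      simp [eq_comm]
    rw [this, finrank_bot]
  · have : χ.space P = ⊤ := by
      ext x
      rw [mem_space, hm]
      simp
    rw [this, finrank_top, Module.finrank_fintype_fun_eq_card, Fintype.card_unique]

end MorphismChar

section

open MatCat

variable {C : Type u} [Category.{v} C] [Preadditive C]

/-- An idempotent of `C` as an object of the idempotent completion of the additive closure. -/
@[reducible] noncomputable def idemObj {X : C} (e : X ⟶ X) (he : e ≫ e = e) : Karoubi (Mat_ C) where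
  X := Mat_.mk Unit fun _ => X
  p := mat fun _ _ => e
  idem := mat_ext fun _ _ => by
    rw [ent_comp, Fintype.sum_unique]
    exact he

/-- The inclusion is e a followed by row i of p, and the projection is column j of p followed by b
e. Their composite contains the (i, j) entry of p ≫ p = p, and the hypothesis reduces it to e. -/
theorem exists_retract_idemObj {X : C} (e : X ⟶ X) (he : e ≫ e = e) (P : Karoubi (Mat_ C))
    (i j : P.X.ι) (a : X ⟶ P.X.X i) (b : P.X.X j ⟶ X) (h : e ≫ a ≫ ent P.p i j ≫ b ≫ e = e) :
    ∃ (f : idemObj e he ⟶ P) (g : P ⟶ idemObj e he), f ≫ g = 𝟙 _ := by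
  classical
  let f : idemObj e he ⟶ P := ⟨mat fun _ k => e ≫ a ≫ ent P.p i k, by
    apply mat_ext
    intro x k
    rw [ent_comp, Fintype.sum_unique, ent_comp]
    simp only [ent_mat, Category.assoc]
    rw [← Preadditive.comp_sum, ← Preadditive.comp_sum, ← ent_comp, P.idem,
      reassoc_of% he]⟩
  let g : P ⟶ idemObj e he := ⟨mat fun k _ => ent P.p k j ≫ b ≫ e, by
    apply mat_ext
    intro k x
    rw [ent_comp]
    simp only [ent_comp, Fintype.sum_unique, ent_mat, Category.assoc, he]
    simp only [← Category.assoc]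
    rw [← Preadditive.sum_comp, ← Preadditive.sum_comp, ← ent_comp, P.idem]⟩
  refine ⟨f, g, ?_⟩
  ext : 1
  apply mat_ext
  intro x y
  change ent (f.f ≫ g.f) x y = e
  rw [ent_comp]
  simp only [f, g, ent_mat, Category.assoc]
  rw [← Preadditive.comp_sum, ← Preadditive.comp_sum]
  simp only [← Category.assoc]
  rw [← Preadditive.sum_comp, ← Preadditive.sum_comp, ← ent_comp, P.idem]
  simpa only [Category.assoc] using h

variable {𝕜 : Type w} [Field 𝕜] {S : Type w'} [Finite S]

/-- Characters that detect the direct summands `(X s, E s)` of every object. -/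
structure SeparatingChars (χ : S → MorphismChar C 𝕜) (X : S → C) (E : ∀ s, X s ⟶ X s) :
    Prop where
  idem : ∀ s, E s ≫ E s = E s
  app_self : ∀ s, (χ s).app (E s) = 1
  app_of_ne : ∀ s t, s ≠ t → (χ s).app (E t) = 0
  eq_zero : ∀ (M : Mat_ C) (p : M ⟶ M), p ≫ p = p →
    (∀ s i j, (χ s).app (ent p i j) = 0) → p = 0
  exists_retract : ∀ (s : S) {Y Z : C} (f : Y ⟶ Z), (χ s).app f ≠ 0 →
    ∃ (a : X s ⟶ Y) (b : Z ⟶ X s), E s ≫ a ≫ f ≫ b ≫ E s = E s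

namespace SeparatingChars

variable {χ : S → MorphismChar C 𝕜} {X : S → C} {E : ∀ s, X s ⟶ X s}

theorem mult_eq_single {P : Karoubi (Mat_ C)} [Unique P.X.ι] {r : S}
    (h1 : (χ r).app (ent P.p default default) = 1)
    (h0 : ∀ s, s ≠ r → (χ s).app (ent P.p default default) = 0) :
    ((Finsupp.linearEquivFunOnFinite ℕ ℕ S).symm.toLinearMap.toAddMonoidHom.comp
      (AddMonoidHom.pi fun s => (χ s).rank)) (IsoClass.of P) = Finsupp.single r 1 := by
  classical
  ext s
  change (χ s).rank (IsoClass.of _) = _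
  rw [Finsupp.single_apply]
  by_cases h : r = s
  · subst h
    rw [if_pos rfl, (χ r).rank_of_unique (c := 1) (Or.inr rfl) (by simpa using h1)]
  · rw [if_neg h, (χ s).rank_of_unique (c := 0) (Or.inl rfl) (by simpa using h0 s (Ne.symm h))]

/-- The Krull-Schmidt property of the idempotent completion of an additive closure, given
sufficiently many characters. -/
noncomputable def krullSchmidt (h : SeparatingChars χ X E) :
    KrullSchmidt (Karoubi (Mat_ C)) S where
  T s := idemObj (E s) (h.idem s)
  mult := (Finsupp.linearEquivFunOnFinite ℕ ℕ S).symm.toLinearMap.toAddMonoidHom.comp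
    (AddMonoidHom.pi fun s => (χ s).rank)
  mult_T t := by
    let _ : Unique (idemObj (E t) (h.idem t)).X.ι := inferInstanceAs (Unique Unit)
    exact mult_eq_single (h.app_self t) fun s hs => h.app_of_ne s t hs
  exists_summand P hP := by
    -- If all characters vanished on the entries of the idempotent of P, this idempotent and hence P
    -- would be zero. An entry detected by χ s makes (X s, E s) a retract of P, and so a direct
    -- summand.
    have : ∃ s i j, (χ s).app (ent P.p i j) ≠ 0 := by
      by_contra! h'
      refine hP ((IsZero.iff_id_eq_zero P).2 ?_)
      ext : 1
      exact h.eq_zero P.X P.p P.idem h'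
    obtain ⟨s, i, j, hs⟩ := this
    obtain ⟨a, b, hab⟩ := h.exists_retract s _ hs
    obtain ⟨f, g, hfg⟩ := exists_retract_idemObj (E s) (h.idem s) P i j a b hab
    obtain ⟨Q, hQ⟩ := exists_iso_biprod_of_retract f g hfg
    exact ⟨s, Q, hQ⟩

/-- An object given by an idempotent in a single 1 × 1 entry is identified by the characters of this
entry. Composites of indecomposables are recognised in this way. -/
theorem nonempty_iso_T (h : SeparatingChars χ X E) {P : Karoubi (Mat_ C)} [Unique P.X.ι] {r : S}
    (h1 : (χ r).app (ent P.p default default) = 1)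
    (h0 : ∀ s, s ≠ r → (χ s).app (ent P.p default default) = 0) :
    Nonempty (P ≅ h.krullSchmidt.T r) :=
  h.krullSchmidt.mult_injective ((mult_eq_single h1 h0).trans (h.krullSchmidt.mult_T r).symm)

end SeparatingChars

end

end FiatCat

/-! ### Horizontal composition in the completions, and the 2-category of an ordered monoid. -/

namespace FiatCat

open CategoryTheory Bicategory Limits Idempotents

universe w v u w'

section

variable {B : Type u} [Bicategory.{w, v} B] [PreadditiveBicategory B] {a b c : B}

/-- The composite of the two whiskerings collapses to the tensor product of the matrices by the
interchange law, so its entries can be read off directly. -/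
theorem MatCat.hc_eq_mhc {x y z : MatCat B} {F F' : x ⟶ y} {G G' : y ⟶ z} (η : F ⟶ F')
    (θ : G ⟶ G') : hc η θ = MatCat.mhc η θ := by
  refine (MatCat.mhc_comp η (𝟙 F') (𝟙 G) θ).symm.trans ?_
  rw [Category.comp_id, Category.id_comp]

theorem MatCat.ent_hc {x y z : MatCat B} {F F' : x ⟶ y} {G G' : y ⟶ z} (η : F ⟶ F')
    (θ : G ⟶ G') (p : (F : Mat_ _).ι × (G : Mat_ _).ι) (q : (F' : Mat_ _).ι × (G' : Mat_ _).ι) :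
    MatCat.ent (M := MatCat.comp₁ F G) (N := MatCat.comp₁ F' G') (hc η θ) p q =
      hc (MatCat.ent η p.1 q.1) (MatCat.ent θ p.2 q.2) := by
  rw [MatCat.hc_eq_mhc]
  rfl

end

section

variable {𝕜 : Type w'} [CommRing 𝕜] {B : Type u} [Bicategory.{w, v} B] {x y z : B}

/-- Horizontal composition of linear combinations of 2-morphisms. -/
noncomputable def LinCat.lhc {f f' : x ⟶ y} {g g' : y ⟶ z} (η : Free.of 𝕜 f ⟶ Free.of 𝕜 f')
    (θ : Free.of 𝕜 g ⟶ Free.of 𝕜 g') : Free.of 𝕜 (f ≫ g) ⟶ Free.of 𝕜 (f' ≫ g') :=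
  LinCat.wR η g ≫ LinCat.wL f' θ

theorem LinCat.lhc_sg {f f' : x ⟶ y} {g g' : y ⟶ z} (η : f ⟶ f') (θ : g ⟶ g') (r s : 𝕜) :
    LinCat.lhc (LinCat.sg η r) (LinCat.sg θ s) = LinCat.sg (hc η θ) (r * s) := by
  rw [LinCat.lhc, LinCat.wR_sg, LinCat.wL_sg, LinCat.sg_comp]
  rfl

theorem LinCat.lhc_id (f : x ⟶ y) (g : y ⟶ z) :
    LinCat.lhc (𝟙 (Free.of 𝕜 f)) (𝟙 (Free.of 𝕜 g)) = 𝟙 (Free.of 𝕜 (f ≫ g)) := by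
  rw [LinCat.lhc, LinCat.wR_id, LinCat.wL_id, Category.comp_id]

end

namespace MorphismChar

variable {D : Type u} [Category.{v} D] {𝕜 : Type w} [Field 𝕜]

/-- The linear form on a free module of morphisms with given values on the basis. -/
noncomputable def linearForm {X Y : D} (φ : (X ⟶ Y) → 𝕜) :
    (Free.of 𝕜 X ⟶ Free.of 𝕜 Y) →+ 𝕜 :=
  Finsupp.liftAddHom fun f : X ⟶ Y => AddMonoidHom.mulRight (φ f)

theorem linearForm_sg {X Y : D} (φ : (X ⟶ Y) → 𝕜) (f : X ⟶ Y) (r : 𝕜) :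
    linearForm φ (LinCat.sg f r) = r * φ f :=
  Finsupp.liftAddHom_apply_single _ _ _

theorem linearForm_comp (φ : ∀ X Y : D, (X ⟶ Y) → 𝕜)
    (hφ : ∀ {X Y Z : D} (f : X ⟶ Y) (g : Y ⟶ Z), φ X Z (f ≫ g) = φ X Y f * φ Y Z g) {X Y Z : D}
    (f : Free.of 𝕜 X ⟶ Free.of 𝕜 Y) (g : Free.of 𝕜 Y ⟶ Free.of 𝕜 Z) :
    linearForm (φ X Z) (f ≫ g) = linearForm (φ X Y) f * linearForm (φ Y Z) g := by
  induction f using LinCat.sg_induction with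
  | h0 => rw [zero_comp, map_zero, map_zero, zero_mul]
  | hadd f f' h h' => rw [Preadditive.add_comp, map_add, map_add, h, h', add_mul]
  | hs f r =>
    induction g using LinCat.sg_induction with
    | h0 => rw [comp_zero, map_zero, map_zero, mul_zero]
    | hadd g g' h h' => rw [Preadditive.comp_add, map_add, map_add, h, h', mul_add]
    | hs g s => rw [LinCat.sg_comp, linearForm_sg, linearForm_sg, linearForm_sg, hφ, mul_mul_mul_comm]

/-- The linear extension of a multiplicative function on morphisms. -/
noncomputable def free (φ : ∀ X Y : D, (X ⟶ Y) → 𝕜)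
    (hφ : ∀ {X Y Z : D} (f : X ⟶ Y) (g : Y ⟶ Z), φ X Z (f ≫ g) = φ X Y f * φ Y Z g) :
    MorphismChar (Free 𝕜 D) 𝕜 where
  app {X Y} := linearForm (D := D) (φ X Y)
  app_comp f g := linearForm_comp (D := D) φ hφ f g

end MorphismChar

namespace OrdMonCat

variable {S : Type u} [PartialOrder S] (𝕜 : Type w) [Field 𝕜]

open Classical in
/-- The coefficient of the identity of `s`. -/
noncomputable def char (s : S) : MorphismChar (Free 𝕜 (Hom₁ S)) 𝕜 :=
  MorphismChar.free (fun X Y _ => if X.val = s ∧ Y.val = s then 1 else 0) (by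
    intro X Y Z f g
    by_cases hX : X.val = s
    · by_cases hZ : Z.val = s
      · have hY : Y.val = s := le_antisymm (hZ ▸ g.down) (hX ▸ f.down)
        simp [hX, hY, hZ]
      · simp [hZ]
    · simp [hX])

open Classical in
theorem char_sg (s : S) {X Y : Hom₁ S} (f : X ⟶ Y) (r : 𝕜) :
    (char 𝕜 s).app (LinCat.sg f r) = r * if X.val = s ∧ Y.val = s then 1 else 0 :=
  MorphismChar.linearForm_sg _ f r

theorem char_id (s : S) (X : Hom₁ S) (h : X.val = s) :
    (char 𝕜 s).app (𝟙 (Free.of 𝕜 X)) = 1 := by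
  rw [LinCat.sg_id, char_sg, if_pos ⟨h, h⟩, mul_one]

theorem char_id_of_ne (s : S) (X : Hom₁ S) (h : X.val ≠ s) :
    (char 𝕜 s).app (𝟙 (Free.of 𝕜 X)) = 0 := by
  rw [LinCat.sg_id, char_sg, if_neg fun h' => h h'.1, mul_zero]

variable {𝕜}

/-- There is at most one 2-morphism X ⟶ Y, so the space of 2-morphisms is at most one-dimensional.
-/
theorem exists_eq_sg {X Y : Hom₁ S} (f : Free.of 𝕜 X ⟶ Free.of 𝕜 Y) (hf : f ≠ 0) :
    ∃ (g : X ⟶ Y) (r : 𝕜), f = LinCat.sg g r ∧ r ≠ 0 := by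
  have hf' : (show (X ⟶ Y) →₀ 𝕜 from f) ≠ 0 := hf
  obtain ⟨g, hg⟩ := Finsupp.support_nonempty_iff.2 hf'
  refine ⟨g, (show (X ⟶ Y) →₀ 𝕜 from f) g, ?_, Finsupp.mem_support_iff.1 hg⟩
  refine Finsupp.ext (M := 𝕜) fun g' : X ⟶ Y => ?_
  obtain rfl : g = g' := Subsingleton.elim _ _
  exact Finsupp.single_eq_same.symm

theorem le_of_ne_zero {X Y : Hom₁ S} (f : Free.of 𝕜 X ⟶ Free.of 𝕜 Y) (hf : f ≠ 0) :
    X.val ≤ Y.val := by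
  obtain ⟨g, -⟩ := exists_eq_sg f hf
  exact g.down

theorem char_ne_zero {X Y : Hom₁ S} (f : Free.of 𝕜 X ⟶ Free.of 𝕜 Y) (hf : f ≠ 0)
    (h : Y.val = X.val) : (char 𝕜 X.val).app f ≠ 0 := by
  obtain ⟨g, r, rfl, hr⟩ := exists_eq_sg f hf
  rwa [char_sg, if_pos ⟨rfl, h⟩, mul_one]

/-- A nonzero entry of p at (i, j) forces the label of i to lie strictly below that of j, so p is
strictly triangular and an idempotent of this kind is zero. Concretely, take a nonzero row i with
maximal label: p = p ≫ p produces a nonzero row k with a larger label. -/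
theorem eq_zero_of_char (M : Mat_ (Free 𝕜 (Hom₁ S))) (p : M ⟶ M) (hp : p ≫ p = p)
    (h : ∀ s i j, (char 𝕜 s).app (MatCat.ent p i j) = 0) : p = 0 := by
  by_contra hne
  let val : M.ι → S := fun i => Hom₁.val (M.X i)
  have hlt : ∀ i j, MatCat.ent p i j ≠ 0 → val i < val j := fun i j hij =>
    lt_of_le_of_ne (le_of_ne_zero (X := M.X i) (Y := M.X j) (MatCat.ent p i j) hij)
      fun e => char_ne_zero (X := M.X i) (Y := M.X j) (MatCat.ent p i j) hij e.symm (h _ i j)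
  have hne' : {i | ∃ j, MatCat.ent p i j ≠ 0}.Nonempty := by
    by_contra! h'
    refine hne (MatCat.mat_ext fun i j => ?_)
    by_contra hij
    exact Set.notMem_empty i (h' ▸ (⟨j, hij⟩ : ∃ j, MatCat.ent p i j ≠ 0))
  obtain ⟨i, ⟨j, hij⟩, hmax⟩ := Set.Finite.exists_maximalFor val _ (Set.toFinite _) hne'
  rw [← hp, MatCat.ent_comp] at hij
  obtain ⟨k, -, hk⟩ := Finset.exists_ne_zero_of_sum_ne_zero hij
  have h1 : MatCat.ent p i k ≠ 0 := fun h' => hk (by rw [h', zero_comp])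
  have h2 : MatCat.ent p k j ≠ 0 := fun h' => hk (by rw [h', comp_zero])
  exact (hlt i k h1).not_ge (hmax ⟨j, h2⟩ (hlt i k h1).le)

/-- A 2-morphism detected by the form of s is a nonzero multiple of the identity of s, hence
invertible. -/
theorem exists_retract_of_char (s : S) {Y Z : Hom₁ S} (f : Free.of 𝕜 Y ⟶ Free.of 𝕜 Z)
    (hf : (char 𝕜 s).app f ≠ 0) :
    ∃ (a : Free.of 𝕜 (Hom₁.mk s) ⟶ Free.of 𝕜 Y) (b : Free.of 𝕜 Z ⟶ Free.of 𝕜 (Hom₁.mk s)),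
      𝟙 _ ≫ a ≫ f ≫ b ≫ 𝟙 _ = 𝟙 (Free.of 𝕜 (Hom₁.mk s)) := by
  have hf0 : f ≠ 0 := fun h => hf (by rw [h, map_zero])
  obtain ⟨g, r, rfl, hr⟩ := exists_eq_sg f hf0
  have hYZ : Y.val = s ∧ Z.val = s := by
    by_contra h
    rw [char_sg, if_neg h, mul_zero] at hf
    exact hf rfl
  obtain ⟨Y⟩ := Y
  obtain ⟨Z⟩ := Z
  obtain ⟨rfl, rfl⟩ := hYZ
  obtain rfl : g = 𝟙 _ := Subsingleton.elim _ _
  refine ⟨LinCat.sg (𝟙 _) r⁻¹, 𝟙 _, ?_⟩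
  rw [Category.id_comp, Category.id_comp, Category.comp_id, LinCat.sg_comp, Category.comp_id,
    inv_mul_cancel₀ hr, LinCat.sg_id]

theorem separatingChars [Finite S] : SeparatingChars (char (S := S) 𝕜)
    (fun s => Free.of 𝕜 (Hom₁.mk s)) (fun s => 𝟙 (Free.of 𝕜 (Hom₁.mk s))) where
  idem _ := Category.comp_id _
  app_self s := char_id 𝕜 s _ rfl
  app_of_ne s _ h := char_id_of_ne 𝕜 s _ (Ne.symm h)
  eq_zero := eq_zero_of_char
  exists_retract s _ _ f hf := exists_retract_of_char s f hf

variable [Monoid S] [MulLeftMono S] [MulRightMono S] [Finite S]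

variable (𝕜) in
/-- The Krull-Schmidt property of the finitarization of the 2-category of an ordered monoid. -/
noncomputable def krullSchmidt (x y : Finitarization 𝕜 (OrdMonCat S)) : KrullSchmidt (x ⟶ y) S :=
  (separatingChars (S := S) (𝕜 := 𝕜)).krullSchmidt

/-- The composite is a family with one member, and its idempotent is the identity of the 1-morphism
`t * s`, which only the form of `t * s` detects. -/
theorem krullSchmidt_comp (x y z : Finitarization 𝕜 (OrdMonCat S)) (s t : S) :
    Nonempty ((krullSchmidt 𝕜 x y).T s ≫ (krullSchmidt 𝕜 y z).T t ≅
      (krullSchmidt 𝕜 x z).T (t * s)) := by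
  let P : Karoubi (Mat_ (Free 𝕜 (Hom₁ S))) := (krullSchmidt 𝕜 x y).T s ≫ (krullSchmidt 𝕜 y z).T t
  let _ : Unique P.X.ι := ⟨⟨((), ())⟩, fun _ => rfl⟩
  have h : MatCat.ent P.p default default = 𝟙 (Free.of 𝕜 (Hom₁.mk (t * s))) := by
    refine (MatCat.ent_hc _ _ _ _).trans ?_
    exact LinCat.lhc_id _ _
  refine (separatingChars (S := S) (𝕜 := 𝕜)).nonempty_iso_T (P := P) ?_ ?_
  · rw [h]
    exact char_id 𝕜 _ _ rfl
  · intro r hr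
    rw [h]
    exact char_id_of_ne 𝕜 _ _ (Ne.symm hr)

end OrdMonCat

end FiatCat

/-! ### Splitting of identity 1-morphisms preserves the Krull-Schmidt property. -/

namespace FiatCat

open CategoryTheory Bicategory Limits Idempotents

universe w v u w'

namespace SplitCat

variable {C : Type u} [Bicategory.{w, v} C] [PreadditiveBicategory C]
  {x y z : SplitCat C}

/-- The cutting idempotents form a natural endomorphism of the identity functor, so being fixed by
them passes to retracts. -/
theorem cut_eq_id_of_retract {F G : x.obj ⟶ y.obj} (i : F ⟶ G) (r : G ⟶ F) (h : i ≫ r = 𝟙 F)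
    (hG : cut x y G = 𝟙 G) : cut x y F = 𝟙 F := by
  rw [← Category.comp_id (cut x y F), ← h, ← Category.assoc, cut_naturality, hG, Category.comp_id]

variable [∀ a b : C, IsIdempotentComplete (a ⟶ b)]

/-- The functor sending a 1-morphism to the direct summand cut out by its idempotent. -/
noncomputable def imFunctor (x y : SplitCat C) : (x ⟶ y) ⥤ (x.obj ⟶ y.obj) where
  obj := im
  map := E
  map_id := E_id
  map_comp := E_comp

instance : (imFunctor x y).Additive where
  map_add := E_add _ _

/-- A 1-morphism that is fixed by its idempotent is its own direct summand. -/
noncomputable def imIso (F : x.obj ⟶ y.obj) (h : cut x y F = 𝟙 F) : im (⟨F⟩ : Hom₁ x y) ≅ F where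
  hom := ι ⟨F⟩
  inv := π ⟨F⟩
  hom_inv_id := ι_π _
  inv_hom_id := (π_ι _).trans h

theorem cut_im (F : Hom₁ x y) : cut x y (im F) = 𝟙 (im F) := by
  rw [cut, lact_im, ract_im, Category.comp_id]

/-- A 1-morphism is isomorphic to its direct summand. -/
noncomputable def isoIm (F : Hom₁ x y) : F ≅ (cutFunctor x y).obj (im F) where
  hom := ofCut (G := ⟨im F⟩) (π F) (cut_π F)
  inv := ofCut (F := ⟨im F⟩) (ι F) ((congrArg (· ≫ _) (cut_im F)).trans (Category.id_comp _))
  hom_inv_id := u_ext (π_ι F)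
  inv_hom_id := u_ext ((ι_π F).trans (cut_im F).symm)

theorem isZero_of_isZero_im {F : Hom₁ x y} (h : IsZero (im F)) : IsZero F :=
  ((cutFunctor x y).map_isZero h).of_iso (isoIm F)

/-- Composition after splitting is that of C applied to the cut summands. For factors fixed by their
cuts these summands are the factors themselves. -/
theorem comp_iso {F : x.obj ⟶ y.obj} {G : y.obj ⟶ z.obj} {H : x.obj ⟶ z.obj}
    (hF : cut x y F = 𝟙 F) (hG : cut y z G = 𝟙 G) (e : F ≫ G ≅ H) :
    Nonempty ((show x ⟶ y from ⟨F⟩) ≫ (show y ⟶ z from ⟨G⟩) ≅ (show x ⟶ z from ⟨H⟩)) :=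
  ⟨(cutFunctor x z).mapIso
    (whiskerRightIso (imIso F hF) _ ≪≫ whiskerLeftIso F (imIso G hG) ≪≫ e)⟩

end SplitCat

open SplitCat in
open Classical in
/-- The Krull-Schmidt property is inherited when the identity 1-morphisms are split. -/
noncomputable def KrullSchmidt.split {C : Type u} [Bicategory.{w, v} C] [PreadditiveBicategory C]
    [∀ a b : C, IsIdempotentComplete (a ⟶ b)] [∀ a b : C, HasZeroObject (a ⟶ b)]
    [∀ a b : C, HasBinaryBiproducts (a ⟶ b)] {x y : SplitCat C} {S : Type w'}
    (ks : KrullSchmidt (x.obj ⟶ y.obj) S) (p : S → Prop)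
    (h : ∀ s, p s ↔ cut x y (ks.T s) = 𝟙 (ks.T s)) : KrullSchmidt (x ⟶ y) {s // p s} where
  T s := (⟨ks.T s⟩ : Hom₁ x y)
  -- After splitting, an object is isomorphic to its cut summand `im P`, so its multiplicities are
  -- those of `im P` in C, restricted to the surviving labels.
  mult := Finsupp.subtypeDomainAddMonoidHom.comp (ks.mult.comp (SplitK₀.mapIsoClass (imFunctor x y)))
  mult_T s := by
    have h1 : SplitK₀.mapIsoClass (imFunctor x y) (IsoClass.of (⟨ks.T s⟩ : Hom₁ x y)) =
        IsoClass.of (ks.T s) := IsoClass.sound (imIso (ks.T s) ((h s).1 s.2))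
    refine (congrArg (fun c => Finsupp.subtypeDomainAddMonoidHom (p := p) (ks.mult c)) h1).trans ?_
    rw [ks.mult_T]
    ext t
    change Finsupp.single s.1 1 t.1 = _
    rw [Finsupp.single_apply, Finsupp.single_apply]
    exact if_congr Subtype.ext_iff.symm rfl rfl
  exists_summand P hP := by
    obtain ⟨s, Q, ⟨e⟩⟩ := ks.exists_summand (im P) fun h0 => hP (isZero_of_isZero_im h0)
    -- The summand T s is a retract of `im P`, on which the cut is the identity; hence the cut is
    -- the identity on T s as well and the label s survives.
    have hs : p s := (h s).2 (cut_eq_id_of_retract (biprod.inl ≫ e.inv) (e.hom ≫ biprod.fst)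
      (by simp) (cut_im P))
    have := preservesBinaryBiproducts_of_preservesBiproducts (cutFunctor x y)
    exact ⟨⟨s, hs⟩, (cutFunctor x y).obj Q,
      ⟨isoIm P ≪≫ (cutFunctor x y).mapIso e ≪≫ (cutFunctor x y).mapBiprod (ks.T s) Q⟩⟩

end FiatCat

/-! ### The finitarization of B_n and its indecomposable 1-morphisms. -/

namespace FiatCat

open CategoryTheory Bicategory Limits Idempotents PartitionMonoid

universe w v u w'

section

variable {𝕜 : Type w'} [CommRing 𝕜] {B : Type u} [Bicategory.{w, v} B] {x y z : B}

theorem LinCat.lhc_add {f f' : x ⟶ y} {g g' : y ⟶ z} (η : Free.of 𝕜 f ⟶ Free.of 𝕜 f')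
    (θ θ' : Free.of 𝕜 g ⟶ Free.of 𝕜 g') : lhc η (θ + θ') = lhc η θ + lhc η θ' := by
  rw [lhc, wL_add, Preadditive.comp_add]
  rfl

theorem LinCat.add_lhc {f f' : x ⟶ y} {g g' : y ⟶ z} (η η' : Free.of 𝕜 f ⟶ Free.of 𝕜 f')
    (θ : Free.of 𝕜 g ⟶ Free.of 𝕜 g') : lhc (η + η') θ = lhc η θ + lhc η' θ := by
  rw [lhc, wR_add, Preadditive.add_comp]
  rfl

theorem LinCat.lhc_zero {f f' : x ⟶ y} {g g' : y ⟶ z} (η : Free.of 𝕜 f ⟶ Free.of 𝕜 f') :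
    lhc η (0 : Free.of 𝕜 g ⟶ Free.of 𝕜 g') = 0 := by
  rw [lhc, wL_zero, comp_zero]

theorem LinCat.zero_lhc {f f' : x ⟶ y} {g g' : y ⟶ z} (θ : Free.of 𝕜 g ⟶ Free.of 𝕜 g') :
    lhc (0 : Free.of 𝕜 f ⟶ Free.of 𝕜 f') θ = 0 := by
  rw [lhc, wR_zero, zero_comp]

end

namespace BCat

variable {n : ℕ}

/-- The element of `F*_n` underlying a 2-morphism. -/
def toFStar {π σ : Hom₁ n} (α : π ⟶ σ) : FStar n := FStar.mk (σ := π.perm) (Hom₂.val α) α.left_le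

theorem toFStar_val {π σ : Hom₁ n} (α : π ⟶ σ) : (toFStar α).val = Hom₂.val α := rfl

theorem toFStar_injective {π σ : Hom₁ n} : Function.Injective (toFStar (π := π) (σ := σ)) :=
  fun _ _ h => hom₂_ext (congrArg FStar.val h)

/-- In the bicategory the horizontal composite is a vertical composite of two whiskerings, hence the
join of two translates by permutations. `mul_eq_sup_of_le` identifies this join with the product of
partitions. -/
theorem toFStar_hc {x y z : BCat n} {π π' : x ⟶ y} {σ σ' : y ⟶ z} (α : π ⟶ π') (β : σ ⟶ σ') :
    toFStar (hc α β : (_ : Hom₁ n) ⟶ _) = toFStar (β : (_ : Hom₁ n) ⟶ _) * toFStar α := by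
  apply FStar.val_injective
  exact (mul_eq_sup_of_le (Hom₂.right_le α) (Hom₂.left_le β)).symm

variable (𝕜 : Type w) [Field 𝕜]

open Classical in
/-- The sum of the coefficients of the 2-morphisms that are finer than `γ`. -/
noncomputable def char (γ : FStar n) : MorphismChar (Free 𝕜 (Hom₁ n)) 𝕜 :=
  MorphismChar.free (fun _ _ α => if Hom₂.val α ≤ γ.val then 1 else 0) (by
    intro π σ τ α β
    -- Vertical composition is the join, which is finer than γ exactly when both factors are; so the
    -- form is multiplicative.
    rw [comp_val, sup_le_iff]
    split_ifs <;> simp_all)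

variable {𝕜}

open Classical in
theorem char_sg (γ : FStar n) {π σ : Hom₁ n} (α : π ⟶ σ) (r : 𝕜) :
    (char 𝕜 γ).app (LinCat.sg α r) = r * if Hom₂.val α ≤ γ.val then 1 else 0 :=
  MorphismChar.linearForm_sg _ α r

/-- A linear combination of 2-morphisms as an element of the semigroup algebra. -/
noncomputable def toAlg {π σ : Hom₁ n} :
    (Free.of 𝕜 π ⟶ Free.of 𝕜 σ) →+ MonoidAlgebra 𝕜 (FStar n) :=
  Finsupp.liftAddHom fun α : π ⟶ σ => MonoidAlgebra.singleAddHom (toFStar α)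

theorem toAlg_sg {π σ : Hom₁ n} (α : π ⟶ σ) (r : 𝕜) :
    toAlg (LinCat.sg α r) = MonoidAlgebra.single (toFStar α) r :=
  Finsupp.liftAddHom_apply_single _ _ _

theorem char_toAlg (γ : FStar n) {π σ : Hom₁ n} (f : Free.of 𝕜 π ⟶ Free.of 𝕜 σ) :
    FStar.char 𝕜 γ (toAlg f) = (char 𝕜 γ).app f := by
  classical
  induction f using LinCat.sg_induction with
  | h0 => rw [map_zero, map_zero, map_zero]
  | hadd f g hf hg => rw [map_add, map_add, map_add, hf, hg]
  | hs α r => rw [toAlg_sg, FStar.char_single, char_sg, mul_ite, mul_one, mul_zero, toFStar_val]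

/-- With source and target fixed, distinct 2-morphisms are distinct partitions, so spaces of
2-morphisms are subspaces of the semigroup algebra and inherit the separation by characters. -/
theorem toAlg_injective {π σ : Hom₁ n} : Function.Injective (toAlg (𝕜 := 𝕜) (π := π) (σ := σ)) := by
  have h : ∀ f : Free.of 𝕜 π ⟶ Free.of 𝕜 σ,
      (toAlg f).coeff = Finsupp.mapDomain (M := 𝕜) (toFStar (π := π) (σ := σ)) f := by
    intro f
    induction f using LinCat.sg_induction with
    | h0 => exact Finsupp.mapDomain_zero.symm
    | hadd f g hf hg =>
      rw [map_add, MonoidAlgebra.coeff_add, hf, hg]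
      exact Finsupp.mapDomain_add.symm
    | hs α r =>
      rw [toAlg_sg]
      exact Finsupp.mapDomain_single.symm
  intro f g hfg
  exact Finsupp.mapDomain_injective toFStar_injective
    ((h f).symm.trans ((congrArg MonoidAlgebra.coeff hfg).trans (h g)))

theorem ext_char {π σ : Hom₁ n} {f g : Free.of 𝕜 π ⟶ Free.of 𝕜 σ}
    (h : ∀ γ, (char 𝕜 γ).app f = (char 𝕜 γ).app g) : f = g :=
  toAlg_injective (FStar.char_injective fun γ => by rw [char_toAlg, char_toAlg, h])

/-- This turns horizontal composition into multiplication in the semigroup algebra, so that the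
groupoid rule `FStar.mob_mul_mob` applies. The order is reversed because the bicategory composes
diagrammatically. -/
theorem toAlg_lhc {x y z : BCat n} {π π' : x ⟶ y} {σ σ' : y ⟶ z} (η : Free.of 𝕜 π ⟶ Free.of 𝕜 π')
    (θ : Free.of 𝕜 σ ⟶ Free.of 𝕜 σ') :
    toAlg (LinCat.lhc η θ : Free.of 𝕜 (_ : Hom₁ n) ⟶ Free.of 𝕜 _) =
      toAlg (θ : Free.of 𝕜 (_ : Hom₁ n) ⟶ Free.of 𝕜 _) * toAlg η := by
  induction η using LinCat.sg_induction with
  | h0 => rw [LinCat.zero_lhc]; exact (mul_zero _).symm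
  | hadd f g hf hg =>
    rw [LinCat.add_lhc]
    exact (map_add toAlg _ _).trans ((congrArg₂ _ hf hg).trans
      ((mul_add _ _ _).symm.trans (congrArg _ (map_add toAlg _ _).symm)))
  | hs α r =>
    induction θ using LinCat.sg_induction with
    | h0 => rw [LinCat.lhc_zero]; exact (zero_mul _).symm
    | hadd f g hf hg =>
      rw [LinCat.lhc_add]
      exact (map_add toAlg _ _).trans ((congrArg₂ _ hf hg).trans
        ((add_mul _ _ _).symm.trans (congrArg (· * _) (map_add toAlg _ _).symm)))
    | hs β s =>
      rw [LinCat.lhc_sg]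
      refine (toAlg_sg _ _).trans ?_
      refine Eq.trans ?_ (congrArg₂ (· * ·) (toAlg_sg _ _).symm (toAlg_sg _ _).symm)
      rw [MonoidAlgebra.single_mul_single, toFStar_hc, mul_comm]

/-- An element of F*_n coarser than both permutations is itself a 2-morphism between them. So Möbius
elements of such γ come from 2-morphisms, which is how `elem` is obtained. -/
theorem exists_toAlg_eq {π σ : Hom₁ n} {x : MonoidAlgebra 𝕜 (FStar n)}
    (hx : x ∈ FStar.above 𝕜 (ofPerm π.perm ⊔ ofPerm σ.perm)) :
    ∃ f : Free.of 𝕜 π ⟶ Free.of 𝕜 σ, toAlg f = x := by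
  induction hx using AddSubmonoid.closure_induction with
  | zero => exact ⟨0, map_zero _⟩
  | add x y _ _ hx hy =>
    obtain ⟨f, rfl⟩ := hx
    obtain ⟨g, rfl⟩ := hy
    exact ⟨f + g, map_add _ _ _⟩
  | mem x hx =>
    obtain ⟨s, hs, r, rfl⟩ := hx
    have h := sup_le_iff.1 hs
    exact ⟨LinCat.sg (⟨s.val, isPropagating_of_le h.1, h.1, h.2⟩ : Hom₂ π σ) r, toAlg_sg _ _⟩

variable (𝕜) in
/-- The basis element of the morphism space `π ⟶ σ` that corresponds to `γ`. -/
noncomputable def elem {π σ : Hom₁ n} {γ : FStar n} (hπ : ofPerm π.perm ≤ γ.val)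
    (hσ : ofPerm σ.perm ≤ γ.val) : Free.of 𝕜 π ⟶ Free.of 𝕜 σ :=
  (exists_toAlg_eq (FStar.mob_mem_above (R := 𝕜) (sup_le hπ hσ))).choose

theorem toAlg_elem {π σ : Hom₁ n} {γ : FStar n} (hπ : ofPerm π.perm ≤ γ.val)
    (hσ : ofPerm σ.perm ≤ γ.val) : toAlg (elem 𝕜 hπ hσ) = FStar.mob 𝕜 γ :=
  (exists_toAlg_eq (FStar.mob_mem_above (R := 𝕜) (sup_le hπ hσ))).choose_spec

open Classical in
theorem char_elem {π σ : Hom₁ n} {γ : FStar n} (hπ : ofPerm π.perm ≤ γ.val)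
    (hσ : ofPerm σ.perm ≤ γ.val) (δ : FStar n) :
    (char 𝕜 δ).app (elem 𝕜 hπ hσ) = if γ = δ then 1 else 0 := by
  rw [← char_toAlg, toAlg_elem, FStar.char_mob]

/-- For fixed γ these 2-morphisms behave like matrix units: the characters are multiplicative for
vertical composition, separate 2-morphisms, and on each side only that of γ has the value 1. In
particular every permutation finer than γ yields the same summand up to isomorphism. -/
theorem elem_comp_elem {π σ τ : Hom₁ n} {γ : FStar n} (hπ : ofPerm π.perm ≤ γ.val)
    (hσ : ofPerm σ.perm ≤ γ.val) (hτ : ofPerm τ.perm ≤ γ.val) :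
    elem 𝕜 hπ hσ ≫ elem 𝕜 hσ hτ = elem 𝕜 hπ hτ := by
  classical
  refine ext_char fun δ => ?_
  rw [(char 𝕜 δ).app_comp, char_elem, char_elem, char_elem]
  split_ifs <;> simp

theorem le_of_char_ne_zero {γ : FStar n} {π σ : Hom₁ n} {f : Free.of 𝕜 π ⟶ Free.of 𝕜 σ}
    (h : (char 𝕜 γ).app f ≠ 0) : ofPerm π.perm ≤ γ.val ∧ ofPerm σ.perm ≤ γ.val := by
  classical
  by_contra hn
  apply h
  clear h
  induction f using LinCat.sg_induction with
  | h0 => rw [map_zero]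
  | hadd f g hf hg => rw [map_add, hf, hg, add_zero]
  | hs α r =>
    rw [char_sg, if_neg fun h => hn ⟨(Hom₂.left_le α).trans h, (Hom₂.right_le α).trans h⟩,
      mul_zero]

/-- A permutation that is finer than `γ`. -/
noncomputable def base (γ : FStar n) : Hom₁ n := ⟨γ.exists_ofPerm_le.choose⟩

theorem base_le (γ : FStar n) : ofPerm (base γ).perm ≤ γ.val := γ.exists_ofPerm_le.choose_spec

/-- Between matrix units of γ only the character of γ can survive, so f becomes its value there
times the idempotent of γ; the factor in b removes this nonzero scalar. -/
theorem exists_retract_of_char (γ : FStar n) {Y Z : Hom₁ n} (f : Free.of 𝕜 Y ⟶ Free.of 𝕜 Z)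
    (hf : (char 𝕜 γ).app f ≠ 0) :
    ∃ (a : Free.of 𝕜 (base γ) ⟶ Free.of 𝕜 Y) (b : Free.of 𝕜 Z ⟶ Free.of 𝕜 (base γ)),
      elem 𝕜 (base_le γ) (base_le γ) ≫ a ≫ f ≫ b ≫ elem 𝕜 (base_le γ) (base_le γ) =
        elem 𝕜 (base_le γ) (base_le γ) := by
  classical
  obtain ⟨hY, hZ⟩ := le_of_char_ne_zero hf
  refine ⟨elem 𝕜 (base_le γ) hY,
    elem 𝕜 hZ (base_le γ) ≫ LinCat.sg (𝟙 (base γ)) ((char 𝕜 γ).app f)⁻¹, ?_⟩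
  refine ext_char fun δ => ?_
  simp only [MorphismChar.app_comp, char_elem, char_sg]
  by_cases h : γ = δ
  · subst h
    rw [if_pos rfl, if_pos (show Hom₂.val (𝟙 (base γ)) ≤ γ.val from base_le γ)]
    field_simp
  · simp [h]

theorem separatingChars : SeparatingChars (char (n := n) 𝕜) (fun γ => Free.of 𝕜 (base γ))
    (fun γ => elem 𝕜 (base_le γ) (base_le γ)) where
  idem _ := elem_comp_elem _ _ _
  app_self γ := by classical rw [char_elem, if_pos rfl]
  app_of_ne γ δ h := by classical rw [char_elem, if_neg (Ne.symm h)]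
  eq_zero M p _ h := MatCat.mat_ext fun i j => ext_char (π := M.X i) (σ := M.X j) fun γ =>
    (h γ i j).trans (map_zero (char 𝕜 γ).app).symm
  exists_retract γ _ _ f hf := exists_retract_of_char γ f hf

variable (𝕜) in
/-- The Krull-Schmidt property of the finitarization of `B_n`. -/
noncomputable def krullSchmidt (x y : Finitarization 𝕜 (BCat n)) : KrullSchmidt (x ⟶ y) (FStar n) :=
  (separatingChars (n := n) (𝕜 := 𝕜)).krullSchmidt

/-- The idempotent of the composite is the product of the Möbius elements of t and s. Under the
hypothesis this is the Möbius element of `t * s`, which is detected by exactly one character. -/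
theorem krullSchmidt_comp (x y z : Finitarization 𝕜 (BCat n)) {s t : FStar n}
    (h : FStar.ker t = FStar.coker s) :
    Nonempty ((krullSchmidt 𝕜 x y).T s ≫ (krullSchmidt 𝕜 y z).T t ≅
      (krullSchmidt 𝕜 x z).T (t * s)) := by
  classical
  let P : Karoubi (Mat_ (Free 𝕜 (Hom₁ n))) := (krullSchmidt 𝕜 x y).T s ≫ (krullSchmidt 𝕜 y z).T t
  let _ : Unique P.X.ι := ⟨⟨((), ())⟩, fun _ => rfl⟩
  have hP : ∀ γ, (char 𝕜 γ).app (MatCat.ent P.p default default) = if t * s = γ then 1 else 0 := by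
    intro γ
    refine (char_toAlg (π := comp₁ (base s) (base t)) (σ := comp₁ (base s) (base t)) γ
      (MatCat.ent P.p default default)).symm.trans ?_
    have h1 : toAlg (π := comp₁ (base s) (base t)) (σ := comp₁ (base s) (base t))
        (MatCat.ent P.p default default) = FStar.mob 𝕜 t * FStar.mob 𝕜 s := by
      refine (congrArg toAlg (MatCat.ent_hc _ _ _ _)).trans ?_
      refine (toAlg_lhc (x := .pt) (y := .pt) (z := .pt) _ _).trans ?_
      exact congrArg₂ _ (toAlg_elem (base_le t) (base_le t)) (toAlg_elem (base_le s) (base_le s))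
    rw [h1, FStar.mob_mul_mob, if_pos h, FStar.char_mob]
  refine (separatingChars (n := n) (𝕜 := 𝕜)).nonempty_iso_T (P := P) ?_ ?_
  · rw [hP, if_pos rfl]
  · intro r hr
    rw [hP, if_neg (Ne.symm hr)]

end BCat

end FiatCat

/-! ### Primitive idempotents, the split 2-category of B_n, and the ring isomorphisms. -/

namespace FiatCat

open CategoryTheory Bicategory Limits Idempotents PartitionMonoid

universe w v u

namespace MorphismChar

variable {C : Type u} [Category.{v} C] [Preadditive C] {𝕜 : Type w} [Field 𝕜]
  (χ : MorphismChar C 𝕜)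

/-- The value of a character on a morphism between families with a single member. -/
noncomputable def value {P Q : Karoubi (Mat_ C)} [Unique P.X.ι] [Unique Q.X.ι] (f : P ⟶ Q) : 𝕜 :=
  χ.app (MatCat.ent f.f default default)

theorem value_comp {P Q R : Karoubi (Mat_ C)} [Unique P.X.ι] [Unique Q.X.ι] [Unique R.X.ι]
    (f : P ⟶ Q) (g : Q ⟶ R) : χ.value (f ≫ g) = χ.value f * χ.value g := by
  rw [value, Karoubi.comp_f, MatCat.ent_comp, Fintype.sum_unique, χ.app_comp]
  rfl

end MorphismChar

namespace FStar

variable {n : ℕ}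

theorem mul_self_of_one_le {f : FStar n} (hf : 1 ≤ f.val) : f * f = f :=
  val_injective (idem_of_one_le hf)

theorem mul_eq_left {s f : FStar n} (hf : 1 ≤ f.val) (h : ker s = ker f) : s * f = s := by
  obtain ⟨σ, hσ⟩ := s.exists_ofPerm_le
  obtain ⟨g, hg, rfl⟩ := exists_eq_perm_mul hσ
  rw [ker_perm_mul] at h
  obtain rfl := eq_of_ker_eq (s := 1) hg hf h
  rw [mul_assoc, mul_self_of_one_le hg]

theorem mul_eq_right {s f : FStar n} (hf : 1 ≤ f.val) (h : coker s = ker f) : f * s = s := by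
  obtain ⟨σ, hσ⟩ := s.exists_ofPerm_le
  obtain ⟨g, hg, rfl⟩ := exists_eq_mul_perm hσ
  rw [coker_mul_perm, coker_eq_ker hg] at h
  obtain rfl := eq_of_ker_eq (s := 1) hg hf h
  rw [← mul_assoc, mul_self_of_one_le hg]

/-- Writing t as a permutation times an idempotent g, the hypothesis makes g a left identity for s,
and the remaining permutation does not change the kernel. With `coker_mul_of_eq` this locates the
composite in the groupoid. -/
theorem ker_mul_of_eq {s t : FStar n} (h : ker t = coker s) : ker (t * s) = ker s := by
  obtain ⟨τ, hτ⟩ := t.exists_ofPerm_le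
  obtain ⟨g, hg, rfl⟩ := exists_eq_perm_mul hτ
  rw [ker_perm_mul] at h
  rw [mul_assoc, ker_perm_mul, mul_eq_right hg h.symm]

theorem coker_mul_of_eq {s t : FStar n} (h : ker t = coker s) : coker (t * s) = coker t := by
  obtain ⟨σ, hσ⟩ := s.exists_ofPerm_le
  obtain ⟨g, hg, rfl⟩ := exists_eq_mul_perm hσ
  rw [coker_mul_perm, coker_eq_ker hg] at h
  rw [← mul_assoc, coker_mul_perm, mul_eq_left hg h]

end FStar

namespace BCat

variable {n : ℕ} {𝕜 : Type w} [Field 𝕜]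

variable (n 𝕜) in
/-- The family with the identity of `S_n` as its single member. -/
@[reducible] def unitFamily : Mat_ (Free 𝕜 (Hom₁ n)) := Mat_.mk Unit fun _ => Free.of 𝕜 ⟨1⟩

/-- An endomorphism of an identity 1-morphism as an element of the semigroup algebra. -/
noncomputable def unitAlg {x : Finitarization 𝕜 (BCat n)} (e : 𝟙 x ⟶ 𝟙 x) :
    MonoidAlgebra 𝕜 (FStar n) :=
  toAlg (𝕜 := 𝕜) (π := ⟨1⟩) (σ := ⟨1⟩) (MatCat.ent (M := unitFamily n 𝕜) (N := unitFamily n 𝕜)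
    (Karoubi.Hom.f e) () ())

theorem unitAlg_injective {x : Finitarization 𝕜 (BCat n)} :
    Function.Injective (unitAlg (x := x)) := fun _ _ h =>
  Karoubi.Hom.ext (MatCat.mat_ext fun _ _ => toAlg_injective (π := ⟨1⟩) (σ := ⟨1⟩) h)

theorem unitAlg_zero (x : Finitarization 𝕜 (BCat n)) : unitAlg (0 : 𝟙 x ⟶ 𝟙 x) = 0 :=
  map_zero (toAlg (π := ⟨1⟩) (σ := ⟨1⟩))

theorem char_unitAlg_comp {x : Finitarization 𝕜 (BCat n)} (γ : FStar n) (e e' : 𝟙 x ⟶ 𝟙 x) :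
    FStar.char 𝕜 γ (unitAlg (e ≫ e')) =
      FStar.char 𝕜 γ (unitAlg e) * FStar.char 𝕜 γ (unitAlg e') := by
  refine (char_toAlg (𝕜 := 𝕜) γ _).trans ?_
  refine Eq.trans ?_ (congrArg₂ (· * ·) (char_toAlg (𝕜 := 𝕜) γ _).symm (char_toAlg (𝕜 := 𝕜) γ _).symm)
  let _ : Unique (𝟙 x : Karoubi (Mat_ (Free 𝕜 (Hom₁ n)))).X.ι := ⟨⟨()⟩, fun _ => rfl⟩
  exact (char 𝕜 γ).value_comp (P := 𝟙 x) (Q := 𝟙 x) (R := 𝟙 x) e e'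

theorem one_le_of_char_unitAlg {x : Finitarization 𝕜 (BCat n)} {γ : FStar n} {e : 𝟙 x ⟶ 𝟙 x}
    (h : FStar.char 𝕜 γ (unitAlg e) ≠ 0) : 1 ≤ γ.val := by
  rw [unitAlg, char_toAlg] at h
  exact (le_of_char_ne_zero h).1

theorem exists_unitAlg_eq (x : Finitarization 𝕜 (BCat n)) {f : FStar n} (hf : 1 ≤ f.val) :
    ∃ e : 𝟙 x ⟶ 𝟙 x, unitAlg e = FStar.mob 𝕜 f := by
  refine ⟨⟨MatCat.mat fun _ _ => elem 𝕜 (π := ⟨1⟩) (σ := ⟨1⟩) hf hf, ?_⟩,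
    toAlg_elem (π := ⟨1⟩) (σ := ⟨1⟩) hf hf⟩
  exact (Category.id_comp _).trans (Category.comp_id _)

/-- The endomorphism algebra is embedded by its characters into a product of copies of 𝕜. A nonzero
idempotent has the value 1 at some γ, and then the Möbius element of γ lies below it; primitivity
makes them equal. -/
theorem exists_unitAlg_primitiveIdempotent {x : Finitarization 𝕜 (BCat n)}
    (e : PrimitiveIdempotent x) : ∃ f : FStar n, 1 ≤ f.val ∧ unitAlg e.val = FStar.mob 𝕜 f := by
  classical
  obtain ⟨γ, hγ⟩ : ∃ γ, FStar.char 𝕜 γ (unitAlg e.val) ≠ 0 := by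
    by_contra! h
    refine e.ne_zero (unitAlg_injective (FStar.char_injective fun γ => ?_))
    rw [h, unitAlg_zero, map_zero]
  have h1 := one_le_of_char_unitAlg hγ
  have hγ' : FStar.char 𝕜 γ (unitAlg e.val) = 1 := by
    have := char_unitAlg_comp γ e.val e.val
    rw [e.idem] at this
    exact mul_left_cancel₀ hγ (by rw [← this, mul_one])
  obtain ⟨e', he'⟩ := exists_unitAlg_eq x h1
  refine ⟨γ, h1, ?_⟩
  -- If both factors have value 1 at γ and one of them is e', then all other characters vanish on
  -- the product, so the product is e'. This gives at once that e' is idempotent and absorbed by e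
  -- on both sides.
  have key : ∀ a b : 𝟙 x ⟶ 𝟙 x, FStar.char 𝕜 γ (unitAlg a) = 1 →
      FStar.char 𝕜 γ (unitAlg b) = 1 → (a = e' ∨ b = e') → a ≫ b = e' := by
    intro a b ha hb hab
    refine unitAlg_injective (FStar.char_injective fun δ => ?_)
    rw [char_unitAlg_comp, he', FStar.char_mob]
    by_cases h : γ = δ
    · subst h
      rw [ha, hb, if_pos rfl, mul_one]
    · rcases hab with rfl | rfl <;> rw [he', FStar.char_mob, if_neg h] <;> simp
  have h' : FStar.char 𝕜 γ (unitAlg e') = 1 := by rw [he', FStar.char_mob, if_pos rfl]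
  rcases e.primitive e' (key _ _ h' h' (Or.inl rfl)) (key _ _ hγ' h' (Or.inr rfl))
    (key _ _ h' hγ' (Or.inl rfl)) with h | h
  · rw [h, unitAlg_zero, map_zero] at h'
    exact absurd h' zero_ne_one
  · rw [← h, he']

/-- A Möbius idempotent is seen by a single character. An idempotent below it is seen by no other,
and its value there is 0 or 1, so it is zero or the whole. -/
theorem exists_primitiveIdempotent (x : Finitarization 𝕜 (BCat n)) {f : FStar n}
    (hf : 1 ≤ f.val) : ∃ e : PrimitiveIdempotent x, unitAlg e.val = FStar.mob 𝕜 f := by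
  classical
  obtain ⟨e, he⟩ := exists_unitAlg_eq x hf
  have h1 : FStar.char 𝕜 f (unitAlg e) = 1 := by rw [he, FStar.char_mob, if_pos rfl]
  refine ⟨⟨e, ?_, ?_, ?_⟩, he⟩
  · refine unitAlg_injective (FStar.char_injective fun δ => ?_)
    rw [char_unitAlg_comp, he, FStar.char_mob]
    split_ifs <;> simp
  · rintro rfl
    rw [unitAlg_zero, map_zero] at h1
    exact zero_ne_one h1
  · intro g hg heg _
    have hg0 : ∀ δ, f ≠ δ → FStar.char 𝕜 δ (unitAlg g) = 0 := fun δ h => by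
      rw [← heg, char_unitAlg_comp, he, FStar.char_mob, if_neg h, zero_mul]
    by_cases h0 : FStar.char 𝕜 f (unitAlg g) = 0
    · refine Or.inl (unitAlg_injective (FStar.char_injective fun δ => ?_))
      rw [unitAlg_zero, map_zero]
      by_cases h : f = δ
      · rw [← h, h0]
      · exact hg0 δ h
    · refine Or.inr (unitAlg_injective (FStar.char_injective fun δ => ?_))
      rw [he, FStar.char_mob]
      split_ifs with h
      · subst h
        have := char_unitAlg_comp f g g
        rw [hg] at this
        exact mul_left_cancel₀ h0 (by rw [← this, mul_one])
      · exact hg0 δ h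

/-- The value of a character on an endomorphism of an indecomposable 1-morphism. -/
noncomputable def endValue {x y : Finitarization 𝕜 (BCat n)} {s : FStar n} (γ : FStar n)
    (f : (krullSchmidt 𝕜 x y).T s ⟶ (krullSchmidt 𝕜 x y).T s) : 𝕜 :=
  (char 𝕜 γ).app (X := Free.of 𝕜 (base s)) (Y := Free.of 𝕜 (base s))
    (MatCat.ent (C := Free 𝕜 (Hom₁ n)) (Karoubi.Hom.f f) () ())

theorem endValue_comp {x y : Finitarization 𝕜 (BCat n)} {s : FStar n} (γ : FStar n)
    (f g : (krullSchmidt 𝕜 x y).T s ⟶ (krullSchmidt 𝕜 x y).T s) :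
    endValue γ (f ≫ g) = endValue γ f * endValue γ g := by
  let _ : Unique ((krullSchmidt 𝕜 x y).T s : Karoubi (Mat_ (Free 𝕜 (Hom₁ n)))).X.ι :=
    ⟨⟨()⟩, fun _ => rfl⟩
  exact (char 𝕜 γ).value_comp (P := (krullSchmidt 𝕜 x y).T s) (Q := (krullSchmidt 𝕜 x y).T s)
    (R := (krullSchmidt 𝕜 x y).T s) f g

open Classical in
theorem endValue_id {x y : Finitarization 𝕜 (BCat n)} {s : FStar n} (γ : FStar n) :
    endValue γ (𝟙 ((krullSchmidt 𝕜 x y).T s)) = if s = γ then 1 else 0 :=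
  char_elem (base_le s) (base_le s) γ

/-- An endomorphism f of T_s satisfies f = f ≫ 𝟙, and the identity of T_s is the Möbius idempotent
of s. So all characters except that of s vanish on f, and f is determined by one scalar. -/
theorem eq_id_iff_endValue {x y : Finitarization 𝕜 (BCat n)} {s : FStar n}
    (f : (krullSchmidt 𝕜 x y).T s ⟶ (krullSchmidt 𝕜 x y).T s) :
    f = 𝟙 _ ↔ endValue s f = 1 := by
  classical
  constructor
  · rintro rfl
    rw [endValue_id, if_pos rfl]
  · intro h
    refine Karoubi.Hom.ext (MatCat.mat_ext fun _ _ =>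
      ext_char (π := base s) (σ := base s) fun γ => ?_)
    change endValue γ f = endValue γ (𝟙 _)
    by_cases hγ : s = γ
    · rw [← hγ, h, endValue_id, if_pos rfl]
    · rw [← Category.comp_id f, endValue_comp, endValue_id, if_neg hγ, mul_zero]

/-- The action of e is the whiskering of e conjugated by the left unitor. On families with one
member the characters are multiplicative with commuting values, so the unitor contributes only the
value of the identity, and the whiskering is a product in the semigroup algebra. -/
theorem endValue_lact {x y : Finitarization 𝕜 (BCat n)} {s : FStar n} (γ : FStar n)
    (e : 𝟙 x ⟶ 𝟙 x) : endValue γ (SplitCat.lact e ((krullSchmidt 𝕜 x y).T s)) =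
      FStar.char 𝕜 γ (FStar.mob 𝕜 s * unitAlg e) * endValue γ (𝟙 ((krullSchmidt 𝕜 x y).T s)) := by
  let T : Karoubi (Mat_ (Free 𝕜 (Hom₁ n))) := (krullSchmidt 𝕜 x y).T s
  let P : Karoubi (Mat_ (Free 𝕜 (Hom₁ n))) := 𝟙 x ≫ (krullSchmidt 𝕜 x y).T s
  let _ : Unique T.X.ι := ⟨⟨()⟩, fun _ => rfl⟩
  let _ : Unique P.X.ι := ⟨⟨((), ())⟩, fun _ => rfl⟩
  let l : P ≅ T := λ_ ((krullSchmidt 𝕜 x y).T s)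
  let m : P ⟶ P := e ▷ (krullSchmidt 𝕜 x y).T s
  have hm : (char 𝕜 γ).value m = FStar.char 𝕜 γ (FStar.mob 𝕜 s * unitAlg e) := by
    refine (char_toAlg (π := comp₁ ⟨1⟩ (base s)) (σ := comp₁ ⟨1⟩ (base s)) γ
      (MatCat.ent m.f default default)).symm.trans (congrArg _ ?_)
    refine (congrArg toAlg (MatCat.ent_hc _ _ _ _)).trans ?_
    refine (toAlg_lhc (x := .pt) (y := .pt) (z := .pt) _ _).trans ?_
    exact congrArg (· * _) (toAlg_elem (𝕜 := 𝕜) (base_le s) (base_le s))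
  change (char 𝕜 γ).value (l.inv ≫ m ≫ l.hom) = _ * (char 𝕜 γ).value (𝟙 T)
  rw [← l.inv_hom_id, MorphismChar.value_comp, MorphismChar.value_comp, MorphismChar.value_comp,
    hm]
  ring

theorem endValue_ract {x y : Finitarization 𝕜 (BCat n)} {s : FStar n} (γ : FStar n)
    (e : 𝟙 y ⟶ 𝟙 y) : endValue γ (SplitCat.ract ((krullSchmidt 𝕜 x y).T s) e) =
      FStar.char 𝕜 γ (unitAlg e * FStar.mob 𝕜 s) * endValue γ (𝟙 ((krullSchmidt 𝕜 x y).T s)) := by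
  let T : Karoubi (Mat_ (Free 𝕜 (Hom₁ n))) := (krullSchmidt 𝕜 x y).T s
  let P : Karoubi (Mat_ (Free 𝕜 (Hom₁ n))) := (krullSchmidt 𝕜 x y).T s ≫ 𝟙 y
  let _ : Unique T.X.ι := ⟨⟨()⟩, fun _ => rfl⟩
  let _ : Unique P.X.ι := ⟨⟨((), ())⟩, fun _ => rfl⟩
  let l : P ≅ T := ρ_ ((krullSchmidt 𝕜 x y).T s)
  let m : P ⟶ P := (krullSchmidt 𝕜 x y).T s ◁ e
  have hm : (char 𝕜 γ).value m = FStar.char 𝕜 γ (unitAlg e * FStar.mob 𝕜 s) := by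
    refine (char_toAlg (π := comp₁ (base s) ⟨1⟩) (σ := comp₁ (base s) ⟨1⟩) γ
      (MatCat.ent m.f default default)).symm.trans (congrArg _ ?_)
    refine (congrArg toAlg (MatCat.ent_hc _ _ _ _)).trans ?_
    refine (toAlg_lhc (x := .pt) (y := .pt) (z := .pt) _ _).trans ?_
    exact congrArg (_ * ·) (toAlg_elem (𝕜 := 𝕜) (base_le s) (base_le s))
  change (char 𝕜 γ).value (l.inv ≫ m ≫ l.hom) = _ * (char 𝕜 γ).value (𝟙 T)
  rw [← l.inv_hom_id, MorphismChar.value_comp, MorphismChar.value_comp, MorphismChar.value_comp,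
    hm]
  ring

/-- The partition that corresponds to an object of the 2-category obtained by splitting. -/
noncomputable def objKer (x : SplitCat (Finitarization 𝕜 (BCat n))) : Setoid (Fin n) :=
  FStar.ker (exists_unitAlg_primitiveIdempotent x.idem).choose

theorem exists_unitAlg_idem (x : SplitCat (Finitarization 𝕜 (BCat n))) :
    ∃ f : FStar n, 1 ≤ f.val ∧ unitAlg x.idem.val = FStar.mob 𝕜 f ∧ FStar.ker f = objKer x :=
  have h := (exists_unitAlg_primitiveIdempotent x.idem).choose_spec
  ⟨_, h.1, h.2, rfl⟩

theorem mob_injective : Function.Injective (FStar.mob 𝕜 (n := n)) := by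
  classical
  intro s t h
  by_contra hst
  have := congrArg (FStar.char 𝕜 s) h
  rw [FStar.char_mob, FStar.char_mob, if_pos rfl, if_neg (Ne.symm hst)] at this
  exact one_ne_zero this

theorem objKer_injective : Function.Injective (objKer (𝕜 := 𝕜) (n := n)) := by
  -- There is only one object of B_n, so an object after splitting amounts to a primitive
  -- idempotent, and this is fixed by the kernel of its label.
  rintro ⟨⟨⟨⟨⟨⟩⟩⟩⟩, e⟩ ⟨⟨⟨⟨⟨⟩⟩⟩⟩, e'⟩ h
  obtain ⟨f, hf, he, hK⟩ := exists_unitAlg_idem (⟨_, e⟩ : SplitCat (Finitarization 𝕜 (BCat n)))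
  obtain ⟨f', hf', he', hK'⟩ := exists_unitAlg_idem (⟨_, e'⟩ : SplitCat (Finitarization 𝕜 (BCat n)))
  obtain rfl := FStar.eq_of_ker_eq (s := 1) hf hf' (hK.trans (h.trans hK'.symm))
  have hv := unitAlg_injective (he.trans he'.symm)
  obtain ⟨v, _, _, _⟩ := e
  obtain ⟨v', _, _, _⟩ := e'
  obtain rfl : v = v' := hv
  rfl

theorem objKer_surjective : Function.Surjective (objKer (𝕜 := 𝕜) (n := n)) := by
  intro K
  obtain ⟨f, hf, rfl⟩ := FStar.exists_one_le_ker_eq K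
  obtain ⟨e, he⟩ := exists_primitiveIdempotent (Finitarization.obj 𝕜 (BCat.pt : BCat n)) hf
  refine ⟨⟨_, e⟩, ?_⟩
  obtain ⟨f', -, he', hK'⟩ := exists_unitAlg_idem (⟨_, e⟩ : SplitCat (Finitarization 𝕜 (BCat n)))
  rw [← hK', mob_injective (he'.symm.trans he)]

/-- The objects x and y carry the Möbius idempotents of some f and g. The value of the cut at s is
the product of the values of the actions of f on the right and g on the left of the Möbius element
of s. By the groupoid rule each is 1 or 0 according to whether the kernel, respectively the
cokernel, matches. -/
theorem cut_eq_id_iff (x y : SplitCat (Finitarization 𝕜 (BCat n))) (s : FStar n) :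
    (FStar.ker s = objKer x ∧ FStar.coker s = objKer y) ↔
      SplitCat.cut x y ((krullSchmidt 𝕜 x.obj y.obj).T s) = 𝟙 _ := by
  classical
  obtain ⟨f, hf, he, hK⟩ := exists_unitAlg_idem x
  obtain ⟨g, hg, he', hK'⟩ := exists_unitAlg_idem y
  rw [eq_id_iff_endValue, SplitCat.cut, endValue_comp, endValue_lact, endValue_ract, endValue_id,
    if_pos rfl, he, he', FStar.mob_mul_mob, FStar.mob_mul_mob, FStar.coker_eq_ker hf, hK, hK',
    mul_one, mul_one]
  by_cases h1 : FStar.ker s = objKer x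
  · by_cases h2 : FStar.coker s = objKer y
    · rw [if_pos h1, if_pos h2.symm, FStar.mul_eq_left hf (h1.trans hK.symm),
        FStar.mul_eq_right hg (h2.trans hK'.symm), FStar.char_mob, if_pos rfl]
      simp [h1, h2]
    · rw [if_neg (Ne.symm h2)]
      simp [h2]
  · rw [if_neg h1]
    simp [h1]

variable (𝕜) in
/-- The Krull-Schmidt property of the 2-category obtained by splitting from the finitarization of
`B_n`. -/
noncomputable def krullSchmidtSplit (x y : SplitCat (Finitarization 𝕜 (BCat n))) :
    KrullSchmidt (x ⟶ y) {s : FStar n // FStar.ker s = objKer x ∧ FStar.coker s = objKer y} :=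
  (krullSchmidt 𝕜 x.obj y.obj).split _ (cut_eq_id_iff x y)

variable (𝕜) in
/-- The elements of `F*_n`, sorted by their kernels and cokernels. -/
noncomputable def sigmaEquiv (n : ℕ) : FStar n ≃ Σ p : SplitCat (Finitarization 𝕜 (BCat n)) ×
    SplitCat (Finitarization 𝕜 (BCat n)),
    {s : FStar n // FStar.ker s = objKer p.1 ∧ FStar.coker s = objKer p.2} :=
  (Equiv.ofBijective (fun p => p.2.val) (by
    constructor
    · rintro ⟨⟨x, y⟩, s, hx, hy⟩ ⟨⟨x', y'⟩, s', hx', hy'⟩ (rfl : s = s')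
      obtain rfl := objKer_injective (hx.symm.trans hx')
      obtain rfl := objKer_injective (hy.symm.trans hy')
      rfl
    · intro s
      obtain ⟨x, hx⟩ := objKer_surjective (𝕜 := 𝕜) (FStar.ker s)
      obtain ⟨y, hy⟩ := objKer_surjective (𝕜 := 𝕜) (FStar.coker s)
      exact ⟨⟨(x, y), s, hx.symm, hy.symm⟩, rfl⟩)).symm

/-- Sorted by kernel and cokernel, F*_n labels the indecomposables of all morphism categories.
Composable objects satisfy ker t = coker s, where both sides multiply to the label `t * s`; if the
middle objects differ, so do the partitions, and the Möbius elements multiply to zero. -/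
theorem exists_ringEquiv (n : ℕ) (𝕜 : Type w) [Field 𝕜] :
    ∃ φ : DecatAlgebra (SplitCat (Finitarization 𝕜 (BCat n))) ≃+* MonoidAlgebra ℤ (FStar n),
      φ '' indecomposableClasses (SplitCat (Finitarization 𝕜 (BCat n))) =
        Set.range FStar.moebius := by
  classical
  obtain ⟨b, hb⟩ := FStar.exists_basis_moebius (n := n)
  have hb' : ∀ p, b.reindex (sigmaEquiv 𝕜 n) p = FStar.mob ℤ p.2.val := fun p => by
    rw [Module.Basis.reindex_apply, hb, FStar.mob_int]
    rfl
  obtain ⟨φ, -, hφ⟩ := exists_decatAlgebra_ringEquiv (krullSchmidtSplit 𝕜 (n := n))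
    (b.reindex (sigmaEquiv 𝕜 n)) (by
      rintro x y z ⟨s, hs⟩ ⟨t, ht⟩
      have h : FStar.ker t = FStar.coker s := ht.1.trans hs.2.symm
      refine ⟨⟨t * s, (FStar.ker_mul_of_eq h).trans hs.1, (FStar.coker_mul_of_eq h).trans ht.2⟩,
        ?_, ?_⟩
      · obtain ⟨e⟩ := krullSchmidt_comp x.obj y.obj z.obj h
        exact SplitCat.comp_iso ((cut_eq_id_iff x y s).1 hs) ((cut_eq_id_iff y z t).1 ht) e
      · rw [hb', hb', hb', FStar.mob_mul_mob, if_pos h]) (by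
      rintro x y y' z ⟨s, hs⟩ ⟨t, ht⟩ hne
      rw [hb', hb', FStar.mob_mul_mob, if_neg]
      intro h
      exact hne (objKer_injective (hs.2.symm.trans (h.symm.trans ht.1))))
  refine ⟨φ, hφ.trans ?_⟩
  rw [Module.Basis.range_reindex, ← funext hb]

end BCat

namespace OrdMonCat

instance (𝕜 : Type w) [Field 𝕜] (S : Type u) : Unique (Finitarization 𝕜 (OrdMonCat S)) where
  default := Finitarization.obj 𝕜 .pt
  uniq := by
    rintro ⟨⟨⟨⟨⟩⟩⟩⟩
    rfl

variable {S : Type u} [PartialOrder S] [Monoid S] [MulLeftMono S] [MulRightMono S] [Finite S]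

theorem nonempty_map_hom_iso (𝕜 : Type w) [Field 𝕜] (s : S) :
    Nonempty (Finitarization.map 𝕜 (hom s) ≅ (krullSchmidt 𝕜 _ _).T s) := by
  let P : Karoubi (Mat_ (Free 𝕜 (Hom₁ S))) := Finitarization.map 𝕜 (hom s)
  let _ : Unique P.X.ι := ⟨⟨()⟩, fun _ => rfl⟩
  have h : MatCat.ent P.p default default = 𝟙 (Free.of 𝕜 (Hom₁.mk s)) := MatCat.ent_id P.X default
  refine (separatingChars (S := S) (𝕜 := 𝕜)).nonempty_iso_T (P := P) ?_ ?_
  · rw [h]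
    exact char_id 𝕜 _ _ rfl
  · intro r hr
    rw [h]
    exact char_id_of_ne 𝕜 _ _ (Ne.symm hr)

variable (S) in
theorem exists_ringEquiv (𝕜 : Type w) [Field 𝕜] :
    ∃ ψ : DecatAlgebra (Finitarization 𝕜 (OrdMonCat S)) ≃+* MonoidAlgebra ℤ S,
      ψ '' indecomposableClasses (Finitarization 𝕜 (OrdMonCat S)) =
        Set.range (MonoidAlgebra.of ℤ S) ∧
      ∀ s : S, ψ (DecatAlgebra.cls (Finitarization.map 𝕜 (hom s))) = MonoidAlgebra.of ℤ S s := by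
  let b : Module.Basis S ℤ (MonoidAlgebra ℤ S) := MonoidAlgebra.basis S ℤ
  have hb : ∀ s, b s = MonoidAlgebra.of ℤ S s := fun s => rfl
  let e : S ≃ Σ _ : Finitarization 𝕜 (OrdMonCat S) × Finitarization 𝕜 (OrdMonCat S), S :=
    ⟨fun s => ⟨default, s⟩, fun p => p.2, fun _ => rfl,
      fun p => Sigma.ext (Subsingleton.elim _ _) HEq.rfl⟩
  have hb' : ∀ p, b.reindex e p = MonoidAlgebra.of ℤ S p.2 := fun p => by
    rw [Module.Basis.reindex_apply, hb]
    rfl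
  obtain ⟨ψ, hψ, hψ'⟩ := exists_decatAlgebra_ringEquiv (krullSchmidt 𝕜 (S := S)) (b.reindex e)
    (fun x y z s t => ⟨t * s, krullSchmidt_comp x y z s t, by
      rw [hb', hb', hb', map_mul]⟩)
    -- There is only one object, so every pair of 1-morphisms is composable.
    (fun _ y y' _ _ _ h => absurd (Subsingleton.elim y y') h)
  refine ⟨ψ, hψ'.trans ?_, fun s => ?_⟩
  · rw [Module.Basis.range_reindex, ← funext hb]
  · obtain ⟨i⟩ := nonempty_map_hom_iso 𝕜 s
    rw [DecatAlgebra.cls_eq i]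
    exact (hψ _ _ s).trans (hb' _)

end OrdMonCat

end FiatCat

theorem theorem5p2 (n : ℕ) (𝕜 : Type*) [Field 𝕜] :
    (∃ b : Module.Basis (FiatCat.FStar n) ℤ (MonoidAlgebra ℤ (FiatCat.FStar n)),
      ∀ s, b s = FiatCat.FStar.moebius s) ∧
    (∃ φ : FiatCat.DecatAlgebra (FiatCat.SplitCat (FiatCat.Finitarization 𝕜 (FiatCat.BCat n))) ≃+*
        MonoidAlgebra ℤ (FiatCat.FStar n),
      φ '' FiatCat.indecomposableClasses
          (FiatCat.SplitCat (FiatCat.Finitarization 𝕜 (FiatCat.BCat n))) =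
        Set.range FiatCat.FStar.moebius) ∧
    (∃ ψ : FiatCat.DecatAlgebra
          (FiatCat.Finitarization 𝕜 (FiatCat.OrdMonCat (FiatCat.FStar n))) ≃+*
        MonoidAlgebra ℤ (FiatCat.FStar n),
      ψ '' FiatCat.indecomposableClasses
          (FiatCat.Finitarization 𝕜 (FiatCat.OrdMonCat (FiatCat.FStar n))) =
        Set.range (MonoidAlgebra.of ℤ (FiatCat.FStar n)) ∧
      ∀ s : FiatCat.FStar n,
        ψ (FiatCat.DecatAlgebra.cls (FiatCat.Finitarization.map 𝕜 (FiatCat.OrdMonCat.hom s))) =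
          MonoidAlgebra.of ℤ (FiatCat.FStar n) s) :=
  ⟨FiatCat.FStar.exists_basis_moebius, FiatCat.BCat.exists_ringEquiv n 𝕜,
    FiatCat.OrdMonCat.exists_ringEquiv (FiatCat.FStar n) 𝕜⟩
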